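/- Let $\alpha\in(0,1]$. Let $P$ be a Borel probability measure on $\mathbb{R}^d$ supported on a compact convex set $\mathcal X\subset\mathbb{R}^d$ with nonempty interior, with a Lebesgue density $\rho$ that is Lipschitz continuous and strictly positive on $\mathcal X$. Let $\mathcal Y=\{y_1,\dots,y_N\}\subset\mathbb{R}^d$ be a finite set and let $c_0\in(0,1)$. Then there is a constant $C>0$, depending only on $\alpha,\mathcal X,\rho,\mathcal Y$ and $c_0$, such that the following holds. Let $Q$ be any probability measure with support $\mathcal Y$ and $\min_{1\le i\le N}Q(\{y_i\})\ge c_0$. Let $T^0$ be the Brenier map from $P$ to $Q$, that is, the $P$-a.e. unique map for which the image of $P$ under $x\mapsto(x,T^0(x))$ minimizes $\int\|x-y\|^2\,d\pi(x,y)$ over the set $\Pi(P,Q)$ of couplings $\pi$ of $P$ and $Q$. For $\varepsilon>0$ let $\pi^\varepsilon$ be the unique maximizer over $\Pi(P,Q)$ of $\int\langle x,y\rangle\,d\pi(x,y)-\varepsilon D_{\mathsf{KL}}(\pi\,\|\,P\otimes Q)$, where $D_{\mathsf{KL}}$ is the Kullback--Leibler divergence, and let $T^\varepsilon(x)=\mathbb{E}_{(X,Y)\sim\pi^\varepsilon}[Y\mid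 X=x]$ be the entropic map. Then for every $\alpha$-Hölder vector field $\varphi:\mathcal X\to\mathbb{R}^d$ and every $\varepsilon\in(0,1)$, $$\left|\int\langle\varphi(x),T^\varepsilon(x)-T^0(x)\rangle\,dP(x)\right|\le C\left(\|\varphi\|_\infty\,\varepsilon^2\log^3(1/\varepsilon)+\|\varphi\|_{\mathcal C^\alpha}\,\varepsilon^{1+\alpha}\right),$$ where $\|\varphi\|_\infty=\sup_{x\in\mathcal X}\|\varphi(x)\|$ and $\|\varphi\|_{\mathcal C^\alpha}=\|\varphi\|_\infty+\sup_{x,y\in\mathcal X,\,x\ne y}\|\varphi(x)-\varphi(y)\|/\|x-y\|^\alpha$. -/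

import Mathlib

open MeasureTheory
open scoped NNReal ENNReal

noncomputable section

namespace EntropicOT

/-- Euclidean space `ℝ^d`. -/
abbrev Rd (d : ℕ) : Type := EuclideanSpace ℝ (Fin d)

/-- `π` is a coupling of `P` and `Q`: its marginals are `P` and `Q`. -/
def IsCoupling {d : ℕ} (P Q : Measure (Rd d)) (π : Measure (Rd d × Rd d)) : Prop :=
  π.map Prod.fst = P ∧ π.map Prod.snd = Q

/-- The quadratic transport cost `∫ ‖x - y‖² dπ(x, y)`, with values in `[0, ∞]`. -/
def quadraticCost {d : ℕ} (π : Measure (Rd d × Rd d)) : ℝ≥0∞ :=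
  ∫⁻ p, ENNReal.ofReal (‖p.1 - p.2‖ ^ 2) ∂π

/-- `π` is an optimal coupling of `P` and `Q` for the quadratic cost. -/
def IsOptimalPlan {d : ℕ} (P Q : Measure (Rd d)) (π : Measure (Rd d × Rd d)) : Prop :=
  IsCoupling P Q π ∧ ∀ π', IsCoupling P Q π' → quadraticCost π ≤ quadraticCost π'

/-- `T` is (a version of) the Brenier map from `P` to `Q`: the image of `P` under
`x ↦ (x, T x)` is an optimal coupling of `P` and `Q`. -/
def IsBrenierMap {d : ℕ} (P Q : Measure (Rd d)) (T : Rd d → Rd d) : Prop :=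
  AEMeasurable T P ∧ IsOptimalPlan P Q (P.map fun x => (x, T x))

/-- The entropic objective `∫ ⟪x, y⟫ dπ(x, y) - ε * KL(π ‖ P ⊗ Q)`; it is `-∞` where the
relative entropy is infinite. -/
def entropicObjective {d : ℕ} (P Q : Measure (Rd d)) (ε : ℝ) (π : Measure (Rd d × Rd d)) :
    EReal :=
  ((∫ p, inner ℝ p.1 p.2 ∂π : ℝ) : EReal)
    - (ε : EReal) * ((InformationTheory.klDiv π (P.prod Q) : ℝ≥0∞) : EReal)

/-- `π` is an optimal coupling for the entropic optimal transport problem with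
regularization parameter `ε`. -/
def IsEntropicPlan {d : ℕ} (P Q : Measure (Rd d)) (ε : ℝ) (π : Measure (Rd d × Rd d)) : Prop :=
  IsCoupling P Q π ∧
    ∀ π', IsCoupling P Q π' → entropicObjective P Q ε π' ≤ entropicObjective P Q ε π

/-- `T` is (a version of) the entropic map: `T x = 𝔼[Y | X = x]` when `(X, Y)` is distributed
according to the optimal entropic coupling. -/
def IsEntropicMap {d : ℕ} (P Q : Measure (Rd d)) (ε : ℝ) (T : Rd d → Rd d) : Prop :=
  AEMeasurable T P ∧ ∃ π : Measure (Rd d × Rd d), IsEntropicPlan P Q ε π ∧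
    (fun p : Rd d × Rd d => T p.1) =ᵐ[π]
      π[fun p : Rd d × Rd d => p.2 |
        MeasurableSpace.comap (Prod.fst : Rd d × Rd d → Rd d) inferInstance]

/-- The measure supported on `X` with Lebesgue density `ρ` there. -/
def densityMeasure {d : ℕ} (X : Set (Rd d)) (ρ : Rd d → ℝ) : Measure (Rd d) :=
  (volume.restrict X).withDensity fun x => ENNReal.ofReal (ρ x)

/-- `φ` is `α`-Hölder on `X`. -/
def IsHolderOn {d : ℕ} (α : ℝ) (X : Set (Rd d)) (φ : Rd d → Rd d) : Prop :=
  ∃ K : ℝ, ∀ x ∈ X, ∀ y ∈ X, ‖φ x - φ y‖ ≤ K * ‖x - y‖ ^ α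

/-- `‖φ‖_∞ = sup_{x ∈ X} ‖φ x‖`. -/
def supNorm {d : ℕ} (X : Set (Rd d)) (φ : Rd d → Rd d) : ℝ :=
  sSup ((fun x => ‖φ x‖) '' X)

/-- `‖φ‖_{C^α} = ‖φ‖_∞ + sup_{x ≠ y ∈ X} ‖φ x - φ y‖ / ‖x - y‖ ^ α`. -/
def holderNorm {d : ℕ} (α : ℝ) (X : Set (Rd d)) (φ : Rd d → Rd d) : ℝ :=
  supNorm X φ +
    sSup {r : ℝ | ∃ x ∈ X, ∃ y ∈ X, x ≠ y ∧ r = ‖φ x - φ y‖ / ‖x - y‖ ^ α}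

end EntropicOT

end

/-!
The sites are finitely many, so both maps are explicit. For offsets `g : ι → ℝ` write
`score y g i x = ⟪x, y i⟫ - g i`. The Brenier map sends the Laguerre cell of `i`, where the score of
`i` is maximal, to `y i`, for offsets `g₀` such that the cells have the masses of `Q`
(`exists_measureReal_cell_eq`, `ae_eq_laguerreMap_of_isBrenierMap`). The entropic map is
`∑ i, softmax y g ε i x • y i`, for offsets `g` such that the softmax weights have these masses
(`exists_integral_softmax_eq`, `ae_eq_softmax_of_isEntropicMap`). So it suffices to integrate a Hölder
function `ψ = ⟪φ, y i⟫` against `softmax y g ε i - 1_{cell y g₀ i}`. Two estimates do this.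

*Smoothing error*, with the same offsets `g` on both sides
(`exists_abs_integral_softmax_sub_indicator_le`). The difference of softmax and indicator is of size
`exp (-|t| / ε)` at distance `t` from the boundary of the cell, which by itself gives only `O(ε)`.
Near the common facet of two cells, and away from all others, the weights depend only on the
difference of the two scores, through the even function `halfSigmoid`, and softmax minus indicator
takes opposite signs on the two sides. Reflection in the facet therefore cancels the main term and
leaves the oscillation of the test function across the layer, of order `ε ^ (1 + α)`
(`exists_abs_integral_halfSigmoid_le`). The reflection fails only near lower-dimensional strata:
where a third score is within `O(ε log (1 / ε))` of the two, or where the facet meets the boundary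
of `X`. These strata contribute `O(ε ^ 2 log² (1 / ε))`, by transversality of hyperplanes
(`exists_integral_exp_triple_le`) and by convexity of `X` (`exists_integral_exp_defect_le`); the
lower bound on the masses of the cells makes the constants uniform in `g`, also when hyperplanes are
parallel.

*Stability*, from `g` to `g₀` (`exists_measureReal_cell_sdiff_le`). The smoothing error against the
constant function shows that the cells of `g` have the masses of `Q` up to `O(ε ^ 2 log² (1 / ε))`.
If two families of offsets differ, up to a common constant, by `δ`, there is a gap in the differences:
cells on one side of it gain mass across their boundary. The boundary carries a layer of mass at least of
order `δ`, by the isoperimetric property of `X` (`exists_le_measureReal_layer`). So the distance of the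
offsets, and with it the measure of the symmetric differences of the cells, is controlled by the
difference of the masses.

The two estimates combine in `exists_abs_integral_mul_softmax_sub_cell_le`. It requires `ε` to be small;
for larger `ε` the claim is the trivial bound by `‖φ‖_∞`.
-/

open Filter
open scoped Topology

namespace EntropicOT

/-! ### Integrals of functions of one or two linear forms over a ball -/

/-- Fubini in the direction `u`, in the form of an average over the translations by `s • u`,
`s ∈ [0, 1]`. -/
lemma lintegral_ball_inner_mul_le {d : ℕ} {u v : Rd d} (huv : inner ℝ u v = 1) (R : ℝ)
    {f : ℝ → ℝ≥0∞} (hf : Measurable f) {k : Rd d → ℝ≥0∞} (hk : Measurable k)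
    (hku : ∀ x (s : ℝ), k (x + s • u) = k x) :
    ∫⁻ x in Metric.closedBall 0 R, f (inner ℝ x v) * k x ≤
      (∫⁻ t, f t) * ∫⁻ x in Metric.closedBall 0 (R + ‖u‖), k x := by
  have hm : Measurable fun x : Rd d => f (inner ℝ x v) * k x :=
    (hf.comp (by fun_prop)).mul hk
  set G : Rd d → ℝ≥0∞ :=
    (Metric.closedBall 0 R).indicator fun x => f (inner ℝ x v) * k x with hG
  have hGm : Measurable G := hm.indicator Metric.isClosed_closedBall.measurableSet
  have h1 : ∫⁻ x in Metric.closedBall 0 R, f (inner ℝ x v) * k x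
      = ∫⁻ s in Set.Icc (0 : ℝ) 1, ∫⁻ x, G (x + s • u) := by
    rw [← lintegral_indicator Metric.isClosed_closedBall.measurableSet]
    simp_rw [lintegral_add_right_eq_self G]
    simp [hG]
  rw [h1, lintegral_lintegral_swap (by fun_prop),
    ← lintegral_indicator (s := Metric.closedBall 0 (R + ‖u‖))
      Metric.isClosed_closedBall.measurableSet,
    ← lintegral_const_mul _ (hk.indicator Metric.isClosed_closedBall.measurableSet)]
  refine lintegral_mono fun x => ?_
  by_cases hx : x ∈ Metric.closedBall (0 : Rd d) (R + ‖u‖)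
  · rw [Set.indicator_of_mem hx]
    calc ∫⁻ s in Set.Icc (0 : ℝ) 1, G (x + s • u)
        ≤ ∫⁻ s in Set.Icc (0 : ℝ) 1, f (inner ℝ x v + s) * k x := by
          refine lintegral_mono fun s => ?_
          refine (Set.indicator_le_self _ _ _).trans ?_
          simp only [hku, inner_add_left, inner_smul_left, huv]
          simp
      _ ≤ ∫⁻ s, f (inner ℝ x v + s) * k x := setLIntegral_le_lintegral _ _
      _ = (∫⁻ t, f t) * k x := by
          rw [lintegral_mul_const _ (by fun_prop), lintegral_add_left_eq_self f]
  · rw [Set.indicator_of_notMem hx, mul_zero]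
    refine le_of_eq ?_
    rw [setLIntegral_congr_fun (g := fun _ => 0) measurableSet_Icc, lintegral_zero]
    intro s hs
    refine Set.indicator_of_notMem (fun hs' => hx ?_) _
    simp only [mem_closedBall_zero_iff] at hs' ⊢
    have h2 : ‖s • u‖ ≤ ‖u‖ := by
      rw [norm_smul, Real.norm_of_nonneg hs.1]
      exact mul_le_of_le_one_left (norm_nonneg _) hs.2
    calc ‖x‖ = ‖(x + s • u) - s • u‖ := by simp
      _ ≤ ‖x + s • u‖ + ‖s • u‖ := norm_sub_le _ _
      _ ≤ R + ‖u‖ := add_le_add hs' h2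

lemma exists_lintegral_inner_le {d : ℕ} {X : Set (Rd d)} (hX : IsCompact X) {v : Rd d}
    (hv : v ≠ 0) :
    ∃ C : ℝ, 0 ≤ C ∧ ∀ f : ℝ → ℝ≥0∞, Measurable f →
      ∫⁻ x in X, f (inner ℝ x v) ≤ ENNReal.ofReal C * ∫⁻ t, f t := by
  obtain ⟨R, hR⟩ := hX.isBounded.subset_closedBall 0
  set u : Rd d := (‖v‖ ^ 2)⁻¹ • v
  have huv : inner ℝ u v = 1 := by
    simp only [u, inner_smul_left, real_inner_self_eq_norm_sq]
    simp [hv]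
  refine ⟨volume.real (Metric.closedBall (0 : Rd d) (R + ‖u‖)), measureReal_nonneg,
    fun f hf => ?_⟩
  refine (lintegral_mono_set hR).trans ?_
  have := lintegral_ball_inner_mul_le huv R hf (k := fun _ => 1) measurable_const
    (fun _ _ => rfl)
  simp only [mul_one, lintegral_const, Measure.restrict_apply MeasurableSet.univ,
    Set.univ_inter, one_mul] at this
  rwa [measureReal_def, ENNReal.ofReal_toReal
    (Metric.isBounded_closedBall.measure_lt_top.ne), mul_comm]

/-- For linearly independent `v`, `w` there is a vector orthogonal to `w` that is dual to `v`. -/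
lemma exists_dual_vector {d : ℕ} {v w : Rd d} (h : LinearIndependent ℝ ![v, w]) :
    ∃ u : Rd d, inner ℝ u v = 1 ∧ inner ℝ u w = 0 := by
  have hw : w ≠ 0 := h.ne_zero 1
  rw [LinearIndependent.pair_symm_iff, LinearIndependent.pair_iff' hw] at h
  set c : ℝ := inner ℝ v w / ‖w‖ ^ 2
  set u : Rd d := v - c • w with hu
  have hu0 : u ≠ 0 := fun h0 => h c (by rw [hu, sub_eq_zero] at h0; exact h0.symm)
  have huw : inner ℝ u w = 0 := by
    have : ‖w‖ ^ 2 ≠ 0 := by positivity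
    simp only [hu, inner_sub_left, inner_smul_left, real_inner_self_eq_norm_sq, c]
    simp only [conj_trivial]
    field_simp
    simp
  have huv : inner ℝ u v = ‖u‖ ^ 2 := by
    have : v = u + c • w := by simp [hu]
    conv_lhs => rw [this]
    rw [inner_add_right, inner_smul_right, huw, real_inner_self_eq_norm_sq]
    simp
  refine ⟨(‖u‖ ^ 2)⁻¹ • u, ?_, ?_⟩
  · rw [inner_smul_left, huv]
    simp [hu0]
  · rw [inner_smul_left, huw, mul_zero]

lemma exists_lintegral_inner_inner_le {d : ℕ} {X : Set (Rd d)} (hX : IsCompact X) {v w : Rd d}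
    (h : LinearIndependent ℝ ![v, w]) :
    ∃ C : ℝ, 0 ≤ C ∧ ∀ f k : ℝ → ℝ≥0∞, Measurable f → Measurable k →
      ∫⁻ x in X, f (inner ℝ x v) * k (inner ℝ x w) ≤
        ENNReal.ofReal C * ((∫⁻ t, f t) * ∫⁻ t, k t) := by
  obtain ⟨R, hR⟩ := hX.isBounded.subset_closedBall 0
  obtain ⟨u, huv, huw⟩ := exists_dual_vector h
  have hw : w ≠ 0 := h.ne_zero 1
  obtain ⟨C, hC0, hC⟩ := exists_lintegral_inner_le
    (isCompact_closedBall (0 : Rd d) (R + ‖u‖)) hw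
  refine ⟨C, hC0, fun f k hf hk => ?_⟩
  refine (lintegral_mono_set hR).trans ?_
  refine (lintegral_ball_inner_mul_le huv R hf (k := fun x => k (inner ℝ x w))
    (by fun_prop) fun x s => ?_).trans ?_
  · simp [inner_add_left, inner_smul_left, huw]
  · calc (∫⁻ t, f t) * ∫⁻ x in Metric.closedBall 0 (R + ‖u‖), k (inner ℝ x w)
        ≤ (∫⁻ t, f t) * (ENNReal.ofReal C * ∫⁻ t, k t) := by gcongr; exact hC k hk
      _ = _ := by ring

/-! ### Strips and exponentials of affine functions -/

lemma lintegral_exp_neg_abs {ε : ℝ} (hε : 0 < ε) (b : ℝ) :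
    ∫⁻ t : ℝ, ENNReal.ofReal (Real.exp (-|t - b| / ε)) = ENNReal.ofReal (2 * ε) := by
  rw [lintegral_sub_right_eq_self (fun t : ℝ => ENNReal.ofReal (Real.exp (-|t| / ε))) b]
  have hi : IntegrableOn (fun t : ℝ => Real.exp (-t / ε)) (Set.Ioi 0) := by
    have := integrableOn_exp_mul_Ioi (a := -ε⁻¹) (by simpa using hε) 0
    refine this.congr_fun (fun t _ => ?_) measurableSet_Ioi
    simp only; congr 1; field_simp
  have hint : Integrable fun t : ℝ => Real.exp (-|t| / ε) := by
    rw [← integrableOn_univ, ← Set.Iic_union_Ioi (a := (0 : ℝ))]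
    refine IntegrableOn.union ?_ (hi.congr_fun (fun t ht => ?_) measurableSet_Ioi)
    · refine (integrableOn_exp_mul_Iic (a := ε⁻¹) (by simpa using hε) 0).congr_fun
        (fun t ht => ?_) measurableSet_Iic
      simp only [abs_of_nonpos (Set.mem_Iic.1 ht)]
      congr 1; field_simp
    · simp only [abs_of_pos (Set.mem_Ioi.1 ht)]
  have h2 : ∫ t : ℝ, Real.exp (-|t| / ε) = 2 * ε := by
    rw [integral_comp_abs (f := fun t => Real.exp (-t / ε))]
    have := integral_exp_mul_Ioi (a := -ε⁻¹) (by simpa using hε) 0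
    simp only [mul_zero, Real.exp_zero] at this
    rw [setIntegral_congr_fun (g := fun t => Real.exp (-ε⁻¹ * t)) measurableSet_Ioi, this]
    · field_simp
    · intro t _; simp only; congr 1; field_simp
  rw [← h2, ofReal_integral_eq_lintegral_ofReal]
  · exact hint
  · exact Filter.Eventually.of_forall fun t => (Real.exp_pos _).le

lemma exists_measureReal_strip_le {d : ℕ} {X : Set (Rd d)} (hX : IsCompact X) {v : Rd d}
    (hv : v ≠ 0) :
    ∃ C : ℝ, 0 < C ∧ ∀ b δ : ℝ, 0 ≤ δ →
      (volume.restrict X).real {x | |inner ℝ x v - b| ≤ δ} ≤ C * δ := by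
  obtain ⟨C, hC0, hC⟩ := exists_lintegral_inner_le hX hv
  refine ⟨2 * C + 1, by positivity, fun b δ hδ => ?_⟩
  have hm : MeasurableSet (Set.Icc (b - δ) (b + δ)) := measurableSet_Icc
  have := hC _ (measurable_const.indicator hm : Measurable
    ((Set.Icc (b - δ) (b + δ)).indicator fun _ => (1 : ℝ≥0∞)))
  rw [lintegral_indicator_const hm, one_mul, Real.volume_Icc, ← ENNReal.ofReal_mul hC0] at this
  have h2 : ∫⁻ x in X, (Set.Icc (b - δ) (b + δ)).indicator (fun _ => (1 : ℝ≥0∞)) (inner ℝ x v)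
      = (volume.restrict X) {x | |inner ℝ x v - b| ≤ δ} := by
    rw [← lintegral_indicator_one (measurableSet_le (by fun_prop) (by fun_prop))]
    refine lintegral_congr fun x => ?_
    simp only [Set.indicator, Set.mem_Icc, Set.mem_ofPred_eq, abs_le, Pi.one_apply]
    congr 1
    simp only [eq_iff_iff]
    constructor <;> rintro ⟨h1, h2⟩ <;> constructor <;> linarith
  rw [h2] at this
  rw [measureReal_def]
  refine (ENNReal.toReal_le_of_le_ofReal (by nlinarith) this).trans (by nlinarith)

lemma exists_integral_exp_strip_le {d : ℕ} {X : Set (Rd d)} (hX : IsCompact X) {v : Rd d}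
    (hv : v ≠ 0) :
    ∃ C : ℝ, 0 ≤ C ∧ ∀ b ε : ℝ, 0 < ε →
      ∫ x in X, Real.exp (-|inner ℝ x v - b| / ε) ≤ C * ε := by
  obtain ⟨C, hC0, hC⟩ := exists_lintegral_inner_le hX hv
  refine ⟨C * 2, by positivity, fun b ε hε => ?_⟩
  have := hC (fun t => ENNReal.ofReal (Real.exp (-|t - b| / ε))) (by fun_prop)
  rw [lintegral_exp_neg_abs hε, ← ENNReal.ofReal_mul hC0] at this
  rw [integral_eq_lintegral_of_nonneg_ae (Filter.Eventually.of_forall fun x => by positivity)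
    (by fun_prop)]
  exact (ENNReal.toReal_le_of_le_ofReal (by positivity) this).trans (by linarith)

lemma exists_integral_exp_exp_strip_le {d : ℕ} {X : Set (Rd d)} (hX : IsCompact X) {v w : Rd d}
    (h : LinearIndependent ℝ ![v, w]) :
    ∃ C : ℝ, 0 ≤ C ∧ ∀ b b' ε : ℝ, 0 < ε →
      ∫ x in X, Real.exp (-|inner ℝ x v - b| / ε) * Real.exp (-|inner ℝ x w - b'| / ε)
        ≤ C * ε ^ 2 := by
  obtain ⟨C, hC0, hC⟩ := exists_lintegral_inner_inner_le hX h
  refine ⟨C * 4, by positivity, fun b b' ε hε => ?_⟩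
  have := hC (fun t => ENNReal.ofReal (Real.exp (-|t - b| / ε)))
    (fun t => ENNReal.ofReal (Real.exp (-|t - b'| / ε))) (by fun_prop) (by fun_prop)
  simp only [lintegral_exp_neg_abs hε] at this
  rw [← ENNReal.ofReal_mul (by positivity), ← ENNReal.ofReal_mul hC0] at this
  rw [integral_eq_lintegral_of_nonneg_ae (Filter.Eventually.of_forall fun x => by positivity)
    (by fun_prop)]
  simp only [← ENNReal.ofReal_mul (Real.exp_pos _).le] at this
  exact (ENNReal.toReal_le_of_le_ofReal (by positivity) this).trans (by nlinarith)

/-! ### Hyperplanes cutting a convex body -/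

/-- The body contains a ball around a point of the hyperplane: this is a point of the segment from
the centre of an inscribed ball to a point of the body far on the other side of the hyperplane. -/
lemma exists_closedBall_subset_of_le_inner {d : ℕ} {X : Set (Rd d)} (hX : IsCompact X)
    (hXc : Convex ℝ X) {v : Rd d} (hv : v ≠ 0) {c : ℝ} (hc : 0 < c)
    {z₀ : Rd d} {r₀ : ℝ} (hr₀ : 0 < r₀) (hz₀ : Metric.closedBall z₀ r₀ ⊆ X) :
    ∃ r : ℝ, 0 < r ∧ ∀ b : ℝ, b ≤ inner ℝ z₀ v →
      c ≤ (volume.restrict X).real {x | inner ℝ x v ≤ b} →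
      ∃ z, inner ℝ z v = b ∧ Metric.closedBall z r ⊆ X := by
  obtain ⟨C, hC0, hC⟩ := exists_measureReal_strip_le hX hv
  obtain ⟨D, hD⟩ := hX.isBounded.subset_closedBall z₀
  have hz₀X : z₀ ∈ X := hz₀ (Metric.mem_closedBall_self hr₀.le)
  have hD0 : 0 ≤ D := by simpa using hD hz₀X
  have := hX.isBounded.measure_lt_top (μ := volume)
  have : IsFiniteMeasure (volume.restrict X) := ⟨by simpa using this⟩
  have hv0 : 0 < ‖v‖ := norm_pos_iff.2 hv
  set η : ℝ := c / (2 * C) with hη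
  have hη0 : 0 < η := by positivity
  refine ⟨r₀ * (η / (‖v‖ * (D + 1))), by positivity, fun b hb hcb => ?_⟩
  obtain ⟨x₁, hx₁X, hx₁⟩ : ∃ x₁ ∈ X, inner ℝ x₁ v < b - η := by
    by_contra! hcon
    have h1 : (volume.restrict X).real {x | inner ℝ x v ≤ b} ≤
        (volume.restrict X).real {x | |inner ℝ x v - b| ≤ η} := by
      rw [measureReal_restrict_apply' hX.measurableSet,
        measureReal_restrict_apply' hX.measurableSet]
      refine measureReal_mono ?_ ((measure_mono Set.inter_subset_right).trans_lt
        hX.isBounded.measure_lt_top).ne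
      rintro x ⟨hx, hxX⟩
      refine ⟨?_, hxX⟩
      have h3 : inner ℝ x v ≤ b := hx
      have := hcon x hxX
      simp only [Set.mem_ofPred_eq, abs_le]
      constructor <;> linarith
    have h2 := hC b η hη0.le
    have : C * η = c / 2 := by rw [hη]; field_simp
    linarith
  set h₀ : ℝ := inner ℝ z₀ v - b
  set h₁ : ℝ := b - inner ℝ x₁ v
  have hh0 : 0 ≤ h₀ := by simp only [h₀]; linarith
  have hh1 : η ≤ h₁ := by simp only [h₁]; linarith
  have hsum : h₀ + h₁ ≤ ‖v‖ * (D + 1) := by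
    have h3 : h₀ + h₁ = inner ℝ (z₀ - x₁) v := by simp only [h₀, h₁, inner_sub_left]; ring
    have h4 : ‖z₀ - x₁‖ ≤ D := by
      have := hD hx₁X
      rwa [mem_closedBall_iff_norm'] at this
    rw [h3]
    refine (real_inner_le_norm _ _).trans ?_
    nlinarith
  have hpos : 0 < h₀ + h₁ := by linarith
  set s : ℝ := h₁ / (h₀ + h₁) with hs
  have hs0 : 0 < s := by apply div_pos <;> linarith
  have hs1 : s ≤ 1 := by rw [hs, div_le_one hpos]; linarith
  have hsη : η / (‖v‖ * (D + 1)) ≤ s := div_le_div₀ (by linarith) hh1 hpos hsum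
  refine ⟨s • z₀ + (1 - s) • x₁, ?_, fun w hw => ?_⟩
  · rw [inner_add_left, inner_smul_left, inner_smul_left]
    simp only [conj_trivial]
    have h3 : inner ℝ z₀ v = h₀ + b := by simp [h₀]
    have h4 : inner ℝ x₁ v = b - h₁ := by simp [h₁]
    rw [h3, h4, hs]
    field_simp
    ring
  · have hw' : ‖w - (s • z₀ + (1 - s) • x₁)‖ ≤ r₀ * s := by
      rw [mem_closedBall_iff_norm] at hw
      exact hw.trans (by gcongr)
    have key : w = s • (z₀ + s⁻¹ • (w - (s • z₀ + (1 - s) • x₁))) + (1 - s) • x₁ := by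
      rw [smul_add, smul_smul, mul_inv_cancel₀ hs0.ne', one_smul]; abel
    rw [key]
    refine hXc (hz₀ ?_) hx₁X hs0.le (by linarith) (by ring)
    rw [mem_closedBall_iff_norm, add_sub_cancel_left, norm_smul, norm_inv,
      Real.norm_of_nonneg hs0.le, inv_mul_le_iff₀ hs0]
    linarith

/-- A hyperplane with volume at least `c` of the body on both sides passes through the centre of an
inscribed ball whose radius depends only on `c` and the direction. -/
lemma exists_closedBall_subset_hyperplane {d : ℕ} {X : Set (Rd d)} (hX : IsCompact X)
    (hXc : Convex ℝ X) (hXi : (interior X).Nonempty) {v : Rd d} (hv : v ≠ 0) {c : ℝ}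
    (hc : 0 < c) :
    ∃ r : ℝ, 0 < r ∧ ∀ b : ℝ, c ≤ (volume.restrict X).real {x | inner ℝ x v ≤ b} →
      c ≤ (volume.restrict X).real {x | b ≤ inner ℝ x v} →
      ∃ z, inner ℝ z v = b ∧ Metric.closedBall z r ⊆ X := by
  obtain ⟨z₀, hz₀⟩ := hXi
  obtain ⟨r₀, hr₀, hball⟩ := Metric.nhds_basis_closedBall.mem_iff.1
    (mem_interior_iff_mem_nhds.1 hz₀)
  obtain ⟨r, hr, h⟩ := exists_closedBall_subset_of_le_inner hX hXc hv hc hr₀ hball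
  obtain ⟨r', hr', h'⟩ :=
    exists_closedBall_subset_of_le_inner hX hXc (neg_ne_zero.2 hv) hc hr₀ hball
  refine ⟨min r r', lt_min hr hr', fun b h1 h2 => ?_⟩
  obtain hb | hb := le_total b (inner ℝ z₀ v)
  · obtain ⟨z, hz, hzX⟩ := h b hb h1
    exact ⟨z, hz, (Metric.closedBall_subset_closedBall (min_le_left _ _)).trans hzX⟩
  · obtain ⟨z, hz, hzX⟩ := h' (-b) (by simpa using hb) (by simpa using h2)
    exact ⟨z, by simpa using hz,
      (Metric.closedBall_subset_closedBall (min_le_right _ _)).trans hzX⟩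

/-- Points close both to a hyperplane through the centre of an inscribed ball and to the boundary
of the body. Contract the part of the body in the slab by a homothety of ratio `1 - θ` with centre
on the hyperplane: the contracted part stays in the slab and keeps a distance at least `θ * r` from
the complement of the body, while its volume is `(1 - θ) ^ d` times the original one. -/
lemma exists_measureReal_strip_boundary_le {d : ℕ} {X : Set (Rd d)} (hX : IsCompact X)
    (hXc : Convex ℝ X) {v : Rd d} (hv : v ≠ 0) {r κ : ℝ} (hr : 0 < r) (hκ : 0 < κ) :
    ∃ C : ℝ, 0 < C ∧ ∀ (b : ℝ) (z : Rd d), inner ℝ z v = b → Metric.closedBall z r ⊆ X →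
      ∀ δ : ℝ, 0 ≤ δ → (volume.restrict X).real
        {x | |inner ℝ x v - b| ≤ δ ∧ ¬ Metric.closedBall x (κ * δ) ⊆ X} ≤ C * δ ^ 2 := by
  obtain ⟨C, hC0, hC⟩ := exists_measureReal_strip_le hX hv
  have hfin : volume X < ∞ := hX.isBounded.measure_lt_top
  have : IsFiniteMeasure (volume.restrict X) := ⟨by simpa using hfin⟩
  refine ⟨d * (κ / r) * C + (κ / r) ^ 2 * volume.real X + 1, by positivity,
    fun b z hz hball δ hδ => ?_⟩
  set θ : ℝ := κ / r * δ with hθ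
  have hθ0 : 0 ≤ θ := by positivity
  have hκδ : κ * δ = θ * r := by rw [hθ]; field_simp
  obtain hθ1 | hθ1 := le_or_gt 1 θ
  · calc (volume.restrict X).real {x | |inner ℝ x v - b| ≤ δ ∧ ¬ Metric.closedBall x (κ * δ) ⊆ X}
        ≤ (volume.restrict X).real Set.univ := measureReal_mono (Set.subset_univ _)
      _ = volume.real X := by simp [measureReal_def]
      _ ≤ θ ^ 2 * volume.real X := le_mul_of_one_le_left measureReal_nonneg (by nlinarith)
      _ = ((κ / r) ^ 2 * volume.real X) * δ ^ 2 := by rw [hθ]; ring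
      _ ≤ _ := by gcongr; nlinarith [show 0 ≤ d * (κ / r) * C by positivity]
  · set U : Set (Rd d) := X ∩ {x | |inner ℝ x v - b| ≤ δ} with hU
    have hUc : IsCompact U := hX.inter_right (isClosed_le (by fun_prop) (by fun_prop))
    have hUvol : volume.real U ≤ C * δ := by
      have := hC b δ hδ
      rwa [measureReal_restrict_apply' hX.measurableSet, Set.inter_comm] at this
    have hUfin : volume U ≠ ∞ := hUc.isBounded.measure_lt_top.ne
    set V : Set (Rd d) := AffineMap.homothety z (1 - θ) '' U with hV
    have hVc : IsCompact V := hUc.image (by fun_prop)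
    have hVU : V ⊆ U := by
      rintro _ ⟨x, ⟨hxX, hx⟩, rfl⟩
      have hx' : |inner ℝ x v - b| ≤ δ := hx
      have hzX : z ∈ X := hball (Metric.mem_closedBall_self hr.le)
      have hhom : AffineMap.homothety z (1 - θ) x = θ • z + (1 - θ) • x := by
        simp only [AffineMap.homothety_apply, vsub_eq_sub, vadd_eq_add]; module
      refine ⟨?_, ?_⟩
      · rw [hhom]
        exact hXc hzX hxX hθ0 (by linarith) (by ring)
      · simp only [Set.mem_ofPred_eq]
        have : inner ℝ (AffineMap.homothety z (1 - θ) x) v - b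
            = (1 - θ) * (inner ℝ x v - b) := by
          rw [hhom, inner_add_left, inner_smul_left, inner_smul_left, hz]
          simp only [conj_trivial]; ring
        rw [this, abs_mul, abs_of_pos (by linarith)]
        nlinarith [abs_nonneg (inner ℝ x v - b)]
    have hVvol : volume.real V = (1 - θ) ^ d * volume.real U := by
      rw [hV, measureReal_def, Measure.addHaar_image_homothety, ENNReal.toReal_mul,
        finrank_euclideanSpace_fin, ENNReal.toReal_ofReal (abs_nonneg _),
        abs_of_nonneg (by have : 0 ≤ 1 - θ := by linarith
                          positivity), measureReal_def]
    have hsub : {x | |inner ℝ x v - b| ≤ δ ∧ ¬ Metric.closedBall x (κ * δ) ⊆ X} ∩ X ⊆ U \ V := by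
      rintro x ⟨⟨hx1, hx2⟩, hxX⟩
      refine ⟨⟨hxX, hx1⟩, ?_⟩
      rintro ⟨x', ⟨hx'X, -⟩, rfl⟩
      refine hx2 fun w hw => ?_
      have hhom : AffineMap.homothety z (1 - θ) x' = θ • z + (1 - θ) • x' := by
        simp only [AffineMap.homothety_apply, vsub_eq_sub, vadd_eq_add]; module
      rw [hhom, mem_closedBall_iff_norm, hκδ] at hw
      obtain h0 | h0 := hθ0.eq_or_lt
      · have hw0 : w = x' := by
          rw [← h0] at hw
          simpa [sub_eq_zero] using hw
        rwa [hw0]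
      · have key : w = θ • (z + θ⁻¹ • (w - (θ • z + (1 - θ) • x'))) + (1 - θ) • x' := by
          rw [smul_add, smul_smul, mul_inv_cancel₀ h0.ne', one_smul]; abel
        rw [key]
        refine hXc (hball ?_) hx'X hθ0 (by linarith) (by ring)
        rw [mem_closedBall_iff_norm, add_sub_cancel_left, norm_smul, norm_inv,
          Real.norm_of_nonneg hθ0, inv_mul_le_iff₀ h0]
        exact hw
    rw [measureReal_restrict_apply' hX.measurableSet]
    calc volume.real ({x | |inner ℝ x v - b| ≤ δ ∧ ¬ Metric.closedBall x (κ * δ) ⊆ X} ∩ X)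
        ≤ volume.real (U \ V) := measureReal_mono hsub
          ((measure_mono Set.sdiff_subset).trans_lt hUfin.lt_top).ne
      _ = volume.real U - volume.real V := measureReal_sdiff hVU hVc.measurableSet hUfin
      _ = (1 - (1 - θ) ^ d) * volume.real U := by rw [hVvol]; ring
      _ ≤ (d * θ) * (C * δ) := by
          have hb := one_add_mul_le_pow (a := -θ) (by linarith) d
          gcongr
          rw [← sub_eq_add_neg] at hb
          linarith
      _ = (d * (κ / r) * C) * δ ^ 2 := by rw [hθ]; ring
      _ ≤ _ := by gcongr; nlinarith [show 0 ≤ (κ / r) ^ 2 * volume.real X by positivity]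

/-! ### An isoperimetric inequality on convex bodies -/

lemma ofReal_le_mul_volume_of_lipschitz {f : ℝ → ℝ} {K : ℝ≥0} (hf : LipschitzWith K f)
    {γ : ℝ} (h0 : f 0 ≤ 0) (h1 : γ < f 1) :
    ENNReal.ofReal γ ≤ K * volume {t ∈ Set.Icc (0 : ℝ) 1 | f t ∈ Set.Ioc 0 γ} := by
  have hsub : Set.Ioc 0 γ ⊆ f '' {t ∈ Set.Icc (0 : ℝ) 1 | f t ∈ Set.Ioc 0 γ} := by
    intro s hs
    obtain ⟨t, ht, rfl⟩ := intermediate_value_Icc zero_le_one hf.continuous.continuousOn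
      (show s ∈ Set.Icc (f 0) (f 1) from ⟨h0.trans hs.1.le, hs.2.trans h1.le⟩)
    exact ⟨t, ⟨ht, hs⟩, rfl⟩
  have h2 := hf.hausdorffMeasure_image_le (d := 1) zero_le_one
    {t ∈ Set.Icc (0 : ℝ) 1 | f t ∈ Set.Ioc 0 γ}
  rw [hausdorffMeasure_real, ENNReal.rpow_one] at h2
  refine le_trans ?_ ((measure_mono hsub).trans h2)
  simp

lemma volume_preimage_add_smul_le {d : ℕ} (S : Set (Rd d)) (a : Rd d) {t : ℝ} (ht : 1 / 2 ≤ t) :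
    volume {x | a + t • x ∈ S} ≤ ENNReal.ofReal (2 ^ d) * volume S := by
  have h : {x | a + t • x ∈ S} = (fun x => t • x) ⁻¹' ((fun x => a + x) ⁻¹' S) := rfl
  have ht0 : 0 < t := by linarith
  rw [h, Measure.addHaar_preimage_smul _ ht0.ne', measure_preimage_add, finrank_euclideanSpace_fin]
  gcongr
  rw [abs_of_pos (by positivity), ← inv_pow]
  gcongr
  rw [inv_le_comm₀ ht0 (by norm_num)]
  linarith

/-- The level set layer `{0 < u ≤ γ}` between two large parts of a convex body has volume of order
at least `γ`. Every segment from `{u ≤ 0}` to `{γ < u}` spends a time at least of order `γ` in the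
layer, and integrating this time over all such segments gives at most a multiple of the volume of
the layer. -/
lemma exists_le_measureReal_layer {d : ℕ} {X : Set (Rd d)} (hX : IsCompact X)
    (hXc : Convex ℝ X) (K : ℝ≥0) {c : ℝ} (hc : 0 < c) :
    ∃ c₁ : ℝ, 0 < c₁ ∧ ∀ u : Rd d → ℝ, LipschitzWith K u → ∀ γ : ℝ, 0 ≤ γ →
      c ≤ (volume.restrict X).real {x | u x ≤ 0} →
      c ≤ (volume.restrict X).real {x | γ < u x} →
      c₁ * γ ≤ (volume.restrict X).real {x | 0 < u x ∧ u x ≤ γ} := by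
  obtain ⟨R, hR⟩ := hX.isBounded.subset_closedBall 0
  have hfin : volume X < ∞ := hX.isBounded.measure_lt_top
  have : IsFiniteMeasure (volume.restrict X) := ⟨by simpa using hfin⟩
  set M : ℝ := (K + 1) * (2 * |R| + 1) * 2 ^ d * (volume.real X + 1) with hM
  have hM0 : 0 < M := by
    have : 0 ≤ volume.real X := measureReal_nonneg
    positivity
  refine ⟨c ^ 2 / M, by positivity, fun u hu γ hγ hA hB => ?_⟩
  have hum : Measurable u := hu.continuous.measurable
  set A : Set (Rd d) := {x | u x ≤ 0} with hAdef
  set B : Set (Rd d) := {x | γ < u x} with hBdef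
  set S : Set (Rd d) := {x | 0 < u x ∧ u x ≤ γ} with hSdef
  have hAm : MeasurableSet A := measurableSet_le hum measurable_const
  have hBm : MeasurableSet B := measurableSet_lt measurable_const hum
  have hSm : MeasurableSet S := (measurableSet_lt measurable_const hum).inter
    (measurableSet_le hum measurable_const)
  have hSXm : MeasurableSet (S ∩ X) := hSm.inter hX.measurableSet
  set μA : Measure (Rd d) := (volume.restrict X).restrict A with hμA
  set μB : Measure (Rd d) := (volume.restrict X).restrict B with hμB
  have hμAv : ∀ T, μA T ≤ volume T := fun T =>
    (Measure.restrict_apply_le _ _).trans (Measure.restrict_apply_le _ _)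
  have hμBv : ∀ T, μB T ≤ volume T := fun T =>
    (Measure.restrict_apply_le _ _).trans (Measure.restrict_apply_le _ _)
  set χ : Rd d → ℝ≥0∞ := (S ∩ X).indicator 1 with hχ
  have hχm : Measurable χ := measurable_one.indicator hSXm
  set J : ℝ≥0∞ := ∫⁻ p, (∫⁻ t in Set.Icc (0 : ℝ) 1, χ ((1 - t) • p.1 + t • p.2)) ∂(μA.prod μB)
    with hJ
  have hlow : ENNReal.ofReal γ * (μA Set.univ * μB Set.univ)
      ≤ ENNReal.ofReal ((K + 1) * (2 * |R| + 1)) * J := by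
    have hae : ∀ᵐ p ∂(μA.prod μB), (p.1 ∈ X ∧ p.1 ∈ A) ∧ (p.2 ∈ X ∧ p.2 ∈ B) := by
      have h1 : ∀ᵐ a ∂μA, a ∈ X ∧ a ∈ A := by
        filter_upwards [ae_restrict_mem hAm,
          ae_restrict_of_ae (ae_restrict_mem hX.measurableSet)] with a h1 h2 using ⟨h2, h1⟩
      have h2 : ∀ᵐ a ∂μB, a ∈ X ∧ a ∈ B := by
        filter_upwards [ae_restrict_mem hBm,
          ae_restrict_of_ae (ae_restrict_mem hX.measurableSet)] with a h1 h2 using ⟨h2, h1⟩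
      filter_upwards [Measure.quasiMeasurePreserving_fst.ae h1,
        Measure.quasiMeasurePreserving_snd.ae h2] with p hp1 hp2 using ⟨hp1, hp2⟩
    rw [hJ, ← lintegral_const_mul' _ _ ENNReal.ofReal_ne_top,
      ← Measure.prod_prod (μ := μA) (ν := μB), Set.univ_prod_univ, ← lintegral_const]
    refine lintegral_mono_ae ?_
    filter_upwards [hae] with p hp
    obtain ⟨⟨h1X, h1A⟩, h2X, h2B⟩ := hp
    have hseg : ∀ t : ℝ, (1 - t) • p.1 + t • p.2 = p.1 + t • (p.2 - p.1) := fun t => by module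
    have hdist : ‖p.2 - p.1‖ ≤ 2 * |R| + 1 := by
      have e1 := mem_closedBall_zero_iff.1 (hR h1X)
      have e2 := mem_closedBall_zero_iff.1 (hR h2X)
      have := norm_sub_le p.2 p.1
      have := le_abs_self R
      linarith
    have hlip : LipschitzWith ((K + 1) * ⟨2 * |R| + 1, by positivity⟩)
        fun t : ℝ => u ((1 - t) • p.1 + t • p.2) := by
      refine (hu.weaken (by simp)).comp (LipschitzWith.of_dist_le_mul fun s t => ?_)
      rw [hseg, hseg, dist_add_left, dist_eq_norm, ← sub_smul, norm_smul, mul_comm, dist_eq_norm]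
      exact mul_le_mul_of_nonneg_right hdist (norm_nonneg _)
    have := ofReal_le_mul_volume_of_lipschitz hlip (γ := γ) 
      (by simp only [sub_zero, one_smul, zero_smul, add_zero]; exact h1A)
      (by simp only [sub_self, one_smul, zero_smul, zero_add]; exact h2B)
    refine this.trans (le_of_eq ?_)
    congr 1
    · rw [← ENNReal.ofReal_coe_nnreal]; rfl
    · rw [← lintegral_indicator_one, ← lintegral_indicator measurableSet_Icc]
      · refine lintegral_congr fun t => ?_
        by_cases ht : t ∈ Set.Icc (0 : ℝ) 1
        · have hX' : (1 - t) • p.1 + t • p.2 ∈ X :=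
            hXc h1X h2X (by linarith [ht.2]) ht.1 (by ring)
          rw [Set.indicator_of_mem ht]
          simp only [hχ, Set.indicator, Set.mem_inter_iff, hX', hSdef, ht, Set.mem_Ioc,
            Set.mem_ofPred_eq, true_and, and_true, Pi.one_apply]
        · rw [Set.indicator_of_notMem ht, Set.indicator_of_notMem fun h => ht h.1]
      · exact measurableSet_Icc.inter (hlip.continuous.measurable measurableSet_Ioc)
  have hup : J ≤ ENNReal.ofReal (2 ^ d) * volume (S ∩ X) * volume X := by
    have hχm2 : Measurable fun q : ℝ × (Rd d × Rd d) => χ ((1 - q.1) • q.2.1 + q.1 • q.2.2) :=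
      hχm.comp (by fun_prop)
    have hmA : μA Set.univ ≤ volume X := by
      refine (Measure.restrict_apply_le _ _).trans (by simp)
    have hmB : μB Set.univ ≤ volume X := by
      refine (Measure.restrict_apply_le _ _).trans (by simp)
    have hint : ∀ (ν : Measure (Rd d)), (∀ T, ν T ≤ volume T) → ∀ (a : Rd d) (t : ℝ), 1 / 2 ≤ t →
        ∫⁻ x, χ (a + t • x) ∂ν ≤ ENNReal.ofReal (2 ^ d) * volume (S ∩ X) := by
      intro ν hν a t ht
      have h1 : ∀ x, χ (a + t • x) = {x | a + t • x ∈ S ∩ X}.indicator 1 x := fun x => rfl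
      simp only [h1]
      rw [lintegral_indicator_one (s := {x | a + t • x ∈ S ∩ X})
        (hSXm.preimage (by fun_prop : Measurable fun x : Rd d => a + t • x))]
      exact (hν _).trans (volume_preimage_add_smul_le _ _ ht)
    rw [hJ, lintegral_lintegral_swap (by exact (hχm2.comp measurable_swap).aemeasurable)]
    calc ∫⁻ t in Set.Icc (0 : ℝ) 1, (∫⁻ p, χ ((1 - t) • p.1 + t • p.2) ∂(μA.prod μB))
        ≤ ∫⁻ t in Set.Icc (0 : ℝ) 1, ENNReal.ofReal (2 ^ d) * volume (S ∩ X) * volume X := by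
          refine lintegral_mono fun t => ?_
          have hm : Measurable fun p : Rd d × Rd d => χ ((1 - t) • p.1 + t • p.2) :=
            hχm.comp (by fun_prop)
          obtain ht | ht := le_total (1 / 2) t
          · dsimp only
            rw [lintegral_prod _ hm.aemeasurable]
            refine (lintegral_mono fun a => hint μB hμBv _ t ht).trans ?_
            rw [lintegral_const]
            gcongr
          · dsimp only
            rw [lintegral_prod_symm _ hm.aemeasurable]
            refine (lintegral_mono fun b => ?_).trans
              ((lintegral_const (μ := μB) _).le.trans (mul_le_mul_right hmB _))
            have := hint μA hμAv (t • b) (1 - t) (by linarith)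
            simpa only [add_comm] using this
      _ = ENNReal.ofReal (2 ^ d) * volume (S ∩ X) * volume X := by simp
  have hμA' : (volume.restrict X).real A = (μA Set.univ).toReal := by
    simp [hμA, measureReal_def]
  have hμB' : (volume.restrict X).real B = (μB Set.univ).toReal := by
    simp [hμB, measureReal_def]
  have hS' : (volume.restrict X).real S = (volume (S ∩ X)).toReal := by
    rw [measureReal_def, Measure.restrict_apply hSm]
  have hSfin : volume (S ∩ X) ≠ ∞ := ((measure_mono Set.inter_subset_right).trans_lt hfin).ne
  have hfinal := hlow.trans (mul_le_mul_right hup _)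
  have h3 := ENNReal.toReal_mono (by simp [ENNReal.mul_eq_top, hSfin, hfin.ne]) hfinal
  simp only [ENNReal.toReal_mul, ENNReal.toReal_ofReal hγ] at h3
  rw [ENNReal.toReal_ofReal (by positivity), ENNReal.toReal_ofReal (by positivity),
    ← hμA', ← hμB', ← hS'] at h3
  have h4 : γ * c ^ 2 ≤ M * (volume.restrict X).real S := by
    calc γ * c ^ 2 = γ * (c * c) := by ring
      _ ≤ γ * ((volume.restrict X).real A * (volume.restrict X).real B) := by gcongr
      _ ≤ _ := h3
      _ = (K + 1) * (2 * |R| + 1) * 2 ^ d * volume.real X * (volume.restrict X).real S := by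
          rw [measureReal_def (μ := volume) (s := X)]; ring
      _ ≤ _ := by rw [hM]; gcongr; linarith
  rw [div_mul_eq_mul_div, div_le_iff₀ hM0]
  linarith

/-! ### Scores, Laguerre cells and triples of scores -/

/-- The affine function `x ↦ ⟪x, y i⟫ - g i`. -/
noncomputable def score {d : ℕ} {ι : Type*} (y : ι → Rd d) (g : ι → ℝ) (i : ι) (x : Rd d) : ℝ :=
  inner ℝ x (y i) - g i

/-- The Laguerre cell of `i`: the closed set on which the score of `i` is maximal. -/
def cell {d : ℕ} {ι : Type*} (y : ι → Rd d) (g : ι → ℝ) (i : ι) : Set (Rd d) :=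
  {x | ∀ j, score y g j x ≤ score y g i x}

section Scores

variable {d : ℕ} {ι : Type*} {y : ι → Rd d} {g : ι → ℝ}

@[fun_prop]
lemma continuous_score (i : ι) : Continuous (score y g i) := by
  unfold score; fun_prop

lemma score_sub_score (i j : ι) (x : Rd d) :
    score y g i x - score y g j x = inner ℝ x (y i - y j) - (g i - g j) := by
  simp only [score, inner_sub_right]; ring

lemma isClosed_cell (i : ι) : IsClosed (cell y g i) := by
  simp only [cell, Set.ofPred_forall]
  exact isClosed_iInter fun j => isClosed_le (by fun_prop) (by fun_prop)

lemma measurableSet_cell (i : ι) : MeasurableSet (cell y g i) := (isClosed_cell i).measurableSet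

lemma mem_cell {i : ι} {x : Rd d} : x ∈ cell y g i ↔ ∀ j, score y g j x ≤ score y g i x := Iff.rfl

lemma exists_mem_cell [Finite ι] [Nonempty ι] (y : ι → Rd d) (g : ι → ℝ) (x : Rd d) :
    ∃ i, x ∈ cell y g i :=
  Finite.exists_max fun i => score y g i x

end Scores

/-- A finite family of properties that are monotone in a constant holds with a common constant. -/
lemma exists_pos_forall_of_mono {ι : Type*} [Finite ι] {p : ι → ℝ → Prop}
    (hp : ∀ i C C', C ≤ C' → p i C → p i C') (h : ∀ i, ∃ C, p i C) :
    ∃ C, 0 < C ∧ ∀ i, p i C := by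
  obtain ⟨f, hf⟩ := Classical.axiom_of_choice h
  obtain ⟨M, hM⟩ := Set.finite_range f |>.bddAbove
  refine ⟨max M 1, by positivity, fun i => hp i _ _ ?_ (hf i)⟩
  exact (hM ⟨i, rfl⟩).trans (le_max_left _ _)

lemma measureReal_restrict_mono {d : ℕ} {X : Set (Rd d)} (hX : IsCompact X) {s t : Set (Rd d)}
    (h : ∀ x ∈ X, x ∈ s → x ∈ t) :
    (volume.restrict X).real s ≤ (volume.restrict X).real t := by
  rw [measureReal_restrict_apply' hX.measurableSet, measureReal_restrict_apply' hX.measurableSet]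
  exact measureReal_mono (fun x hx => ⟨h x hx.2 hx.1, hx.2⟩)
    ((measure_mono Set.inter_subset_right).trans_lt hX.isBounded.measure_lt_top).ne

/-- If three distinct points are collinear, the cell of the middle one lies in a strip whose width
is controlled by how close the three scores can be to each other; a lower bound on the volumes of
the cells therefore keeps the three scores apart. -/
lemma exists_le_abs_score_sub_add {d : ℕ} {ι : Type*} {X : Set (Rd d)} (hX : IsCompact X)
    {y : ι → Rd d} (hy : Function.Injective y) {i j k : ι} (hij : i ≠ j) (hkj : k ≠ j)
    (hik : i ≠ k) (hdep : ¬ LinearIndependent ℝ ![y i - y j, y k - y j]) {c : ℝ} (hc : 0 < c) :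
    ∃ s : ℝ, 0 < s ∧ ∀ g : ι → ℝ, (∀ l, c ≤ (volume.restrict X).real (cell y g l)) →
      ∀ x, s ≤ |score y g i x - score y g j x| + |score y g k x - score y g j x| := by
  have hv : y i - y j ≠ 0 := sub_ne_zero.2 (hy.ne hij)
  obtain ⟨C, hC0, hC⟩ := exists_measureReal_strip_le hX hv
  rw [LinearIndependent.pair_iff' hv] at hdep
  push Not at hdep
  obtain ⟨l, hl⟩ := hdep
  have hl0 : l ≠ 0 := by
    rintro rfl
    rw [zero_smul, eq_comm, sub_eq_zero] at hl
    exact hkj (hy hl)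
  have hl1 : l ≠ 1 := by
    rintro rfl
    rw [one_smul, sub_left_inj] at hl
    exact hik (hy hl)
  have hl1' : 1 - l ≠ 0 := sub_ne_zero.2 hl1.symm
  set Λ : ℝ := |l|⁻¹ + |1 - l|⁻¹ with hΛ
  have hΛ0 : 0 < Λ := by positivity
  refine ⟨c / (C * Λ) / (1 + |l|), by positivity, fun g hg x => ?_⟩
  set κ : ℝ := l * (g i - g j) - (g k - g j) with hκ
  have hrel : ∀ x, score y g k x - score y g j x
      = l * (score y g i x - score y g j x) + κ := by
    intro x
    rw [score_sub_score, score_sub_score, ← hl, inner_smul_right]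
    ring
  have hκlow : c / (C * Λ) ≤ |κ| := by
    obtain ⟨m, hm⟩ : ∃ m, ∀ x ∈ cell y g m, |score y g i x - score y g j x| ≤ Λ * |κ| := by
      have e1 : 0 < |l|⁻¹ := by positivity
      have e2 : 0 < |1 - l|⁻¹ := by positivity
      -- `t` is the difference of the two outer scores; in each case it is trapped between `0` or
      -- `-κ / l` and `κ / (1 - l)` on the cell of the middle point.
      have bound : ∀ t a b : ℝ, a ≤ t → t ≤ b → |a| ≤ Λ * |κ| → |b| ≤ Λ * |κ| →
          |t| ≤ Λ * |κ| := fun t a b h1 h2 h3 h4 => by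
        rw [abs_le] at *; constructor <;> linarith
      have b0 : |(0 : ℝ)| ≤ Λ * |κ| := by rw [abs_zero]; positivity
      have b1 : |-κ / l| ≤ Λ * |κ| := by
        rw [abs_div, abs_neg, div_eq_inv_mul]; gcongr; linarith
      have b2 : |κ / (1 - l)| ≤ Λ * |κ| := by
        rw [abs_div, div_eq_inv_mul]; gcongr; linarith
      obtain h | h := hl0.lt_or_gt
      · refine ⟨j, fun x hx => bound _ (-κ / l) 0 ?_ (by linarith [hx i]) b1 b0⟩
        have := hrel x
        rw [div_le_iff_of_neg h]
        linarith [hx k]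
      · obtain h' | h' := hl1.lt_or_gt
        · refine ⟨k, fun x hx => bound _ (-κ / l) (κ / (1 - l)) ?_ ?_ b1 b2⟩
          · have := hrel x
            rw [div_le_iff₀ h]
            linarith [hx j]
          · have := hrel x
            rw [le_div_iff₀ (by linarith)]
            linarith [hx i]
        · refine ⟨i, fun x hx => bound _ 0 (κ / (1 - l)) (by linarith [hx j]) ?_ b0 b2⟩
          have := hrel x
          rw [le_div_iff_of_neg (by linarith)]
          linarith [hx k]
    have h1 : c ≤ C * (Λ * |κ|) := by
      refine (hg m).trans ((measureReal_restrict_mono hX fun x _ hx => ?_).trans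
        (hC (g i - g j) (Λ * |κ|) (by positivity)))
      have := hm x hx
      rwa [score_sub_score] at this
    rw [div_le_iff₀ (by positivity)]
    linarith
  rw [div_le_iff₀ (by positivity)]
  refine hκlow.trans ?_
  have h1 : κ = (score y g k x - score y g j x) - l * (score y g i x - score y g j x) := by
    rw [hrel]; ring
  have h2 : |κ| ≤ |score y g k x - score y g j x| + |l| * |score y g i x - score y g j x| := by
    rw [← abs_mul, h1]; exact abs_sub _ _
  have := abs_nonneg (score y g k x - score y g j x)
  have := abs_nonneg (score y g i x - score y g j x)
  have := abs_nonneg l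
  nlinarith [mul_nonneg (abs_nonneg l) (abs_nonneg (score y g k x - score y g j x))]

/-- The region where three scores are within `O(ε)` of each other has volume `O(ε ^ 2)`. -/
lemma exists_integral_exp_triple_le {d : ℕ} {ι : Type*} {X : Set (Rd d)} (hX : IsCompact X)
    {y : ι → Rd d} (hy : Function.Injective y) {i j k : ι} (hij : i ≠ j) (hkj : k ≠ j)
    (hik : i ≠ k) {c : ℝ} (hc : 0 < c) :
    ∃ C : ℝ, 0 ≤ C ∧ ∀ g : ι → ℝ, (∀ l, c ≤ (volume.restrict X).real (cell y g l)) →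
      ∀ ε : ℝ, 0 < ε →
      ∫ x in X, Real.exp (-|score y g i x - score y g j x| / ε) *
        Real.exp (-|score y g k x - score y g j x| / ε) ≤ C * ε ^ 2 := by
  by_cases hdep : LinearIndependent ℝ ![y i - y j, y k - y j]
  · obtain ⟨C, hC0, hC⟩ := exists_integral_exp_exp_strip_le hX hdep
    refine ⟨C, hC0, fun g _ ε hε => ?_⟩
    simpa only [score_sub_score] using hC (g i - g j) (g k - g j) ε hε
  · obtain ⟨s, hs, h⟩ := exists_le_abs_score_sub_add hX hy hij hkj hik hdep hc
    have hfin : volume X < ∞ := hX.isBounded.measure_lt_top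
    refine ⟨volume.real X * (2 / s ^ 2), by positivity, fun g hg ε hε => ?_⟩
    have hb : ∀ x, Real.exp (-|score y g i x - score y g j x| / ε) *
        Real.exp (-|score y g k x - score y g j x| / ε) ≤ 2 / s ^ 2 * ε ^ 2 := by
      intro x
      have h1 := Real.quadratic_le_exp_of_nonneg (x := s / ε) (by positivity)
      have h2 : (s / ε) ^ 2 / 2 ≤ Real.exp (s / ε) := by
        have : 0 < s / ε := by positivity
        linarith
      rw [← Real.exp_add]
      calc Real.exp (-|score y g i x - score y g j x| / ε + -|score y g k x - score y g j x| / ε)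
          ≤ Real.exp (-(s / ε)) := by
            rw [Real.exp_le_exp, ← add_div, ← neg_div]
            have := h g hg x
            gcongr
            linarith
        _ = (Real.exp (s / ε))⁻¹ := Real.exp_neg _
        _ ≤ ((s / ε) ^ 2 / 2)⁻¹ := by gcongr
        _ = 2 / s ^ 2 * ε ^ 2 := by field_simp
    calc ∫ x in X, Real.exp (-|score y g i x - score y g j x| / ε) *
        Real.exp (-|score y g k x - score y g j x| / ε)
        ≤ ∫ x in X, 2 / s ^ 2 * ε ^ 2 := by
          refine integral_mono_of_nonneg (Filter.Eventually.of_forall fun x => by positivity)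
            (integrableOn_const hfin.ne) (Filter.Eventually.of_forall hb)
      _ = volume.real X * (2 / s ^ 2) * ε ^ 2 := by
          rw [setIntegral_const, smul_eq_mul]; ring

/-! ### Reflection across the hyperplane where two scores agree -/

/-- The orthogonal reflection across the hyperplane `{x | ⟪x, v⟫ = b}` (for `v ≠ 0`). -/
noncomputable def hyperplaneReflection {d : ℕ} (v : Rd d) (b : ℝ) (x : Rd d) : Rd d :=
  x - (2 * (inner ℝ x v - b) / ‖v‖ ^ 2) • v

section Reflection

variable {d : ℕ} {v : Rd d}

lemma inner_hyperplaneReflection_sub (hv : v ≠ 0) (b : ℝ) (x : Rd d) :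
    inner ℝ (hyperplaneReflection v b x) v - b = -(inner ℝ x v - b) := by
  have : ‖v‖ ^ 2 ≠ 0 := by positivity
  simp only [hyperplaneReflection, inner_sub_left, inner_smul_left, real_inner_self_eq_norm_sq,
    conj_trivial]
  field_simp
  ring

lemma hyperplaneReflection_involutive (hv : v ≠ 0) (b : ℝ) :
    Function.Involutive (hyperplaneReflection v b) := by
  intro x
  rw [hyperplaneReflection, inner_hyperplaneReflection_sub hv, hyperplaneReflection]
  module

lemma norm_hyperplaneReflection_sub_self (hv : v ≠ 0) (b : ℝ) (x : Rd d) :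
    ‖hyperplaneReflection v b x - x‖ = 2 / ‖v‖ * |inner ℝ x v - b| := by
  have : 0 < ‖v‖ := norm_pos_iff.2 hv
  rw [hyperplaneReflection, sub_sub_cancel_left, norm_neg, norm_smul, Real.norm_eq_abs, abs_div,
    abs_mul, abs_of_pos (by positivity : 0 < ‖v‖ ^ 2), abs_two]
  field_simp

@[fun_prop]
lemma continuous_hyperplaneReflection (b : ℝ) : Continuous (hyperplaneReflection v b) := by
  unfold hyperplaneReflection; fun_prop

lemma measurePreserving_hyperplaneReflection (b : ℝ) :
    MeasurePreserving (hyperplaneReflection v b) volume volume := by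
  have h1 := ((ℝ ∙ v)ᗮ.reflection).measurePreserving
  have h2 := measurePreserving_add_right (volume : Measure (Rd d)) ((2 * b / ‖v‖ ^ 2) • v)
  have h3 : hyperplaneReflection v b
      = (fun x => x + (2 * b / ‖v‖ ^ 2) • v) ∘ (ℝ ∙ v)ᗮ.reflection := by
    funext x
    simp only [hyperplaneReflection, Function.comp, Submodule.reflection_orthogonal_apply,
      Submodule.reflection_singleton_apply, real_inner_comm v x, RCLike.ofReal_real_eq_id, id]
    module
  rw [h3]
  exact h2.comp h1

end Reflection

/-- The part of the cell of `j` that the reflection exchanging the scores of `i` and `j` does not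
map into the cell of `i` carries little of the mass that concentrates on the hyperplane: its points
are close to the boundary of the body or to the cell of a third index. -/
lemma exists_integral_exp_defect_le {d : ℕ} {ι : Type*} [Fintype ι] {X : Set (Rd d)}
    (hX : IsCompact X) (hXc : Convex ℝ X) (hXi : (interior X).Nonempty)
    {y : ι → Rd d} (hy : Function.Injective y) {i j : ι} (hij : i ≠ j) {c : ℝ} (hc : 0 < c) :
    ∃ C : ℝ, 0 < C ∧ ∀ g : ι → ℝ, (∀ l, c ≤ (volume.restrict X).real (cell y g l)) →
      ∀ ε : ℝ, 0 < ε → ε ≤ Real.exp (-1) →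
      ∫ x, {x | x ∈ X ∩ cell y g j ∧
          hyperplaneReflection (y i - y j) (g i - g j) x ∉ X ∩ cell y g i}.indicator
        (fun x => Real.exp (-|score y g i x - score y g j x| / ε)) x
        ≤ C * (ε ^ 2 * Real.log (1 / ε) ^ 2) := by
  classical
  have hfin : volume X < ∞ := hX.isBounded.measure_lt_top
  have : IsFiniteMeasure (volume.restrict X) := ⟨by simpa using hfin⟩
  have hv : y i - y j ≠ 0 := sub_ne_zero.2 (hy.ne hij)
  set v := y i - y j with hvdef
  have hv0 : 0 < ‖v‖ := norm_pos_iff.2 hv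
  obtain ⟨r, hr, hball⟩ := exists_closedBall_subset_hyperplane hX hXc hXi hv hc
  obtain ⟨C₁, hC₁, hbd⟩ := exists_measureReal_strip_boundary_le hX hXc hv hr
    (κ := 2 / ‖v‖) (by positivity)
  have htri : ∀ k : {k : ι // k ≠ j ∧ i ≠ k}, ∃ C : ℝ, ∀ g : ι → ℝ,
      (∀ l, c ≤ (volume.restrict X).real (cell y g l)) → ∀ ε : ℝ, 0 < ε →
      ∫ x in X, Real.exp (-|score y g i x - score y g j x| / ε) *
        Real.exp (-|score y g k x - score y g j x| / ε) ≤ C * ε ^ 2 := fun k =>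
    (exists_integral_exp_triple_le hX hy hij k.2.1 k.2.2 hc).imp fun C h => h.2
  obtain ⟨C₂, hC₂, htri⟩ := exists_pos_forall_of_mono (fun k C C' hCC' h g hg ε hε =>
    (h g hg ε hε).trans (by gcongr)) htri
  -- the constant by which a third score can catch up under the reflection
  obtain ⟨Λ, hΛ0, hΛ⟩ : ∃ Λ : ℝ, 0 < Λ ∧ ∀ k, 2 * (1 + 2 * (‖y k - y i‖ / ‖v‖)) ≤ Λ :=
    exists_pos_forall_of_mono (p := fun k Λ => 2 * (1 + 2 * (‖y k - y i‖ / ‖v‖)) ≤ Λ)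
      (fun k C C' h1 h2 => h2.trans h1) fun k => ⟨_, le_rfl⟩
  have hΛ2 : 2 ≤ Λ := le_trans (by have : 0 ≤ ‖y i - y i‖ / ‖v‖ := by positivity
                                   linarith) (hΛ i)
  refine ⟨4 * C₁ + volume.real X + Fintype.card {k : ι // k ≠ j ∧ i ≠ k} * (C₂ * Λ ^ 2),
    by positivity, fun g hg ε hε hε1 => ?_⟩
  set b := g i - g j with hb
  set σ := hyperplaneReflection v b with hσ
  set h : Rd d → ℝ := fun x => score y g i x - score y g j x with hh
  have hhx : ∀ x, h x = inner ℝ x v - b := fun x => score_sub_score i j x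
  have hhσ : ∀ x, h (σ x) = -h x := fun x => by
    rw [hhx, hhx]; exact inner_hyperplaneReflection_sub hv b x
  set ℓ := Real.log (1 / ε) with hℓ
  have hℓ1 : 1 ≤ ℓ := by
    rw [hℓ, one_div, Real.log_inv]
    have := Real.log_le_log hε hε1
    rw [Real.log_exp] at this
    linarith
  set δ := 2 * ε * ℓ with hδ
  have hδ0 : 0 ≤ δ := by positivity
  have hexpδ : Real.exp (-δ / ε) = ε ^ 2 := by
    have : -δ / ε = Real.log ε + Real.log ε := by
      rw [hδ, hℓ, one_div, Real.log_inv]; field_simp; ring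
    rw [this, Real.exp_add, Real.exp_log hε]; ring
  -- an inscribed ball centred on the hyperplane
  obtain ⟨z, hz, hzX⟩ := hball b
    ((hg j).trans (measureReal_restrict_mono hX fun x _ hx => by
      have := hx i
      have := hhx x
      simp only [hh] at this
      simp only [Set.mem_ofPred_eq]; linarith))
    ((hg i).trans (measureReal_restrict_mono hX fun x _ hx => by
      have := hx j
      have := hhx x
      simp only [hh] at this
      simp only [Set.mem_ofPred_eq]; linarith))
  set W : Set (Rd d) := {x | |h x| ≤ δ ∧ σ x ∉ X} with hW
  have hhm : Continuous h := by simp only [hh]; fun_prop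
  have hσm : Continuous σ := continuous_hyperplaneReflection b
  have hWm : MeasurableSet W :=
    (measurableSet_le hhm.measurable.abs measurable_const).inter
      (hσm.measurable hX.measurableSet.compl)
  have hWvol : (volume.restrict X).real W ≤ C₁ * δ ^ 2 := by
    refine (measureReal_restrict_mono hX fun x _ hx => ?_).trans (hbd b z hz hzX δ hδ0)
    refine ⟨by rw [← hhx]; exact hx.1, fun hsub => hx.2 (hsub ?_)⟩
    rw [mem_closedBall_iff_norm, hσ, norm_hyperplaneReflection_sub_self hv, ← hhx]
    gcongr
    exact hx.1
  have hcont : ∀ (k : ι) (η : ℝ), Continuous fun x =>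
      Real.exp (-|h x| / η) * Real.exp (-|score y g k x - score y g j x| / η) := fun k η => by
    fun_prop
  have hint : ∀ (k : ι) (η : ℝ), Integrable (fun x =>
      Real.exp (-|h x| / η) * Real.exp (-|score y g k x - score y g j x| / η))
      (volume.restrict X) := fun k η => (hcont k η).continuousOn.integrableOn_compact hX
  set G : Rd d → ℝ := fun x => W.indicator 1 x + ε ^ 2 +
    ∑ k : {k : ι // k ≠ j ∧ i ≠ k}, Real.exp (-|h x| / (Λ * ε)) *
      Real.exp (-|score y g k x - score y g j x| / (Λ * ε)) with hG
  have hsum0 : ∀ x, 0 ≤ ∑ k : {k : ι // k ≠ j ∧ i ≠ k}, Real.exp (-|h x| / (Λ * ε)) *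
      Real.exp (-|score y g k x - score y g j x| / (Λ * ε)) := fun x =>
    Finset.sum_nonneg fun _ _ => by positivity
  have hWi : Integrable (W.indicator (1 : Rd d → ℝ)) (volume.restrict X) :=
    (integrable_const (1 : ℝ)).indicator hWm
  have hGi : Integrable G (volume.restrict X) :=
    (hWi.add (integrable_const _)).add (integrable_finsetSum _ fun k _ => hint k _)
  have hpt : ∀ x ∈ X, {x | x ∈ X ∩ cell y g j ∧ σ x ∉ X ∩ cell y g i}.indicator
      (fun x => Real.exp (-|h x| / ε)) x ≤ G x := by
    intro x hxX
    have hW0 : 0 ≤ W.indicator (1 : Rd d → ℝ) x := Set.indicator_nonneg (fun _ _ => zero_le_one) _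
    by_cases hx : x ∈ {x | x ∈ X ∩ cell y g j ∧ σ x ∉ X ∩ cell y g i}
    swap
    · rw [Set.indicator_of_notMem hx]
      have := hsum0 x
      simp only [hG]; positivity
    rw [Set.indicator_of_mem hx]
    obtain ⟨⟨-, hxj⟩, hxσ⟩ := hx
    by_cases hσX : σ x ∈ X
    · -- a third score overtakes the score of `i` at the reflected point
      have hσi : σ x ∉ cell y g i := fun h => hxσ ⟨hσX, h⟩
      simp only [mem_cell, not_forall, not_le] at hσi
      obtain ⟨k, hk⟩ := hσi
      have hxh : h x ≤ 0 := by have := hxj i; simp only [hh]; linarith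
      have hkj : k ≠ j := by
        rintro rfl
        have := hhσ x
        simp only [hh] at this hxh
        linarith
      have hik : i ≠ k := by rintro rfl; exact lt_irrefl _ hk
      have hclose : |score y g k x - score y g j x| ≤ (Λ - 1) * |h x| := by
        have e1 := hxj k
        have e2 : score y g k (σ x) - score y g i (σ x) = (score y g k x - score y g i x)
            + inner ℝ (σ x - x) (y k - y i) := by
          rw [score_sub_score, score_sub_score, inner_sub_left]; ring
        have e3 : inner ℝ (σ x - x) (y k - y i) ≤ 2 / ‖v‖ * |h x| * ‖y k - y i‖ := by
          refine (real_inner_le_norm _ _).trans_eq ?_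
          rw [hσ, norm_hyperplaneReflection_sub_self hv, ← hhx]
        have e4 : 2 / ‖v‖ * |h x| * ‖y k - y i‖ = 2 * (‖y k - y i‖ / ‖v‖) * |h x| := by ring
        have e5 := hΛ k
        have e6 : 0 ≤ |h x| := abs_nonneg _
        have e7 : h x = -|h x| := by rw [abs_of_nonpos hxh, neg_neg]
        have e8 : 0 ≤ ‖y k - y i‖ / ‖v‖ := by positivity
        rw [abs_of_nonpos (by linarith)]
        simp only [hh] at e7 e3 e4 e6 ⊢
        nlinarith
      have hle : Real.exp (-|h x| / ε) ≤ Real.exp (-|h x| / (Λ * ε)) *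
          Real.exp (-|score y g k x - score y g j x| / (Λ * ε)) := by
        rw [← Real.exp_add, Real.exp_le_exp, ← add_div, div_le_div_iff₀ hε (by positivity)]
        nlinarith
      have := Finset.single_le_sum (f := fun k : {k : ι // k ≠ j ∧ i ≠ k} =>
        Real.exp (-|h x| / (Λ * ε)) * Real.exp (-|score y g k x - score y g j x| / (Λ * ε)))
        (fun _ _ => by positivity) (Finset.mem_univ ⟨k, hkj, hik⟩)
      simp only [hG]
      have : 0 ≤ ε ^ 2 := by positivity
      linarith
    · have := hsum0 x
      have hε2 : 0 ≤ ε ^ 2 := by positivity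
      simp only [hG]
      obtain hle | hlt := le_or_gt |h x| δ
      · have hxW : x ∈ W := ⟨hle, hσX⟩
        rw [Set.indicator_of_mem hxW, Pi.one_apply]
        have : Real.exp (-|h x| / ε) ≤ 1 := Real.exp_le_one_iff.2
          (div_nonpos_of_nonpos_of_nonneg (neg_nonpos.2 (abs_nonneg _)) hε.le)
        linarith
      · have : Real.exp (-|h x| / ε) ≤ ε ^ 2 := by
          rw [← hexpδ]; gcongr
        linarith
  have hindX : ∀ x, {x | x ∈ X ∩ cell y g j ∧ σ x ∉ X ∩ cell y g i}.indicator
      (fun x => Real.exp (-|h x| / ε)) x = X.indicator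
      ({x | x ∈ X ∩ cell y g j ∧ σ x ∉ X ∩ cell y g i}.indicator
        (fun x => Real.exp (-|h x| / ε))) x := by
    intro x
    by_cases hxX : x ∈ X
    · rw [Set.indicator_of_mem hxX]
    · rw [Set.indicator_of_notMem hxX, Set.indicator_of_notMem fun hx => hxX hx.1.1]
  rw [integral_congr_ae (Filter.Eventually.of_forall hindX), integral_indicator hX.measurableSet]
  calc ∫ x in X, {x | x ∈ X ∩ cell y g j ∧ σ x ∉ X ∩ cell y g i}.indicator
        (fun x => Real.exp (-|h x| / ε)) x
      ≤ ∫ x in X, G x := by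
        refine integral_mono_of_nonneg (Filter.Eventually.of_forall fun x =>
          Set.indicator_nonneg (fun _ _ => by positivity) _) hGi ?_
        filter_upwards [ae_restrict_mem hX.measurableSet] with x hx using hpt x hx
    _ = (volume.restrict X).real W + volume.real X * ε ^ 2 +
        ∑ k : {k : ι // k ≠ j ∧ i ≠ k}, ∫ x in X, Real.exp (-|h x| / (Λ * ε)) *
          Real.exp (-|score y g k x - score y g j x| / (Λ * ε)) := by
        simp only [hG]
        have hWc : Integrable (fun x => W.indicator (1 : Rd d → ℝ) x + ε ^ 2)
          (volume.restrict X) := hWi.add (integrable_const _)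
        rw [integral_add hWc
          (integrable_finsetSum _ fun (k : {k : ι // k ≠ j ∧ i ≠ k}) _ => hint k (Λ * ε)),
          integral_add hWi (integrable_const _),
          integral_finsetSum _ fun (k : {k : ι // k ≠ j ∧ i ≠ k}) _ => hint k (Λ * ε),
          integral_indicator_one hWm,
          setIntegral_const, smul_eq_mul]
    _ ≤ C₁ * δ ^ 2 + volume.real X * ε ^ 2 +
        ∑ k : {k : ι // k ≠ j ∧ i ≠ k}, C₂ * (Λ * ε) ^ 2 := by
        gcongr with k
        exact htri k g hg (Λ * ε) (by positivity)
    _ = 4 * C₁ * (ε ^ 2 * ℓ ^ 2) + (volume.real X +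
        Fintype.card {k : ι // k ≠ j ∧ i ≠ k} * (C₂ * Λ ^ 2)) * (ε ^ 2 * 1) := by
        rw [Finset.sum_const, Finset.card_univ, nsmul_eq_mul, hδ]; ring
    _ ≤ 4 * C₁ * (ε ^ 2 * ℓ ^ 2) + (volume.real X +
        Fintype.card {k : ι // k ≠ j ∧ i ≠ k} * (C₂ * Λ ^ 2)) * (ε ^ 2 * ℓ ^ 2) := by
        gcongr
        exact one_le_pow₀ hℓ1
    _ = _ := by ring

lemma hyperplaneReflection_neg {d : ℕ} (v : Rd d) (b : ℝ) :
    hyperplaneReflection (-v) (-b) = hyperplaneReflection v b := by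
  funext x
  simp only [hyperplaneReflection, inner_neg_right, norm_neg]
  module

lemma rpow_mul_exp_neg_div_le {t ε α : ℝ} (ht : 0 ≤ t) (hε : 0 < ε) (hα0 : 0 < α) (hα1 : α ≤ 1) :
    t ^ α * Real.exp (-t / ε) ≤ 2 * ε ^ α * Real.exp (-t / (2 * ε)) := by
  set s := t / ε with hs
  have hs0 : 0 ≤ s := by positivity
  have ht' : t = ε * s := by rw [hs]; field_simp
  have h1 : s ^ α ≤ 1 + s := by
    calc s ^ α ≤ (1 + s) ^ α := Real.rpow_le_rpow hs0 (by linarith) hα0.le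
      _ ≤ (1 + s) ^ (1 : ℝ) := Real.rpow_le_rpow_of_exponent_le (by linarith) hα1
      _ = 1 + s := Real.rpow_one _
  have h2 : 1 + s ≤ 2 * Real.exp (s / 2) := by
    have := Real.add_one_le_exp (s / 2)
    linarith
  have h3 : Real.exp (-t / ε) = Real.exp (-s) := by rw [hs, neg_div]
  have h4 : Real.exp (-t / (2 * ε)) = Real.exp (s / 2) * Real.exp (-s) := by
    rw [← Real.exp_add, ht']; congr 1; field_simp; ring
  rw [h3, h4, ht', Real.mul_rpow hε.le hs0]
  calc ε ^ α * s ^ α * Real.exp (-s)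
      ≤ ε ^ α * (2 * Real.exp (s / 2)) * Real.exp (-s) := by gcongr; exact h1.trans h2
    _ = _ := by ring

/-! ### Cancellation across the interface of two cells -/

/-- The two-point softmax weight of the lower one of two scores that differ by `t`. -/
noncomputable def halfSigmoid (ε t : ℝ) : ℝ := 1 / (1 + Real.exp (|t| / ε))

lemma halfSigmoid_nonneg (ε t : ℝ) : 0 ≤ halfSigmoid ε t := by
  unfold halfSigmoid; positivity

lemma halfSigmoid_le (ε t : ℝ) : halfSigmoid ε t ≤ Real.exp (-|t| / ε) := by
  rw [halfSigmoid, neg_div, Real.exp_neg, one_div]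
  gcongr
  linarith

@[fun_prop]
lemma continuous_halfSigmoid (ε : ℝ) : Continuous (halfSigmoid ε) := by
  unfold halfSigmoid
  refine continuous_const.div (by fun_prop) fun t => by positivity

/-- The weight is even in the difference of the two scores, so the contributions of the two sides of
the interface cancel under the reflection, up to the variation of `F` over a distance `O(ε)` and up
to the points at which the reflection does not exchange the two cells. -/
lemma exists_abs_integral_halfSigmoid_le {d : ℕ} {ι : Type*} [Fintype ι] {X : Set (Rd d)}
    (hX : IsCompact X) (hXc : Convex ℝ X) (hXi : (interior X).Nonempty)
    {y : ι → Rd d} (hy : Function.Injective y) {i j : ι} (hij : i ≠ j) {c : ℝ} (hc : 0 < c) :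
    ∃ C : ℝ, 0 < C ∧ ∀ g : ι → ℝ, (∀ l, c ≤ (volume.restrict X).real (cell y g l)) →
      ∀ ε : ℝ, 0 < ε → ε ≤ Real.exp (-1) → ∀ α : ℝ, 0 < α → α ≤ 1 →
      ∀ F : Rd d → ℝ, Measurable F → ∀ B K : ℝ, 0 ≤ B → 0 ≤ K → (∀ x ∈ X, |F x| ≤ B) →
        (∀ x ∈ X, ∀ x' ∈ X, |F x - F x'| ≤ K * ‖x - x'‖ ^ α) →
      |∫ x in X, F x * (halfSigmoid ε (score y g i x - score y g j x) *
          ((cell y g j).indicator 1 x - (cell y g i).indicator 1 x))|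
        ≤ C * (B * (ε ^ 2 * Real.log (1 / ε) ^ 2) + K * ε ^ (1 + α)) := by
  have hfin : volume X < ∞ := hX.isBounded.measure_lt_top
  have hv : y i - y j ≠ 0 := sub_ne_zero.2 (hy.ne hij)
  have hv0 : 0 < ‖y i - y j‖ := norm_pos_iff.2 hv
  obtain ⟨C₁, hC₁, h₁⟩ := exists_integral_exp_defect_le hX hXc hXi hy hij hc
  obtain ⟨C₂, hC₂, h₂⟩ := exists_integral_exp_defect_le hX hXc hXi hy hij.symm hc
  obtain ⟨C₃, hC₃, h₃⟩ := exists_integral_exp_strip_le hX hv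
  set κ : ℝ := 2 / ‖y i - y j‖ with hκ
  have hκ0 : 0 < κ := by positivity
  refine ⟨C₁ + C₂ + (κ + 1) * (4 * C₃), by positivity,
    fun g hg ε hε hε1 α hα0 hα1 F hF B K hB hK hFB hFK => ?_⟩
  set v := y i - y j with hvdef
  set b := g i - g j with hb
  set σ := hyperplaneReflection v b with hσ
  set h : Rd d → ℝ := fun x => score y g i x - score y g j x with hh
  have hhx : ∀ x, h x = inner ℝ x v - b := fun x => score_sub_score i j x
  have hhσ : ∀ x, h (σ x) = -h x := fun x => by
    rw [hhx, hhx]; exact inner_hyperplaneReflection_sub hv b x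
  have hhc : Continuous h := by simp only [hh]; fun_prop
  have hσc : Continuous σ := continuous_hyperplaneReflection b
  have hσσ : ∀ x, σ (σ x) = x := hyperplaneReflection_involutive hv b
  have hσmp : MeasurePreserving σ volume volume := measurePreserving_hyperplaneReflection b
  set A : Set (Rd d) := X ∩ cell y g j with hA
  set A' : Set (Rd d) := X ∩ cell y g i with hA'
  have hAm : MeasurableSet A := hX.measurableSet.inter (measurableSet_cell j)
  have hAm' : MeasurableSet A' := hX.measurableSet.inter (measurableSet_cell i)
  set S : Rd d → ℝ := fun x => halfSigmoid ε (h x) with hS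
  have hSc : Continuous S := by simp only [hS]; fun_prop
  have hS0 : ∀ x, 0 ≤ S x := fun x => halfSigmoid_nonneg _ _
  set e : Rd d → ℝ := fun x => Real.exp (-|h x| / ε) with he
  have hec : Continuous e := by simp only [he]; fun_prop
  have hSe : ∀ x, S x ≤ e x := fun x => halfSigmoid_le _ _
  have he1 : ∀ x, e x ≤ 1 := fun x => Real.exp_le_one_iff.2
    (div_nonpos_of_nonpos_of_nonneg (neg_nonpos.2 (abs_nonneg _)) hε.le)
  have hSσ : ∀ x, S (σ x) = S x := fun x => by simp only [hS, halfSigmoid, hhσ, abs_neg]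
  have heσ : ∀ x, e (σ x) = e x := fun x => by simp only [he, hhσ, abs_neg]
  have hfinI : ∀ T : Set (Rd d), MeasurableSet T → T ⊆ X → ∀ f : Rd d → ℝ, Measurable f →
      ∀ M : ℝ, (∀ x ∈ X, |f x| ≤ M) → Integrable (T.indicator f) := by
    intro T hT hTX f hf M hM
    rw [integrable_indicator_iff hT]
    refine Measure.integrableOn_of_bounded (M := M) ((measure_mono hTX).trans_lt hfin).ne
      hf.aestronglyMeasurable ?_
    filter_upwards [ae_restrict_mem hT] with x hx using hM x (hTX hx)
  have hFS : Measurable fun x => F x * S x := hF.mul hSc.measurable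
  have hFSb : ∀ x ∈ X, |F x * S x| ≤ B := fun x hx => by
    rw [abs_mul, abs_of_nonneg (hS0 x)]
    calc |F x| * S x ≤ B * 1 := mul_le_mul (hFB x hx) ((hSe x).trans (he1 x)) (hS0 x) hB
      _ = B := mul_one B
  set wA : Rd d → ℝ := A.indicator fun x => F x * S x with hwA
  set wA' : Rd d → ℝ := A'.indicator fun x => F x * S x with hwA'
  have hwAi : Integrable wA := hfinI A hAm Set.inter_subset_left _ hFS B hFSb
  have hwAi' : Integrable wA' := hfinI A' hAm' Set.inter_subset_left _ hFS B hFSb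
  have hwAσ : Integrable (fun x => wA' (σ x)) := hσmp.integrable_comp_of_integrable hwAi'
  have hσemb : MeasurableEmbedding σ :=
    (Homeomorph.mk ⟨σ, σ, hσσ, hσσ⟩ hσc hσc).measurableEmbedding
  have hLHS : ∫ x in X, F x * (S x * ((cell y g j).indicator 1 x - (cell y g i).indicator 1 x))
      = ∫ x, (wA x - wA' (σ x)) := by
    rw [integral_sub hwAi hwAσ, hσmp.integral_comp hσemb, ← integral_sub hwAi hwAi',
      ← integral_indicator hX.measurableSet]
    refine integral_congr_ae (Filter.Eventually.of_forall fun x => ?_)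
    simp only [hwA, hwA', hA, hA', Set.indicator, Set.mem_inter_iff, Pi.one_apply]
    by_cases hx : x ∈ X <;> by_cases h1 : x ∈ cell y g j <;> by_cases h2 : x ∈ cell y g i <;>
      simp [hx, h1, h2]
  set D : Rd d → ℝ := {x | x ∈ A ∧ σ x ∉ A'}.indicator e with hD
  set D' : Rd d → ℝ := {x | x ∈ A' ∧ σ x ∉ A}.indicator e with hD'
  have hDm : MeasurableSet {x | x ∈ A ∧ σ x ∉ A'} :=
    hAm.inter (hσc.measurable hAm').compl
  have hDm' : MeasurableSet {x | x ∈ A' ∧ σ x ∉ A} :=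
    hAm'.inter (hσc.measurable hAm).compl
  have he1' : ∀ x ∈ X, |e x| ≤ 1 := fun x _ => by
    rw [abs_of_nonneg (by positivity : 0 ≤ e x)]; exact he1 x
  have hDi : Integrable D := hfinI _ hDm (fun x hx => hx.1.1) _ hec.measurable 1 he1'
  have hDi' : Integrable D' := hfinI _ hDm' (fun x hx => hx.1.1) _ hec.measurable 1 he1'
  have hDσ : Integrable (fun x => D' (σ x)) := hσmp.integrable_comp_of_integrable hDi'
  have hDint : ∫ x, D x ≤ C₁ * (ε ^ 2 * Real.log (1 / ε) ^ 2) := h₁ g hg ε hε hε1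
  have hDint' : ∫ x, D' (σ x) ≤ C₂ * (ε ^ 2 * Real.log (1 / ε) ^ 2) := by
    rw [hσmp.integral_comp hσemb]
    have := h₂ g hg ε hε hε1
    have hr : hyperplaneReflection (y j - y i) (g j - g i) = σ := by
      rw [hσ, ← hyperplaneReflection_neg, hvdef, hb, neg_sub, neg_sub]
    simp only [hr] at this
    convert this using 3
    rw [hD', he]
    simp only [hh, hA, hA', abs_sub_comm]
  set H : Rd d → ℝ := X.indicator fun x => K * ((κ + 1) * (2 * ε ^ α *
    Real.exp (-|h x| / (2 * ε)))) with hH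
  have hHi : Integrable H := by
    rw [hH, integrable_indicator_iff hX.measurableSet]
    exact (by fun_prop : Continuous fun x => K * ((κ + 1) * (2 * ε ^ α *
      Real.exp (-|h x| / (2 * ε))))).continuousOn.integrableOn_compact hX
  have hHint : ∫ x, H x ≤ (κ + 1) * (4 * C₃) * (K * ε ^ (1 + α)) := by
    rw [hH, integral_indicator hX.measurableSet, integral_const_mul, integral_const_mul,
      integral_const_mul]
    simp only [hhx]
    have := h₃ b (2 * ε) (by positivity)
    calc K * ((κ + 1) * (2 * ε ^ α * ∫ x in X, Real.exp (-|inner ℝ x v - b| / (2 * ε))))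
        ≤ K * ((κ + 1) * (2 * ε ^ α * (C₃ * (2 * ε)))) := by gcongr
      _ = (κ + 1) * (4 * C₃) * (K * (ε * ε ^ α)) := by ring
      _ = _ := by rw [Real.rpow_add hε, Real.rpow_one]
  have hpt : ∀ x, ‖wA x - wA' (σ x)‖ ≤ H x + (B * D x + B * D' (σ x)) := by
    intro x
    have hH0 : 0 ≤ H x := Set.indicator_nonneg (fun x _ => by positivity) _
    have hD0 : 0 ≤ D x := Set.indicator_nonneg (fun x _ => by positivity) _
    have hD0' : 0 ≤ D' (σ x) := Set.indicator_nonneg (fun x _ => by positivity) _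
    rw [Real.norm_eq_abs]
    by_cases hxA : x ∈ A <;> by_cases hxA' : σ x ∈ A'
    · have e1 : wA x - wA' (σ x) = (F x - F (σ x)) * S x := by
        simp only [hwA, hwA']
        rw [Set.indicator_of_mem hxA, Set.indicator_of_mem hxA', hSσ]; ring
      have e2 : H x = K * ((κ + 1) * (2 * ε ^ α * Real.exp (-|h x| / (2 * ε)))) := by
        simp only [hH]; rw [Set.indicator_of_mem hxA.1]
      have e3 : ‖x - σ x‖ = κ * |h x| := by
        rw [norm_sub_rev, hhx]; exact norm_hyperplaneReflection_sub_self hv b x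
      have e4 : (κ * |h x|) ^ α ≤ (κ + 1) * |h x| ^ α := by
        rw [Real.mul_rpow hκ0.le (abs_nonneg _)]
        gcongr
        calc κ ^ α ≤ (κ + 1) ^ α := Real.rpow_le_rpow hκ0.le (by linarith) hα0.le
          _ ≤ (κ + 1) ^ (1 : ℝ) := Real.rpow_le_rpow_of_exponent_le (by linarith) hα1
          _ = κ + 1 := Real.rpow_one _
      have e5 : |wA x - wA' (σ x)| ≤ H x := by
        rw [e1, e2, abs_mul, abs_of_nonneg (hS0 x)]
        calc |F x - F (σ x)| * S x ≤ (K * (κ * |h x|) ^ α) * e x := by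
              have := hFK x hxA.1 (σ x) hxA'.1
              rw [e3] at this
              exact mul_le_mul this (hSe x) (hS0 x) (by positivity)
          _ ≤ (K * ((κ + 1) * |h x| ^ α)) * e x := by gcongr
          _ = K * ((κ + 1) * (|h x| ^ α * e x)) := by ring
          _ ≤ _ := by
              refine mul_le_mul_of_nonneg_left (mul_le_mul_of_nonneg_left ?_ (by positivity)) hK
              exact rpow_mul_exp_neg_div_le (abs_nonneg _) hε hα0 hα1
      have : 0 ≤ B * D x + B * D' (σ x) := by positivity
      linarith
    · have e1 : wA x - wA' (σ x) = F x * S x := by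
        simp only [hwA, hwA']
        rw [Set.indicator_of_mem hxA, Set.indicator_of_notMem hxA', sub_zero]
      have e2 : D x = e x := Set.indicator_of_mem (show x ∈ {x | x ∈ A ∧ σ x ∉ A'} from
        ⟨hxA, hxA'⟩) _
      have e3 : |F x * S x| ≤ B * e x := by
        rw [abs_mul, abs_of_nonneg (hS0 x)]
        exact mul_le_mul (hFB x hxA.1) (hSe x) (hS0 x) hB
      rw [e1, e2]
      have : 0 ≤ B * D' (σ x) := by positivity
      linarith
    · have e1 : wA x - wA' (σ x) = -(F (σ x) * S (σ x)) := by
        simp only [hwA, hwA']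
        rw [Set.indicator_of_notMem hxA, Set.indicator_of_mem hxA', zero_sub]
      have e2 : D' (σ x) = e (σ x) := Set.indicator_of_mem
        (show σ x ∈ {x | x ∈ A' ∧ σ x ∉ A} from ⟨hxA', by rwa [hσσ]⟩) _
      have e3 : |F (σ x) * S (σ x)| ≤ B * e (σ x) := by
        rw [abs_mul, abs_of_nonneg (hS0 _)]
        exact mul_le_mul (hFB _ hxA'.1) (hSe _) (hS0 _) hB
      rw [e1, e2, abs_neg]
      have : 0 ≤ B * D x := by positivity
      linarith
    · have e1 : wA x - wA' (σ x) = 0 := by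
        simp only [hwA, hwA']
        rw [Set.indicator_of_notMem hxA, Set.indicator_of_notMem hxA', sub_zero]
      rw [e1, abs_zero]
      positivity
  rw [hLHS]
  have hsumi : Integrable fun x => B * D x + B * D' (σ x) :=
    (hDi.const_mul B).add (hDσ.const_mul B)
  calc |∫ x, (wA x - wA' (σ x))| ≤ ∫ x, (H x + (B * D x + B * D' (σ x))) :=
        norm_integral_le_of_norm_le (hHi.add hsumi) (Filter.Eventually.of_forall hpt)
    _ = (∫ x, H x) + (B * (∫ x, D x) + B * ∫ x, D' (σ x)) := by
        rw [integral_add hHi hsumi, integral_add (hDi.const_mul B) (hDσ.const_mul B),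
          integral_const_mul, integral_const_mul]
    _ ≤ (κ + 1) * (4 * C₃) * (K * ε ^ (1 + α)) + (B * (C₁ * (ε ^ 2 * Real.log (1 / ε) ^ 2)) +
        B * (C₂ * (ε ^ 2 * Real.log (1 / ε) ^ 2))) := by gcongr
    _ ≤ _ := by
        have e1 : 0 ≤ B * (ε ^ 2 * Real.log (1 / ε) ^ 2) := by positivity
        have e2 : 0 ≤ K * ε ^ (1 + α) := by positivity
        have e3 : 0 ≤ (κ + 1) * (4 * C₃) := by positivity
        nlinarith [mul_nonneg e3 e1, mul_nonneg (add_pos hC₁ hC₂).le e2]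

/-! ### Softmax weights -/

/-- The weight `exp (aᵢ / ε) / ∑ⱼ exp (aⱼ / ε)` of the score `aᵢ`. -/
noncomputable def softmax {d : ℕ} {ι : Type*} [Fintype ι] (y : ι → Rd d) (g : ι → ℝ) (ε : ℝ)
    (i : ι) (x : Rd d) : ℝ :=
  Real.exp (score y g i x / ε) / ∑ j, Real.exp (score y g j x / ε)

section Softmax

variable {d : ℕ} {ι : Type*} [Fintype ι] {y : ι → Rd d} {g : ι → ℝ} {ε : ℝ}

lemma softmax_denom_pos [Nonempty ι] (x : Rd d) : 0 < ∑ j, Real.exp (score y g j x / ε) :=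
  Finset.sum_pos (fun _ _ => Real.exp_pos _) Finset.univ_nonempty

lemma softmax_nonneg (i : ι) (x : Rd d) : 0 ≤ softmax y g ε i x :=
  div_nonneg (Real.exp_pos _).le (Finset.sum_nonneg fun _ _ => (Real.exp_pos _).le)

lemma sum_softmax [Nonempty ι] (x : Rd d) : ∑ i, softmax y g ε i x = 1 := by
  simp only [softmax]
  rw [← Finset.sum_div, div_self (softmax_denom_pos x).ne']

lemma softmax_le_one (i : ι) (x : Rd d) : softmax y g ε i x ≤ 1 := by
  have : Nonempty ι := ⟨i⟩
  rw [← sum_softmax (y := y) (g := g) (ε := ε) x]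
  exact Finset.single_le_sum (f := fun i => softmax y g ε i x)
    (fun _ _ => softmax_nonneg _ _) (Finset.mem_univ i)

@[fun_prop]
lemma continuous_softmax (i : ι) : Continuous (softmax y g ε i) := by
  have : Nonempty ι := ⟨i⟩
  unfold softmax
  refine Continuous.div (by fun_prop) (by fun_prop) fun x => (softmax_denom_pos x).ne'

lemma softmax_le_exp (i j : ι) (x : Rd d) :
    softmax y g ε i x ≤ Real.exp ((score y g i x - score y g j x) / ε) := by
  have : Nonempty ι := ⟨i⟩
  rw [softmax, sub_div, Real.exp_sub]
  gcongr
  exact Finset.single_le_sum (f := fun j => Real.exp (score y g j x / ε))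
    (fun _ _ => (Real.exp_pos _).le) (Finset.mem_univ j)

lemma softmax_le_indicator_add [DecidableEq ι] (i : ι) (x : Rd d) :
    softmax y g ε i x ≤ (cell y g i).indicator 1 x +
      ∑ j : {j // j ≠ i}, Real.exp (-|score y g i x - score y g j x| / ε) := by
  have h0 : 0 ≤ ∑ j : {j // j ≠ i}, Real.exp (-|score y g i x - score y g j x| / ε) :=
    Finset.sum_nonneg fun _ _ => (Real.exp_pos _).le
  by_cases hx : x ∈ cell y g i
  · rw [Set.indicator_of_mem hx, Pi.one_apply]
    linarith [softmax_le_one (y := y) (g := g) (ε := ε) i x]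
  · rw [Set.indicator_of_notMem hx, zero_add]
    simp only [mem_cell, not_forall, not_le] at hx
    obtain ⟨j, hj⟩ := hx
    have hji : j ≠ i := by rintro rfl; exact lt_irrefl _ hj
    refine (softmax_le_exp i j x).trans ?_
    refine le_trans (le_of_eq ?_) (Finset.single_le_sum (f := fun j : {j // j ≠ i} =>
      Real.exp (-|score y g i x - score y g j x| / ε)) (fun _ _ => (Real.exp_pos _).le)
      (Finset.mem_univ ⟨j, hji⟩))
    simp only
    rw [abs_of_neg (by linarith), neg_neg]

/-- On the cell of `j`, the softmax weight of `i` differs from the one computed from `i` and `j`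
alone by the contributions of third indices. -/
lemma abs_softmax_sub_halfSigmoid_le [DecidableEq ι] {i j : ι} (hij : i ≠ j) {x : Rd d} (hx : x ∈ cell y g j) :
    |softmax y g ε i x - halfSigmoid ε (score y g i x - score y g j x)| ≤
      ∑ k : {k : ι // k ≠ j ∧ i ≠ k}, Real.exp (-|score y g i x - score y g j x| / ε) *
        Real.exp (-|score y g k x - score y g j x| / ε) := by
  have : Nonempty ι := ⟨i⟩
  set Z := ∑ j, Real.exp (score y g j x / ε) with hZ
  have hZ0 : 0 < Z := softmax_denom_pos x
  set a := Real.exp (score y g i x / ε) with ha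
  set b := Real.exp (score y g j x / ε) with hb
  have ha0 : 0 < a := Real.exp_pos _
  have hb0 : 0 < b := Real.exp_pos _
  have hS : halfSigmoid ε (score y g i x - score y g j x) = a / (a + b) := by
    have h1 : |score y g i x - score y g j x| / ε = score y g j x / ε - score y g i x / ε := by
      rw [abs_of_nonpos (by linarith [hx i])]; ring
    rw [halfSigmoid, h1, Real.exp_sub, ← ha, ← hb]
    field_simp
  have hrest : Z - (a + b) = ∑ k : {k : ι // k ≠ j ∧ i ≠ k}, Real.exp (score y g k x / ε) := by
    have h1 : ∑ k : {k : ι // k ≠ j ∧ i ≠ k}, Real.exp (score y g k x / ε)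
        = ∑ k ∈ Finset.univ.filter (fun k => k ≠ j ∧ i ≠ k), Real.exp (score y g k x / ε) :=
      (Finset.sum_subtype _ (by simp) fun k => Real.exp (score y g k x / ε)).symm
    have h2 : Finset.univ.filter (fun k => k ≠ j ∧ i ≠ k) = (Finset.univ.erase i).erase j := by
      ext k; simp [eq_comm]
    have h3 := Finset.add_sum_erase Finset.univ (fun k => Real.exp (score y g k x / ε))
      (Finset.mem_univ i)
    have h4 := Finset.add_sum_erase (Finset.univ.erase i)
      (fun k => Real.exp (score y g k x / ε)) (Finset.mem_erase.2 ⟨hij.symm, Finset.mem_univ j⟩)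
    rw [h1, h2]
    simp only [← ha, ← hb] at h3 h4
    linarith
  have hdiff : a / (a + b) - a / Z = ∑ k : {k : ι // k ≠ j ∧ i ≠ k},
      a / (a + b) * softmax y g ε k x := by
    have h1 : a / (a + b) - a / Z = a / (a + b) * ((Z - (a + b)) / Z) := by
      field_simp
    rw [h1, hrest, ← Finset.mul_sum, Finset.sum_div]
    rfl
  have hsm : softmax y g ε i x = a / Z := rfl
  rw [hS, hsm, abs_sub_comm, hdiff,
    abs_of_nonneg (Finset.sum_nonneg fun k _ => mul_nonneg (by positivity) (softmax_nonneg _ _))]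
  refine Finset.sum_le_sum fun k _ => mul_le_mul ?_ ?_ (softmax_nonneg _ _) (Real.exp_pos _).le
  · rw [← hS]; exact halfSigmoid_le _ _
  · refine (softmax_le_exp (k : ι) j x).trans (le_of_eq ?_)
    rw [abs_of_nonpos (by linarith [hx k]), neg_neg]

end Softmax

/-- Laguerre cells overlap in a null set. -/
lemma ae_sum_indicator_cell {d : ℕ} {ι : Type*} [Fintype ι] [Nonempty ι] {X : Set (Rd d)}
    (hX : IsCompact X) {y : ι → Rd d} (hy : Function.Injective y) (g : ι → ℝ) :
    ∀ᵐ x ∂(volume.restrict X), ∑ i, (cell y g i).indicator (1 : Rd d → ℝ) x = 1 := by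
  classical
  have hfin : IsFiniteMeasure (volume.restrict X) :=
    ⟨by simpa using hX.isBounded.measure_lt_top⟩
  have hties : ∀ᵐ x ∂(volume.restrict X), ∀ i j, i ≠ j → score y g i x ≠ score y g j x := by
    simp only [ae_all_iff]
    intro i j hij
    have hv : y i - y j ≠ 0 := sub_ne_zero.2 (hy.ne hij)
    obtain ⟨C, -, hC⟩ := exists_measureReal_strip_le hX hv
    have h0 := hC (g i - g j) 0 le_rfl
    rw [mul_zero] at h0
    have h1 := (measureReal_eq_zero_iff (by finiteness)).1 (le_antisymm h0 measureReal_nonneg)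
    rw [← compl_compl {x | |inner ℝ x (y i - y j) - (g i - g j)| ≤ 0}] at h1
    filter_upwards [mem_ae_iff.2 h1] with x hx heq
    apply hx
    simp only [Set.mem_ofPred_eq]
    rw [← score_sub_score, heq, sub_self, abs_zero]
  filter_upwards [hties] with x hx
  obtain ⟨i, hi⟩ := exists_mem_cell y g x
  rw [Finset.sum_eq_single i, Set.indicator_of_mem hi, Pi.one_apply]
  · intro j _ hji
    exact Set.indicator_of_notMem (fun hj : x ∈ cell y g j =>
      hx i j hji.symm (le_antisymm (hj i) (hi j))) _
  · simp

lemma indicator_one_mem_Icc {α : Type*} (s : Set α) (x : α) :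
    0 ≤ s.indicator (1 : α → ℝ) x ∧ s.indicator (1 : α → ℝ) x ≤ 1 := by
  by_cases h : x ∈ s <;> simp [h]

/-- The mass that softmax moves across the interface of two cells is the same in both directions,
up to the error in the statement. -/
lemma exists_abs_integral_softmax_exchange_le {d : ℕ} {ι : Type*} [Fintype ι] {X : Set (Rd d)}
    (hX : IsCompact X) (hXc : Convex ℝ X) (hXi : (interior X).Nonempty)
    {y : ι → Rd d} (hy : Function.Injective y) {i j : ι} (hij : i ≠ j) {c : ℝ} (hc : 0 < c) :
    ∃ C : ℝ, 0 < C ∧ ∀ g : ι → ℝ, (∀ l, c ≤ (volume.restrict X).real (cell y g l)) →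
      ∀ ε : ℝ, 0 < ε → ε ≤ Real.exp (-1) → ∀ α : ℝ, 0 < α → α ≤ 1 →
      ∀ F : Rd d → ℝ, Measurable F → ∀ B K : ℝ, 0 ≤ B → 0 ≤ K → (∀ x ∈ X, |F x| ≤ B) →
        (∀ x ∈ X, ∀ x' ∈ X, |F x - F x'| ≤ K * ‖x - x'‖ ^ α) →
      |∫ x in X, F x * (softmax y g ε i x * (cell y g j).indicator 1 x -
          softmax y g ε j x * (cell y g i).indicator 1 x)|
        ≤ C * (B * (ε ^ 2 * Real.log (1 / ε) ^ 2) + K * ε ^ (1 + α)) := by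
  classical
  have hfin : IsFiniteMeasure (volume.restrict X) :=
    ⟨by simpa using hX.isBounded.measure_lt_top⟩
  obtain ⟨C₁, hC₁, h₁⟩ := exists_abs_integral_halfSigmoid_le hX hXc hXi hy hij hc
  have htri : ∀ i j : ι, i ≠ j → ∀ k : {k : ι // k ≠ j ∧ i ≠ k}, ∃ C : ℝ, ∀ g : ι → ℝ,
      (∀ l, c ≤ (volume.restrict X).real (cell y g l)) → ∀ ε : ℝ, 0 < ε →
      ∫ x in X, Real.exp (-|score y g i x - score y g j x| / ε) *
        Real.exp (-|score y g k x - score y g j x| / ε) ≤ C * ε ^ 2 := fun i j hij k =>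
    (exists_integral_exp_triple_le hX hy hij k.2.1 k.2.2 hc).imp fun C h => h.2
  obtain ⟨C₂, hC₂, h₂⟩ := exists_pos_forall_of_mono (fun k C C' hCC' h g hg ε hε =>
    (h g hg ε hε).trans (by gcongr)) (htri i j hij)
  obtain ⟨C₃, hC₃, h₃⟩ := exists_pos_forall_of_mono (fun k C C' hCC' h g hg ε hε =>
    (h g hg ε hε).trans (by gcongr)) (htri j i hij.symm)
  set n₁ : ℝ := (Fintype.card {k : ι // k ≠ j ∧ i ≠ k} : ℝ) with hn₁
  set n₂ : ℝ := (Fintype.card {k : ι // k ≠ i ∧ j ≠ k} : ℝ) with hn₂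
  refine ⟨C₁ + (n₁ * C₂ + n₂ * C₃), by positivity,
    fun g hg ε hε hε1 α hα0 hα1 F hF B K hB hK hFB hFK => ?_⟩
  have hℓ1 : 1 ≤ Real.log (1 / ε) := by
    rw [one_div, Real.log_inv]
    have := Real.log_le_log hε hε1
    rw [Real.log_exp] at this
    linarith
  set S : Rd d → ℝ := fun x => halfSigmoid ε (score y g i x - score y g j x) with hS
  have hSsymm : ∀ x, S x = halfSigmoid ε (score y g j x - score y g i x) := fun x => by
    simp only [hS, halfSigmoid, abs_sub_comm]
  set χi : Rd d → ℝ := (cell y g i).indicator 1 with hχi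
  set χj : Rd d → ℝ := (cell y g j).indicator 1 with hχj
  have hχim : Measurable χi := measurable_one.indicator (measurableSet_cell i)
  have hχjm : Measurable χj := measurable_one.indicator (measurableSet_cell j)
  set E₁ : Rd d → ℝ := fun x => ∑ k : {k : ι // k ≠ j ∧ i ≠ k},
    Real.exp (-|score y g i x - score y g j x| / ε) *
      Real.exp (-|score y g k x - score y g j x| / ε) with hE₁
  set E₂ : Rd d → ℝ := fun x => ∑ k : {k : ι // k ≠ i ∧ j ≠ k},
    Real.exp (-|score y g j x - score y g i x| / ε) *
      Real.exp (-|score y g k x - score y g i x| / ε) with hE₂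
  have hint : ∀ i j k : ι, Integrable (fun x =>
      Real.exp (-|score y g i x - score y g j x| / ε) *
      Real.exp (-|score y g k x - score y g j x| / ε)) (volume.restrict X) := fun i j k =>
    (by fun_prop : Continuous fun x => Real.exp (-|score y g i x - score y g j x| / ε) *
      Real.exp (-|score y g k x - score y g j x| / ε)).continuousOn.integrableOn_compact hX
  have hE₁i : Integrable E₁ (volume.restrict X) :=
    integrable_finsetSum _ fun k _ => hint i j k
  have hE₂i : Integrable E₂ (volume.restrict X) :=
    integrable_finsetSum _ fun k _ => hint j i k
  have hE₁0 : ∀ x, 0 ≤ E₁ x := fun x => Finset.sum_nonneg fun _ _ => by positivity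
  have hE₂0 : ∀ x, 0 ≤ E₂ x := fun x => Finset.sum_nonneg fun _ _ => by positivity
  have hE₁int : ∫ x in X, E₁ x ≤ n₁ * C₂ * ε ^ 2 := by
    simp only [hE₁]
    rw [integral_finsetSum _ fun (k : {k : ι // k ≠ j ∧ i ≠ k}) _ => hint i j k]
    refine (Finset.sum_le_sum fun k _ => h₂ k g hg ε hε).trans_eq ?_
    rw [Finset.sum_const, Finset.card_univ, nsmul_eq_mul]; ring
  have hE₂int : ∫ x in X, E₂ x ≤ n₂ * C₃ * ε ^ 2 := by
    simp only [hE₂]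
    rw [integral_finsetSum _ fun (k : {k : ι // k ≠ i ∧ j ≠ k}) _ => hint j i k]
    refine (Finset.sum_le_sum fun k _ => h₃ k g hg ε hε).trans_eq ?_
    rw [Finset.sum_const, Finset.card_univ, nsmul_eq_mul]; ring
  have hbdd : ∀ f : Rd d → ℝ, Measurable f → (∀ x, |f x| ≤ 1) →
      Integrable (fun x => F x * f x) (volume.restrict X) := fun f hf hf1 => by
    refine Integrable.of_bound (hF.mul hf).aestronglyMeasurable B ?_
    filter_upwards [ae_restrict_mem hX.measurableSet] with x hx
    rw [Real.norm_eq_abs, abs_mul]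
    calc |F x| * |f x| ≤ B * 1 := mul_le_mul (hFB x hx) (hf1 x) (abs_nonneg _) hB
      _ = B := mul_one B
  have hS01 : ∀ x, 0 ≤ S x ∧ S x ≤ 1 := fun x => ⟨halfSigmoid_nonneg _ _,
    (halfSigmoid_le _ _).trans (Real.exp_le_one_iff.2
    (div_nonpos_of_nonpos_of_nonneg (neg_nonpos.2 (abs_nonneg _)) hε.le))⟩
  have hSm : Measurable S := by
    have : Continuous S := by simp only [hS]; fun_prop
    exact this.measurable
  have hi1 : Integrable (fun x => F x * (softmax y g ε i x * χj x - softmax y g ε j x * χi x))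
      (volume.restrict X) := by
    refine hbdd _ (((continuous_softmax i).measurable.mul hχjm).sub
      ((continuous_softmax j).measurable.mul hχim)) fun x => ?_
    have e1 := softmax_nonneg (y := y) (g := g) (ε := ε) i x
    have e2 := softmax_nonneg (y := y) (g := g) (ε := ε) j x
    have e3 := softmax_le_one (y := y) (g := g) (ε := ε) i x
    have e4 := softmax_le_one (y := y) (g := g) (ε := ε) j x
    have e5 := indicator_one_mem_Icc (cell y g i) x
    have e6 := indicator_one_mem_Icc (cell y g j) x
    rw [abs_le]
    constructor
    · nlinarith [mul_le_mul e4 e5.2 e5.1 zero_le_one, mul_nonneg e1 e6.1]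
    · nlinarith [mul_le_mul e3 e6.2 e6.1 zero_le_one, mul_nonneg e2 e5.1]
  have hi2 : Integrable (fun x => F x * (S x * (χj x - χi x))) (volume.restrict X) := by
    refine hbdd _ (hSm.mul (hχjm.sub hχim)) fun x => ?_
    have e5 := indicator_one_mem_Icc (cell y g i) x
    have e6 := indicator_one_mem_Icc (cell y g j) x
    rw [abs_mul, abs_of_nonneg (hS01 x).1]
    have : |χj x - χi x| ≤ 1 := by rw [abs_le]; constructor <;> linarith
    exact mul_le_one₀ (hS01 x).2 (abs_nonneg _) this
  have hpt : ∀ x ∈ X, |F x * (softmax y g ε i x * χj x - softmax y g ε j x * χi x)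
      - F x * (S x * (χj x - χi x))| ≤ B * (E₁ x + E₂ x) := by
    intro x hx
    have e1 : |(softmax y g ε i x - S x) * χj x| ≤ E₁ x := by
      by_cases hxj : x ∈ cell y g j
      · simp only [hχj, Set.indicator_of_mem hxj, Pi.one_apply, mul_one]
        exact abs_softmax_sub_halfSigmoid_le hij hxj
      · simp only [hχj, Set.indicator_of_notMem hxj, mul_zero, abs_zero]
        exact hE₁0 x
    have e2 : |(softmax y g ε j x - S x) * χi x| ≤ E₂ x := by
      by_cases hxi : x ∈ cell y g i
      · simp only [hχi, Set.indicator_of_mem hxi, Pi.one_apply, mul_one]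
        rw [hSsymm]
        exact abs_softmax_sub_halfSigmoid_le hij.symm hxi
      · simp only [hχi, Set.indicator_of_notMem hxi, mul_zero, abs_zero]
        exact hE₂0 x
    have e3 : F x * (softmax y g ε i x * χj x - softmax y g ε j x * χi x)
        - F x * (S x * (χj x - χi x))
        = F x * ((softmax y g ε i x - S x) * χj x - (softmax y g ε j x - S x) * χi x) := by ring
    rw [e3, abs_mul]
    refine mul_le_mul (hFB x hx) ((abs_sub _ _).trans (add_le_add e1 e2)) (abs_nonneg _) hB
  have hdiff : |(∫ x in X, F x * (softmax y g ε i x * χj x - softmax y g ε j x * χi x))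
      - ∫ x in X, F x * (S x * (χj x - χi x))| ≤ B * ((n₁ * C₂ + n₂ * C₃) * ε ^ 2) := by
    rw [← integral_sub hi1 hi2]
    have hle : ∀ᵐ x ∂(volume.restrict X),
        ‖F x * (softmax y g ε i x * χj x - softmax y g ε j x * χi x)
          - F x * (S x * (χj x - χi x))‖ ≤ B * (E₁ x + E₂ x) := by
      filter_upwards [ae_restrict_mem hX.measurableSet] with x hx using hpt x hx
    refine (norm_integral_le_of_norm_le ((hE₁i.add hE₂i).const_mul B) hle).trans ?_
    calc ∫ x in X, B * (E₁ x + E₂ x)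
      _ = B * ((∫ x in X, E₁ x) + ∫ x in X, E₂ x) := by
          rw [integral_const_mul, integral_add hE₁i hE₂i]
      _ ≤ B * (n₁ * C₂ * ε ^ 2 + n₂ * C₃ * ε ^ 2) := by gcongr
      _ = _ := by ring
  have hmain := h₁ g hg ε hε hε1 α hα0 hα1 F hF B K hB hK hFB hFK
  have htriangle := abs_add_le ((∫ x in X, F x * (softmax y g ε i x * χj x -
    softmax y g ε j x * χi x)) - ∫ x in X, F x * (S x * (χj x - χi x)))
    (∫ x in X, F x * (S x * (χj x - χi x)))
  rw [sub_add_cancel] at htriangle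
  refine htriangle.trans ((add_le_add hdiff hmain).trans ?_)
  have e1 : B * ((n₁ * C₂ + n₂ * C₃) * ε ^ 2)
      ≤ (n₁ * C₂ + n₂ * C₃) * (B * (ε ^ 2 * Real.log (1 / ε) ^ 2)) := by
    have : ε ^ 2 * 1 ≤ ε ^ 2 * Real.log (1 / ε) ^ 2 := by
      gcongr
      exact one_le_pow₀ hℓ1
    calc _ = (n₁ * C₂ + n₂ * C₃) * (B * (ε ^ 2 * 1)) := by ring
      _ ≤ _ := by gcongr
  have e2 : 0 ≤ (n₁ * C₂ + n₂ * C₃) * (K * ε ^ (1 + α)) := by positivity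
  linarith

/-- Replacing softmax by the indicator of the cell changes integrals of Hölder functions by an
amount of order `ε ^ 2 * log ^ 2 + ε ^ (1 + α)` only. -/
lemma exists_abs_integral_softmax_sub_indicator_le {d : ℕ} {ι : Type*} [Fintype ι]
    {X : Set (Rd d)} (hX : IsCompact X) (hXc : Convex ℝ X) (hXi : (interior X).Nonempty)
    {y : ι → Rd d} (hy : Function.Injective y) {c : ℝ} (hc : 0 < c) :
    ∃ C : ℝ, 0 < C ∧ ∀ g : ι → ℝ, (∀ l, c ≤ (volume.restrict X).real (cell y g l)) →
      ∀ ε : ℝ, 0 < ε → ε ≤ Real.exp (-1) → ∀ α : ℝ, 0 < α → α ≤ 1 →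
      ∀ F : Rd d → ℝ, Measurable F → ∀ B K : ℝ, 0 ≤ B → 0 ≤ K → (∀ x ∈ X, |F x| ≤ B) →
        (∀ x ∈ X, ∀ x' ∈ X, |F x - F x'| ≤ K * ‖x - x'‖ ^ α) → ∀ i,
      |∫ x in X, F x * (softmax y g ε i x - (cell y g i).indicator 1 x)|
        ≤ C * (B * (ε ^ 2 * Real.log (1 / ε) ^ 2) + K * ε ^ (1 + α)) := by
  classical
  have hfin : IsFiniteMeasure (volume.restrict X) :=
    ⟨by simpa using hX.isBounded.measure_lt_top⟩
  obtain ⟨C, hC, h⟩ := exists_pos_forall_of_mono (ι := {p : ι × ι // p.1 ≠ p.2})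
    (p := fun p C => ∀ g : ι → ℝ, (∀ l, c ≤ (volume.restrict X).real (cell y g l)) →
      ∀ ε : ℝ, 0 < ε → ε ≤ Real.exp (-1) → ∀ α : ℝ, 0 < α → α ≤ 1 →
      ∀ F : Rd d → ℝ, Measurable F → ∀ B K : ℝ, 0 ≤ B → 0 ≤ K → (∀ x ∈ X, |F x| ≤ B) →
        (∀ x ∈ X, ∀ x' ∈ X, |F x - F x'| ≤ K * ‖x - x'‖ ^ α) →
      |∫ x in X, F x * (softmax y g ε p.1.1 x * (cell y g p.1.2).indicator 1 x -
          softmax y g ε p.1.2 x * (cell y g p.1.1).indicator 1 x)|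
        ≤ C * (B * (ε ^ 2 * Real.log (1 / ε) ^ 2) + K * ε ^ (1 + α)))
    (fun p C C' hCC' h g hg ε hε hε1 α hα0 hα1 F hF B K hB hK hFB hFK =>
      (h g hg ε hε hε1 α hα0 hα1 F hF B K hB hK hFB hFK).trans (by gcongr))
    fun p => (exists_abs_integral_softmax_exchange_le hX hXc hXi hy p.2 hc).imp fun C h => h.2
  refine ⟨Fintype.card ι * C + 1, by positivity,
    fun g hg ε hε hε1 α hα0 hα1 F hF B K hB hK hFB hFK i => ?_⟩
  have : Nonempty ι := ⟨i⟩
  set G : ι → Rd d → ℝ := fun j x => F x * (softmax y g ε i x * (cell y g j).indicator 1 x -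
      softmax y g ε j x * (cell y g i).indicator 1 x) with hG
  have hGi : ∀ j, Integrable (G j) (volume.restrict X) := fun j => by
    have hm : Measurable (G j) := hF.mul (((continuous_softmax i).measurable.mul
      (measurable_one.indicator (measurableSet_cell j))).sub ((continuous_softmax j).measurable.mul
      (measurable_one.indicator (measurableSet_cell i))))
    refine Integrable.of_bound hm.aestronglyMeasurable (B * 1) ?_
    filter_upwards [ae_restrict_mem hX.measurableSet] with x hx
    have e1 := softmax_nonneg (y := y) (g := g) (ε := ε) i x
    have e2 := softmax_nonneg (y := y) (g := g) (ε := ε) j x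
    have e3 := softmax_le_one (y := y) (g := g) (ε := ε) i x
    have e4 := softmax_le_one (y := y) (g := g) (ε := ε) j x
    have e5 := indicator_one_mem_Icc (cell y g i) x
    have e6 := indicator_one_mem_Icc (cell y g j) x
    rw [Real.norm_eq_abs, abs_mul]
    refine mul_le_mul (hFB x hx) ?_ (abs_nonneg _) hB
    rw [abs_le]
    constructor
    · nlinarith [mul_le_mul e4 e5.2 e5.1 zero_le_one, mul_nonneg e1 e6.1]
    · nlinarith [mul_le_mul e3 e6.2 e6.1 zero_le_one, mul_nonneg e2 e5.1]
  have hsum : ∫ x in X, F x * (softmax y g ε i x - (cell y g i).indicator 1 x)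
      = ∑ j, ∫ x in X, G j x := by
    rw [← integral_finsetSum _ fun j _ => hGi j]
    refine integral_congr_ae ?_
    filter_upwards [ae_sum_indicator_cell hX hy g] with x hx
    have e1 := sum_softmax (y := y) (g := g) (ε := ε) x
    simp only [hG]
    rw [← Finset.mul_sum, Finset.sum_sub_distrib, ← Finset.mul_sum, ← Finset.sum_mul, hx, e1]
    ring
  rw [hsum]
  have hr : 0 ≤ B * (ε ^ 2 * Real.log (1 / ε) ^ 2) + K * ε ^ (1 + α) := by positivity
  calc |∑ j, ∫ x in X, G j x| ≤ ∑ j, |∫ x in X, G j x| := Finset.abs_sum_le_sum_abs _ _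
    _ ≤ ∑ j : ι, C * (B * (ε ^ 2 * Real.log (1 / ε) ^ 2) + K * ε ^ (1 + α)) := by
        refine Finset.sum_le_sum fun j _ => ?_
        obtain rfl | hij := eq_or_ne i j
        · simp only [hG, sub_self, mul_zero, integral_zero, abs_zero]
          positivity
        · exact h ⟨(i, j), hij⟩ g hg ε hε hε1 α hα0 hα1 F hF B K hB hK hFB hFK
    _ = Fintype.card ι * C * (B * (ε ^ 2 * Real.log (1 / ε) ^ 2) + K * ε ^ (1 + α)) := by
        rw [Finset.sum_const, Finset.card_univ, nsmul_eq_mul]; ring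
    _ ≤ _ := by gcongr; linarith

/-! ### Stability of Laguerre cells under changes of their masses -/

/-- Among finitely many real numbers there is a gap of length at least the `card`-th part of their
spread: of the `card` half-open intervals that divide the spread, one contains none of the numbers,
since the smallest number lies in none of them. -/
lemma exists_gap {ι : Type*} [Fintype ι] (η : ι → ℝ) {i₀ i₁ : ι} (h : η i₀ < η i₁) :
    ∃ s, η i₀ ≤ s ∧ s + (η i₁ - η i₀) / Fintype.card ι ≤ η i₁ ∧
      ∀ i, η i ≤ s ∨ s + (η i₁ - η i₀) / Fintype.card ι ≤ η i := by
  classical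
  set N := Fintype.card ι with hN
  have hN0 : 0 < N := Fintype.card_pos_iff.2 ⟨i₀⟩
  have hN0' : (0 : ℝ) < N := by exact_mod_cast hN0
  set δ : ℝ := (η i₁ - η i₀) / N with hδ
  have hδ0 : 0 < δ := div_pos (by linarith) hN0'
  have hNδ : N * δ = η i₁ - η i₀ := by rw [hδ]; field_simp
  set m : ι → ℤ := fun i => ⌈(η i - η i₀) / δ⌉ with hm
  have hcard : ((Finset.univ.erase i₀).image m).card < (Finset.Icc (1 : ℤ) N).card := by
    refine Finset.card_image_le.trans_lt ?_
    rw [Finset.card_erase_of_mem (Finset.mem_univ _), Finset.card_univ, Int.card_Icc]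
    omega
  obtain ⟨t, ht, htm⟩ := Finset.exists_mem_notMem_of_card_lt_card hcard
  rw [Finset.mem_Icc] at ht
  have hmt : ∀ i, m i ≠ t := by
    intro i hi
    by_cases hi0 : i = i₀
    · subst hi0
      have : m i = 0 := by simp [hm]
      omega
    · exact htm (Finset.mem_image.2 ⟨i, Finset.mem_erase.2 ⟨hi0, Finset.mem_univ i⟩, hi⟩)
  have ht1 : (1 : ℝ) ≤ t := by exact_mod_cast ht.1
  have htN : (t : ℝ) ≤ N := by exact_mod_cast ht.2
  refine ⟨η i₀ + (t - 1) * δ, by nlinarith, by nlinarith, fun i => ?_⟩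
  by_contra! hcon
  apply hmt i
  rw [hm, Int.ceil_eq_iff, lt_div_iff₀ hδ0, div_le_iff₀ hδ0]
  constructor <;> nlinarith [hcon.1, hcon.2]

lemma lipschitzWith_sup'_score {d : ℕ} {ι : Type*} {y : ι → Rd d} (g : ι → ℝ)
    {S : Finset ι} (hS : S.Nonempty) {K : ℝ≥0} (hK : ∀ i, ‖y i‖ ≤ K) :
    LipschitzWith K fun x => S.sup' hS fun i => score y g i x := by
  refine LipschitzWith.of_le_add_mul K fun x x' => Finset.sup'_le hS _ fun i hi => ?_
  have h1 := Finset.le_sup' (fun i => score y g i x') hi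
  have h2 : score y g i x - score y g i x' ≤ K * dist x x' := by
    have : score y g i x - score y g i x' = inner ℝ (x - x') (y i) := by
      simp only [score, inner_sub_left]; ring
    rw [this, dist_eq_norm, mul_comm]
    exact (real_inner_le_norm _ _).trans (by gcongr; exact hK i)
  linarith

section Stability

variable {d : ℕ} {ι : Type*} [Fintype ι] {X : Set (Rd d)} {P : Measure (Rd d)}

lemma ae_of_measureReal_le [IsFiniteMeasure P] {M : ℝ} (hX : IsCompact X)
    (hup : ∀ s, P.real s ≤ M * (volume.restrict X).real s) {p : Rd d → Prop}
    (h : ∀ᵐ x ∂(volume.restrict X), p x) : ∀ᵐ x ∂P, p x := by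
  have hfin : IsFiniteMeasure (volume.restrict X) :=
    ⟨by simpa using hX.isBounded.measure_lt_top⟩
  have h0 : (volume.restrict X).real {x | ¬ p x} = 0 := by
    rw [measureReal_def, show (volume.restrict X) {x | ¬ p x} = 0 from h]; rfl
  have h1 := hup {x | ¬ p x}
  rw [h0, mul_zero] at h1
  exact (measureReal_eq_zero_iff (by finiteness)).1 (le_antisymm h1 measureReal_nonneg)

/-- If the offsets of the indices in `S` change by at most `s` and all others by at least `s + γ`,
the points at which the best score outside `S` exceeds the best score in `S` by at most `γ` change
over to cells of `S`. -/
lemma measureReal_layer_le_sum [IsProbabilityMeasure P] {M : ℝ} (hX : IsCompact X)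
    (hup : ∀ s, P.real s ≤ M * (volume.restrict X).real s)
    {y : ι → Rd d} (hy : Function.Injective y) (g g' : ι → ℝ) {s γ : ℝ} (hγ : 0 ≤ γ)
    {S T : Finset ι} (hS : S.Nonempty) (hT : T.Nonempty) (hST : ∀ i, i ∈ T ↔ i ∉ S)
    (hgS : ∀ i ∈ S, g' i - g i ≤ s) (hgT : ∀ i ∈ T, s + γ ≤ g' i - g i) :
    P.real {x | 0 < (T.sup' hT fun i => score y g i x) - (S.sup' hS fun i => score y g i x) ∧
      (T.sup' hT fun i => score y g i x) - (S.sup' hS fun i => score y g i x) ≤ γ} ≤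
      ∑ i, |P.real (cell y g i) - P.real (cell y g' i)| := by
  have : Nonempty ι := ⟨hS.choose⟩
  set u : Rd d → ℝ := fun x =>
    (T.sup' hT fun i => score y g i x) - (S.sup' hS fun i => score y g i x) with hu
  have hum : Measurable u := by
    obtain ⟨K, -, hK⟩ := exists_pos_forall_of_mono (p := fun i K => ‖y i‖ ≤ K)
      (fun i C C' h h' => h'.trans h) fun i => ⟨_, le_rfl⟩
    exact ((lipschitzWith_sup'_score g hT (K := K.toNNReal)
      fun i => (hK i).trans (Real.le_coe_toNNReal K)).continuous.sub
      (lipschitzWith_sup'_score g hS (K := K.toNNReal)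
      fun i => (hK i).trans (Real.le_coe_toNNReal K)).continuous).measurable
  set Lay : Set (Rd d) := {x | 0 < u x ∧ u x ≤ γ} with hLay
  have hLm : MeasurableSet Lay := (measurableSet_lt measurable_const hum).inter
    (measurableSet_le hum measurable_const)
  have hcelli : ∀ (g : ι → ℝ) (i : ι), Integrable ((cell y g i).indicator (1 : Rd d → ℝ)) P :=
    fun g i => (integrable_const (1 : ℝ)).indicator (measurableSet_cell i)
  have hdiffi : ∀ i, Integrable (fun x => (cell y g' i).indicator (1 : Rd d → ℝ) x
      - (cell y g i).indicator (1 : Rd d → ℝ) x) P := fun i => (hcelli g' i).sub (hcelli g i)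
  have hle_of_cell : ∀ x, ∀ i ∈ S, x ∈ cell y g i → u x ≤ 0 := by
    intro x i hi hx
    have h1 : T.sup' hT (fun i => score y g i x) ≤ score y g i x :=
      Finset.sup'_le hT _ fun j _ => hx j
    have h2 := Finset.le_sup' (fun i => score y g i x) hi
    simp only [hu]; linarith
  have hcell_of_le : ∀ x, u x ≤ γ → ∃ k ∈ S, x ∈ cell y g' k := by
    intro x hx
    obtain ⟨k, hk, hkmax⟩ := S.exists_max_image (fun i => score y g' i x) hS
    obtain ⟨i, hi, himax⟩ := S.exists_mem_eq_sup' hS fun i => score y g i x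
    refine ⟨k, hk, fun j => ?_⟩
    by_cases hj : j ∈ S
    · exact hkmax j hj
    · have hjT : j ∈ T := (hST j).2 hj
      have h1 := Finset.le_sup' (fun i => score y g i x) hjT
      have h2 := hgT j hjT
      have h3 := hgS i hi
      have h4 := hkmax i hi
      simp only [hu] at hx
      rw [himax] at hx
      simp only [score] at h1 h4 hx ⊢
      linarith
  have hpt : ∀ᵐ x ∂P, Lay.indicator (1 : Rd d → ℝ) x ≤
      ∑ i ∈ S, ((cell y g' i).indicator (1 : Rd d → ℝ) x
        - (cell y g i).indicator (1 : Rd d → ℝ) x) := by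
    filter_upwards [ae_of_measureReal_le hX hup (ae_sum_indicator_cell hX hy g)] with x hx
    rw [Finset.sum_sub_distrib]
    have h0 : ∀ (g : ι → ℝ), ∀ i ∈ S, 0 ≤ (cell y g i).indicator (1 : Rd d → ℝ) x :=
      fun g i _ => (indicator_one_mem_Icc _ x).1
    have hS1 : ∑ i ∈ S, (cell y g i).indicator (1 : Rd d → ℝ) x ≤ 1 := by
      rw [← hx]
      exact Finset.sum_le_sum_of_subset_of_nonneg (Finset.subset_univ S)
        fun i _ _ => (indicator_one_mem_Icc _ x).1
    have hS1' : u x ≤ γ → 1 ≤ ∑ i ∈ S, (cell y g' i).indicator (1 : Rd d → ℝ) x := by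
      intro hux
      obtain ⟨k, hk, hxk⟩ := hcell_of_le x hux
      refine le_trans (le_of_eq ?_) (Finset.single_le_sum (h0 g') hk)
      rw [Set.indicator_of_mem hxk, Pi.one_apply]
    have hS0 : 0 < u x → ∑ i ∈ S, (cell y g i).indicator (1 : Rd d → ℝ) x = 0 := fun hux =>
      Finset.sum_eq_zero fun i hi => Set.indicator_of_notMem
        (fun hxi => (hle_of_cell x i hi hxi).not_gt hux) _
    by_cases hxL : x ∈ Lay
    · rw [Set.indicator_of_mem hxL, Pi.one_apply, hS0 hxL.1]
      linarith [hS1' hxL.2]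
    · rw [Set.indicator_of_notMem hxL]
      obtain hux | hux := le_or_gt (u x) γ
      · linarith [hS1' hux]
      · rw [hS0 (hγ.trans_lt hux)]
        linarith [Finset.sum_nonneg (h0 g')]
  calc P.real Lay = ∫ x, Lay.indicator (1 : Rd d → ℝ) x ∂P := (integral_indicator_one hLm).symm
    _ ≤ ∫ x, ∑ i ∈ S, ((cell y g' i).indicator (1 : Rd d → ℝ) x
        - (cell y g i).indicator (1 : Rd d → ℝ) x) ∂P :=
        integral_mono_ae ((integrable_const (1 : ℝ)).indicator hLm)
          (integrable_finsetSum _ fun i _ => hdiffi i) hpt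
    _ = ∑ i ∈ S, (P.real (cell y g' i) - P.real (cell y g i)) := by
        rw [integral_finsetSum _ fun i _ => hdiffi i]
        refine Finset.sum_congr rfl fun i _ => ?_
        rw [integral_sub (hcelli g' i) (hcelli g i),
          integral_indicator_one (measurableSet_cell i),
          integral_indicator_one (measurableSet_cell i)]
    _ ≤ ∑ i ∈ S, |P.real (cell y g i) - P.real (cell y g' i)| := by
        refine Finset.sum_le_sum fun i _ => ?_
        rw [abs_sub_comm]; exact le_abs_self _
    _ ≤ _ := Finset.sum_le_sum_of_subset_of_nonneg (Finset.subset_univ S)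
        fun i _ _ => abs_nonneg _

/-- Lipschitz dependence of the offsets, up to a common constant, on the masses of the cells. -/
lemma exists_offset_sub_le [IsProbabilityMeasure P] {m M : ℝ} (hm : 0 < m) (hM : 0 < M)
    (hX : IsCompact X) (hXc : Convex ℝ X)
    (hlow : ∀ s, m * (volume.restrict X).real s ≤ P.real s)
    (hup : ∀ s, P.real s ≤ M * (volume.restrict X).real s)
    {y : ι → Rd d} (hy : Function.Injective y) {c : ℝ} (hc : 0 < c) :
    ∃ C c₂ : ℝ, 0 < C ∧ 0 < c₂ ∧ ∀ g g' : ι → ℝ, (∀ l, c ≤ P.real (cell y g l)) →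
      c₂ ≤ ∑ l, |P.real (cell y g l) - P.real (cell y g' l)| ∨
      ∀ i j, (g' i - g i) - (g' j - g j) ≤
        C * ∑ l, |P.real (cell y g l) - P.real (cell y g' l)| := by
  classical
  have hfin : IsFiniteMeasure (volume.restrict X) :=
    ⟨by simpa using hX.isBounded.measure_lt_top⟩
  obtain ⟨K, hK0, hK⟩ := exists_pos_forall_of_mono (p := fun i K => ‖y i‖ ≤ K)
    (fun i C C' h h' => h'.trans h) fun i => ⟨_, le_rfl⟩
  have hK' : ∀ i, ‖y i‖ ≤ K.toNNReal := fun i => (hK i).trans (Real.le_coe_toNNReal K)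
  obtain ⟨c₁, hc₁, hlayer⟩ := exists_le_measureReal_layer hX hXc (K.toNNReal + K.toNNReal)
    (c := c / (2 * M)) (by positivity)
  refine ⟨Fintype.card ι / (m * c₁) + 1, m * (c / (2 * M)), by positivity, by positivity,
    fun g g' hg => ?_⟩
  set D := ∑ l, |P.real (cell y g l) - P.real (cell y g' l)| with hD
  have hD0 : 0 ≤ D := Finset.sum_nonneg fun _ _ => abs_nonneg _
  by_cases hDc : m * (c / (2 * M)) ≤ D
  · exact Or.inl hDc
  right
  push Not at hDc
  intro i₁ i₀
  obtain hη | hη := le_or_gt (g' i₁ - g i₁) (g' i₀ - g i₀)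
  · have : 0 ≤ (Fintype.card ι / (m * c₁) + 1) * D := by positivity
    linarith
  obtain ⟨s, hs0, hs1, hs⟩ := exists_gap (fun i => g' i - g i) hη
  have : Nonempty ι := ⟨i₀⟩
  have hN : (0 : ℝ) < Fintype.card ι := by exact_mod_cast Fintype.card_pos
  set γ : ℝ := ((g' i₁ - g i₁) - (g' i₀ - g i₀)) / Fintype.card ι with hγ
  have hγ0 : 0 < γ := div_pos (by linarith) hN
  set S : Finset ι := Finset.univ.filter fun i => g' i - g i ≤ s with hSdef
  set T : Finset ι := Finset.univ.filter fun i => ¬ g' i - g i ≤ s with hTdef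
  have hS : S.Nonempty := ⟨i₀, by simpa [hSdef] using hs0⟩
  have hT : T.Nonempty := ⟨i₁, by
    simp only [hTdef, Finset.mem_filter, Finset.mem_univ, true_and, not_le]; linarith⟩
  have hST : ∀ i, i ∈ T ↔ i ∉ S := fun i => by simp [hSdef, hTdef]
  have hgS : ∀ i ∈ S, g' i - g i ≤ s := fun i hi => by simpa [hSdef] using hi
  have hgT : ∀ i ∈ T, s + γ ≤ g' i - g i := fun i hi =>
    (hs i).resolve_left (by simpa [hTdef] using hi)
  have hlay := measureReal_layer_le_sum hX hup hy g g' hγ0.le hS hT hST hgS hgT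
  rw [← hD] at hlay
  set u : Rd d → ℝ := fun x =>
    (T.sup' hT fun i => score y g i x) - (S.sup' hS fun i => score y g i x) with hu
  have hulip : LipschitzWith (K.toNNReal + K.toNNReal) u :=
    (lipschitzWith_sup'_score g hT hK').sub (lipschitzWith_sup'_score g hS hK')
  have hvol : ∀ l, c / M ≤ (volume.restrict X).real (cell y g l) := fun l => by
    rw [div_le_iff₀ hM, mul_comm]
    exact (hg l).trans (hup _)
  have hcM : c / (2 * M) = c / M / 2 := by field_simp
  have hcM0 : 0 < c / M := by positivity
  have hA : c / (2 * M) ≤ (volume.restrict X).real {x | u x ≤ 0} := by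
    have h1 : (volume.restrict X).real (cell y g i₀) ≤ (volume.restrict X).real {x | u x ≤ 0} := by
      refine measureReal_mono fun x hx => ?_
      have h1 : T.sup' hT (fun i => score y g i x) ≤ score y g i₀ x :=
        Finset.sup'_le hT _ fun j _ => hx j
      have h2 := Finset.le_sup' (fun i => score y g i x) (show i₀ ∈ S by simpa [hSdef] using hs0)
      simp only [hu, Set.mem_ofPred_eq]; linarith
    linarith [hvol i₀]
  have hpos : c / M ≤ (volume.restrict X).real {x | 0 < u x} := by
    refine (hvol i₁).trans (ENNReal.toReal_mono (by finiteness) (measure_mono_ae ?_))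
    filter_upwards [ae_sum_indicator_cell hX hy g] with x hx hxc
    change 0 < u x
    by_contra! hux
    -- otherwise a score in `S` is maximal as well
    obtain ⟨k, hk, hkmax⟩ := S.exists_mem_eq_sup' hS fun i => score y g i x
    have hi₁T : i₁ ∈ T := by
      simp only [hTdef, Finset.mem_filter, Finset.mem_univ, true_and, not_le]; linarith
    have h1 := Finset.le_sup' (fun i => score y g i x) hi₁T
    simp only [hu] at hux
    rw [hkmax] at hux
    have hxk : x ∈ cell y g k := fun j => by
      have h2 : score y g j x ≤ score y g i₁ x := hxc j
      linarith
    have hne : i₁ ≠ k := by rintro rfl; exact (hST i₁).1 hi₁T hk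
    have h2 : ∑ i ∈ {i₁, k}, (cell y g i).indicator (1 : Rd d → ℝ) x ≤ 1 := by
      rw [← hx]
      exact Finset.sum_le_sum_of_subset_of_nonneg (Finset.subset_univ _)
        fun i _ _ => (indicator_one_mem_Icc _ x).1
    have hxc' : x ∈ cell y g i₁ := hxc
    rw [Finset.sum_pair hne, Set.indicator_of_mem hxc', Set.indicator_of_mem hxk] at h2
    norm_num at h2
  have hsplit : (volume.restrict X).real {x | 0 < u x} ≤
      (volume.restrict X).real {x | 0 < u x ∧ u x ≤ γ} + (volume.restrict X).real {x | γ < u x} := by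
    refine le_trans (measureReal_mono fun x hx => ?_) (measureReal_union_le _ _)
    obtain h | h := le_or_gt (u x) γ
    · exact Or.inl ⟨hx, h⟩
    · exact Or.inr h
  have hlayvol := (hlow {x | 0 < u x ∧ u x ≤ γ}).trans hlay
  have hB : c / (2 * M) ≤ (volume.restrict X).real {x | γ < u x} := by
    have h1 : (volume.restrict X).real {x | 0 < u x ∧ u x ≤ γ} < c / (2 * M) :=
      lt_of_mul_lt_mul_left (hlayvol.trans_lt hDc) hm.le
    linarith
  have hfinal := hlayer u hulip γ hγ0.le hA hB
  have h1 : m * (c₁ * γ) ≤ D := (mul_le_mul_of_nonneg_left hfinal hm.le).trans hlayvol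
  have h2 : (g' i₁ - g i₁) - (g' i₀ - g i₀) = Fintype.card ι * γ := by rw [hγ]; field_simp
  rw [h2]
  calc Fintype.card ι * γ = Fintype.card ι / (m * c₁) * (m * (c₁ * γ)) := by field_simp
    _ ≤ Fintype.card ι / (m * c₁) * D := by gcongr
    _ ≤ _ := by gcongr; linarith

/-- A point that leaves the cell of `i` lies in a strip whose width is the change of the offsets. -/
lemma exists_measureReal_cell_sdiff_le_of_offset [IsProbabilityMeasure P] {M : ℝ} (hM : 0 < M)
    (hX : IsCompact X) (hup : ∀ s, P.real s ≤ M * (volume.restrict X).real s)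
    {y : ι → Rd d} (hy : Function.Injective y) :
    ∃ C : ℝ, 0 < C ∧ ∀ (g g' : ι → ℝ) (t : ℝ), 0 ≤ t →
      (∀ i j, (g' i - g i) - (g' j - g j) ≤ t) →
      ∀ i, P.real (cell y g i \ cell y g' i) ≤ C * t := by
  classical
  obtain ⟨C₂, hC₂, hstrip⟩ := exists_pos_forall_of_mono (ι := {p : ι × ι // p.1 ≠ p.2})
    (p := fun p C => ∀ b δ : ℝ, 0 ≤ δ →
      (volume.restrict X).real {x | |inner ℝ x (y p.1.1 - y p.1.2) - b| ≤ δ} ≤ C * δ)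
    (fun p C C' hCC' h b δ hδ => (h b δ hδ).trans (by gcongr))
    fun p => (exists_measureReal_strip_le hX (sub_ne_zero.2 (hy.ne p.2))).imp fun C h => h.2
  refine ⟨Fintype.card ι * (M * C₂) + 1, by positivity, fun g g' t ht h i => ?_⟩
  have hsub : cell y g i \ cell y g' i ⊆
      ⋃ j ∈ Finset.univ.erase i, {x | |inner ℝ x (y i - y j) - (g i - g j)| ≤ t} := by
    rintro x ⟨hx, hx'⟩
    simp only [mem_cell, not_forall, not_le] at hx'
    obtain ⟨j, hj⟩ := hx'
    have hji : j ≠ i := by rintro rfl; exact lt_irrefl _ hj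
    simp only [Set.mem_iUnion]
    refine ⟨j, Finset.mem_erase.2 ⟨hji, Finset.mem_univ _⟩, ?_⟩
    have h1 := hx j
    have h2 := h i j
    simp only [Set.mem_ofPred_eq]
    rw [← score_sub_score, abs_of_nonneg (by linarith)]
    simp only [score] at hj ⊢
    linarith
  calc P.real (cell y g i \ cell y g' i)
      ≤ P.real (⋃ j ∈ Finset.univ.erase i, {x | |inner ℝ x (y i - y j) - (g i - g j)| ≤ t}) :=
        measureReal_mono hsub (measure_ne_top P _)
    _ ≤ ∑ j ∈ Finset.univ.erase i, P.real {x | |inner ℝ x (y i - y j) - (g i - g j)| ≤ t} :=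
        measureReal_biUnion_finset_le _ _
    _ ≤ ∑ j ∈ Finset.univ.erase i, M * (C₂ * t) := by
        refine Finset.sum_le_sum fun j hj => (hup _).trans ?_
        gcongr
        exact hstrip ⟨(i, j), (Finset.ne_of_mem_erase hj).symm⟩ _ _ ht
    _ ≤ ∑ j : ι, M * (C₂ * t) :=
        Finset.sum_le_sum_of_subset_of_nonneg (Finset.subset_univ _) fun _ _ _ => by positivity
    _ = Fintype.card ι * (M * C₂) * t := by
        rw [Finset.sum_const, Finset.card_univ, nsmul_eq_mul]; ring
    _ ≤ _ := by gcongr; linarith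

/-- Lipschitz dependence of the cells on their masses. -/
lemma exists_measureReal_cell_sdiff_le [IsProbabilityMeasure P] {m M : ℝ} (hm : 0 < m)
    (hM : 0 < M) (hX : IsCompact X) (hXc : Convex ℝ X)
    (hlow : ∀ s, m * (volume.restrict X).real s ≤ P.real s)
    (hup : ∀ s, P.real s ≤ M * (volume.restrict X).real s)
    {y : ι → Rd d} (hy : Function.Injective y) {c : ℝ} (hc : 0 < c) :
    ∃ C : ℝ, 0 < C ∧ ∀ g g' : ι → ℝ, (∀ l, c ≤ P.real (cell y g l)) →
      ∀ i, P.real (cell y g i \ cell y g' i) ≤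
        C * ∑ l, |P.real (cell y g l) - P.real (cell y g' l)| := by
  obtain ⟨C₁, c₂, hC₁, hc₂, hoff⟩ := exists_offset_sub_le hm hM hX hXc hlow hup hy hc
  obtain ⟨C₂, hC₂, hstrip⟩ := exists_measureReal_cell_sdiff_le_of_offset hM hX hup hy
  refine ⟨1 / c₂ + C₂ * C₁, by positivity, fun g g' hg i => ?_⟩
  set D := ∑ l, |P.real (cell y g l) - P.real (cell y g' l)| with hD
  have hD0 : 0 ≤ D := Finset.sum_nonneg fun _ _ => abs_nonneg _
  have h1 : 0 ≤ 1 / c₂ * D := by positivity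
  have h2 : 0 ≤ C₂ * C₁ * D := by positivity
  rw [add_mul]
  obtain hDc | h := hoff g g' hg
  · have h3 : 1 ≤ 1 / c₂ * D := by
      rwa [div_mul_eq_mul_div, one_mul, le_div_iff₀ hc₂, one_mul]
    have h4 : P.real (cell y g i \ cell y g' i) ≤ 1 := measureReal_le_one
    linarith
  · have h3 := hstrip g g' (C₁ * D) (by positivity) h i
    linarith

end Stability

/-! ### Existence of dual potentials -/

/-- Minimisation of the dual functional `F g + ∑ qᵢ gᵢ`. The negative of `p` is a continuous
subgradient of `F`, the total weight of `p` makes the functional invariant under a common shift of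
the offsets, and the lower bound on `F` makes it coercive modulo shifts. -/
lemma exists_offset_of_subgradient {ι : Type*} [Fintype ι] [Nonempty ι] {q : ι → ℝ}
    (hq0 : ∀ i, 0 < q i) (hq1 : ∑ i, q i = 1) {F : (ι → ℝ) → ℝ} {p : ι → (ι → ℝ) → ℝ}
    (hp0 : ∀ i g, 0 ≤ p i g) (hp1 : ∀ g, ∑ i, p i g = 1)
    (hsub : ∀ g g', F g' + ∑ i, (g' i - g i) * p i g' ≤ F g) {B : ℝ}
    (hB : ∀ g i, -B - g i ≤ F g) (hcont : ∀ i, Continuous (p i)) :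
    ∃ g, ∀ i, p i g = q i := by
  classical
  set Φ : (ι → ℝ) → ℝ := fun g => F g + ∑ i, q i * g i with hΦ
  have hFlip : LipschitzWith 1 F := by
    refine LipschitzWith.of_le_add_mul 1 fun g' g => ?_
    have h1 := hsub g g'
    have h2 : ∑ i, (g i - g' i) * p i g' ≤ ∑ i, dist g' g * p i g' := by
      refine Finset.sum_le_sum fun i _ => mul_le_mul_of_nonneg_right ?_ (hp0 i g')
      have := dist_le_pi_dist g' g i
      rw [Real.dist_eq, abs_sub_comm] at this
      exact (le_abs_self _).trans this
    rw [← Finset.mul_sum, hp1, mul_one] at h2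
    have h3 : ∑ i, (g' i - g i) * p i g' = -∑ i, (g i - g' i) * p i g' := by
      rw [← Finset.sum_neg_distrib]; exact Finset.sum_congr rfl fun i _ => by ring
    rw [NNReal.coe_one, one_mul]
    linarith
  have hΦc : Continuous Φ := by
    have := hFlip.continuous
    simp only [hΦ]; fun_prop
  obtain ⟨i₀, hi₀⟩ := Finite.exists_min q
  set c := q i₀ with hc
  have hc0 : 0 < c := hq0 i₀
  have hshift : ∀ (g : ι → ℝ) (t : ℝ), Φ g = Φ fun i => g i - t := by
    intro g t
    have h1 := hsub g fun i => g i - t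
    have h2 := hsub (fun i => g i - t) g
    simp only [sub_sub_cancel_left, sub_sub_cancel, ← Finset.mul_sum, hp1] at h1 h2
    simp only [hΦ, mul_sub, Finset.sum_sub_distrib, ← Finset.sum_mul, hq1]
    linarith
  set R : ℝ := (|B| + |Φ 0|) / c with hR
  have hR0 : 0 ≤ R := by positivity
  obtain ⟨g, hgbox, hgmin⟩ := (isCompact_Icc (a := (0 : ι → ℝ)) (b := fun _ => R)).exists_isMinOn
    ⟨0, le_rfl, fun _ => hR0⟩ hΦc.continuousOn
  have hmin : ∀ g', Φ g ≤ Φ g' := by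
    intro g'
    obtain ⟨k₀, hk₀⟩ := Finite.exists_min g'
    rw [hshift g' (g' k₀)]
    set g'' : ι → ℝ := fun i => g' i - g' k₀ with hg''
    have h0 : ∀ i, 0 ≤ g'' i := fun i => by simp only [hg'']; linarith [hk₀ i]
    by_cases hbox : ∀ i, g'' i ≤ R
    · exact hgmin ⟨h0, hbox⟩
    · push Not at hbox
      obtain ⟨k, hk⟩ := hbox
      have h1 : Φ g ≤ Φ 0 := hgmin ⟨le_rfl, fun _ => hR0⟩
      have h2 := hB g'' k₀
      have h3 : g'' k₀ = 0 := by simp [hg'']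
      have h4 : q k * g'' k ≤ ∑ i, q i * g'' i :=
        Finset.single_le_sum (f := fun i => q i * g'' i)
          (fun i _ => mul_nonneg (hq0 i).le (h0 i)) (Finset.mem_univ k)
      have h5 : c * R ≤ q k * g'' k := mul_le_mul (hi₀ k) hk.le hR0 (hq0 k).le
      have h6 : c * R = |B| + |Φ 0| := by rw [hR]; field_simp
      have h7 : Φ g'' = F g'' + ∑ i, q i * g'' i := rfl
      linarith [le_abs_self B, le_abs_self (Φ 0)]
  have hle : ∀ i, q i ≤ p i g := by
    intro i
    have hpath : Continuous fun t : ℝ => Function.update g i (g i - t) :=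
      continuous_const.update i (by fun_prop)
    have hlim : Tendsto (fun t : ℝ => p i (Function.update g i (g i - t))) (𝓝[>] 0)
        (𝓝 (p i g)) := by
      have := ((hcont i).comp hpath).tendsto 0
      simp only [Function.comp, sub_zero, Function.update_eq_self] at this
      exact this.mono_left nhdsWithin_le_nhds
    refine ge_of_tendsto hlim ?_
    filter_upwards [self_mem_nhdsWithin] with t ht
    have ht0 : 0 < t := ht
    set g' := Function.update g i (g i - t) with hg'
    have h1 := hsub g g'
    have h2 := hmin g'
    have e1 : ∑ k, (g' k - g k) * p k g' = -t * p i g' := by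
      rw [Finset.sum_eq_single i]
      · simp [hg']
      · intro k _ hk; simp [hg', hk]
      · simp
    have e2 : ∑ k, q k * g' k = ∑ k, q k * g k - t * q i := by
      have : ∑ k, q k * (g' k - g k) = -t * q i := by
        rw [Finset.sum_eq_single i]
        · simp [hg']; ring
        · intro k _ hk; simp [hg', hk]
        · simp
      simp only [mul_sub, Finset.sum_sub_distrib] at this
      linarith
    simp only [hΦ] at h2
    rw [e1] at h1
    rw [e2] at h2
    have : t * q i ≤ t * p i g' := by linarith
    exact le_of_mul_le_mul_left this ht0
  refine ⟨g, fun i => ?_⟩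
  have := (Finset.sum_eq_sum_iff_of_le fun i _ => hle i).1 ((hq1.trans (hp1 g).symm))
  exact (this i (Finset.mem_univ i)).symm

lemma exists_neg_le_inner {d : ℕ} {ι : Type*} [Finite ι] {X : Set (Rd d)} (hX : IsCompact X) (y : ι → Rd d) :
    ∃ B : ℝ, ∀ x ∈ X, ∀ i, -B ≤ inner ℝ x (y i) := by
  obtain ⟨R, hR⟩ := hX.isBounded.exists_norm_le
  obtain ⟨K, hK0, hK⟩ := exists_pos_forall_of_mono (p := fun i K => ‖y i‖ ≤ K)
    (fun i C C' h h' => h'.trans h) fun i => ⟨_, le_rfl⟩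
  refine ⟨|R| * K, fun x hx i => ?_⟩
  have h1 := abs_real_inner_le_norm x (y i)
  have h2 : ‖x‖ * ‖y i‖ ≤ |R| * K :=
    mul_le_mul ((hR x hx).trans (le_abs_self R)) (hK i) (norm_nonneg _) (abs_nonneg _)
  linarith [neg_abs_le (inner ℝ x (y i))]

section Existence

variable {d : ℕ} {ι : Type*} [Fintype ι] [Nonempty ι] {X : Set (Rd d)} {P : Measure (Rd d)}

lemma integrable_of_continuous_of_ae_mem [IsFiniteMeasure P] (hX : IsCompact X)
    (hPX : ∀ᵐ x ∂P, x ∈ X) {E : Type*} [NormedAddCommGroup E] [SecondCountableTopology E]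
    {f : Rd d → E} (hf : Continuous f) : Integrable f P := by
  obtain ⟨C, hC⟩ := hX.exists_bound_of_continuousOn hf.continuousOn
  exact Integrable.of_bound hf.aestronglyMeasurable C (hPX.mono hC)

/-- Laguerre cells with prescribed positive masses. -/
lemma exists_measureReal_cell_eq [IsProbabilityMeasure P] {M : ℝ} (hM : 0 < M)
    (hX : IsCompact X) (hup : ∀ s, P.real s ≤ M * (volume.restrict X).real s)
    {y : ι → Rd d} (hy : Function.Injective y) {q : ι → ℝ}
    (hq0 : ∀ i, 0 < q i) (hq1 : ∑ i, q i = 1) :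
    ∃ g : ι → ℝ, ∀ i, P.real (cell y g i) = q i := by
  have hPX : ∀ᵐ x ∂P, x ∈ X := ae_of_measureReal_le hX hup (ae_restrict_mem hX.measurableSet)
  obtain ⟨B, hB⟩ := exists_neg_le_inner hX y
  obtain ⟨C, hC, hsdiff⟩ := exists_measureReal_cell_sdiff_le_of_offset hM hX hup hy
  obtain ⟨K, hK0, hK⟩ := exists_pos_forall_of_mono (p := fun i K => ‖y i‖ ≤ K)
    (fun i C C' h h' => h'.trans h) fun i => ⟨_, le_rfl⟩
  have hK' : ∀ i, ‖y i‖ ≤ K.toNNReal := fun i => (hK i).trans (Real.le_coe_toNNReal K)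
  set U : (ι → ℝ) → Rd d → ℝ := fun g x =>
    Finset.univ.sup' Finset.univ_nonempty fun i => score y g i x with hU
  have hUi : ∀ g, Integrable (U g) P := fun g =>
    integrable_of_continuous_of_ae_mem hX hPX (lipschitzWith_sup'_score g _ hK').continuous
  have hcelli : ∀ (g : ι → ℝ) (i : ι), Integrable ((cell y g i).indicator (1 : Rd d → ℝ)) P :=
    fun g i => (integrable_const (1 : ℝ)).indicator (measurableSet_cell i)
  have hone : ∀ g, ∀ᵐ x ∂P, ∑ i, (cell y g i).indicator (1 : Rd d → ℝ) x = 1 := fun g =>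
    ae_of_measureReal_le hX hup (ae_sum_indicator_cell hX hy g)
  refine exists_offset_of_subgradient hq0 hq1 (F := fun g => ∫ x, U g x ∂P)
    (p := fun i g => P.real (cell y g i)) (fun _ _ => measureReal_nonneg) (fun g => ?_)
    (fun g g' => ?_) (B := B) (fun g i => ?_) (fun i => ?_)
  · calc ∑ i, P.real (cell y g i) = ∑ i, ∫ x, (cell y g i).indicator (1 : Rd d → ℝ) x ∂P :=
          Finset.sum_congr rfl fun i _ => (integral_indicator_one (measurableSet_cell i)).symm
      _ = ∫ x, ∑ i, (cell y g i).indicator (1 : Rd d → ℝ) x ∂P :=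
          (integral_finsetSum _ fun i _ => hcelli g i).symm
      _ = ∫ x, 1 ∂P := integral_congr_ae (hone g)
      _ = 1 := by simp
  · have hi : ∀ i, Integrable (fun x => (g' i - g i) *
        (cell y g' i).indicator (1 : Rd d → ℝ) x) P := fun i => (hcelli g' i).const_mul _
    calc (∫ x, U g' x ∂P) + ∑ i, (g' i - g i) * P.real (cell y g' i)
        = ∫ x, (U g' x + ∑ i, (g' i - g i) * (cell y g' i).indicator (1 : Rd d → ℝ) x) ∂P := by
          rw [integral_add (hUi g') (integrable_finsetSum _ fun i _ => hi i),
            integral_finsetSum _ fun i _ => hi i]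
          congr 1
          refine Finset.sum_congr rfl fun i _ => ?_
          rw [integral_const_mul, integral_indicator_one (measurableSet_cell i)]
      _ ≤ ∫ x, U g x ∂P := by
          refine integral_mono_ae ((hUi g').add (integrable_finsetSum _ fun i _ => hi i)) (hUi g) ?_
          filter_upwards [hone g'] with x hx
          obtain ⟨k, hk⟩ := exists_mem_cell y g' x
          have h1 : U g' x ≤ score y g' k x := Finset.sup'_le _ _ fun j _ => hk j
          have h2 : score y g k x ≤ U g x :=
            Finset.le_sup' (fun i => score y g i x) (Finset.mem_univ k)
          have h3 : ∑ i, (g' i - g i) * (cell y g' i).indicator (1 : Rd d → ℝ) x = g' k - g k := by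
            classical
            rw [Finset.sum_eq_single k, Set.indicator_of_mem hk, Pi.one_apply, mul_one]
            · intro j _ hjk
              by_cases hj : x ∈ cell y g' j
              · have h4 : ∑ i ∈ {k, j}, (cell y g' i).indicator (1 : Rd d → ℝ) x ≤ 1 := by
                  rw [← hx]
                  exact Finset.sum_le_sum_of_subset_of_nonneg (Finset.subset_univ _)
                    fun i _ _ => (indicator_one_mem_Icc _ x).1
                rw [Finset.sum_pair hjk.symm, Set.indicator_of_mem hk,
                  Set.indicator_of_mem hj] at h4
                norm_num at h4
              · rw [Set.indicator_of_notMem hj, mul_zero]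
            · simp
          simp only [score] at h1 h2
          linarith
  · have h1 : ∫ _, (-B - g i) ∂P ≤ ∫ x, U g x ∂P := by
      refine integral_mono_ae (integrable_const _) (hUi g) ?_
      filter_upwards [hPX] with x hx
      refine le_trans ?_ (Finset.le_sup' (fun i => score y g i x) (Finset.mem_univ i))
      have := hB x hx i
      simp only [score]
      linarith
    simpa using h1
  · have hlip : LipschitzWith (C * 2).toNNReal fun g => P.real (cell y g i) := by
      refine LipschitzWith.of_le_add_mul _ fun g g' => ?_
      have h1 : P.real (cell y g i) ≤ P.real (cell y g' i) + P.real (cell y g i \ cell y g' i) := by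
        refine le_trans (measureReal_mono fun x hx => ?_) (measureReal_union_le _ _)
        by_cases h : x ∈ cell y g' i
        · exact Or.inl h
        · exact Or.inr ⟨hx, h⟩
      have h2 := hsdiff g g' (2 * dist g g') (by positivity) (fun i j => by
        have e1 := dist_le_pi_dist g g' i
        have e2 := dist_le_pi_dist g g' j
        rw [Real.dist_eq, abs_le] at e1 e2
        linarith) i
      rw [Real.coe_toNNReal _ (by positivity)]
      linarith
    exact hlip.continuous

/-- Softmax weights with prescribed positive masses. -/
lemma exists_integral_softmax_eq [IsProbabilityMeasure P] (hX : IsCompact X)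
    (hPX : ∀ᵐ x ∂P, x ∈ X) (y : ι → Rd d) {q : ι → ℝ}
    (hq0 : ∀ i, 0 < q i) (hq1 : ∑ i, q i = 1) {ε : ℝ} (hε : 0 < ε) :
    ∃ g : ι → ℝ, ∀ i, ∫ x, softmax y g ε i x ∂P = q i := by
  obtain ⟨B, hB⟩ := exists_neg_le_inner hX y
  set U : (ι → ℝ) → Rd d → ℝ := fun g x =>
    ε * Real.log (∑ i, Real.exp (score y g i x / ε)) with hU
  have hUc : ∀ g, Continuous (U g) := fun g => by
    refine continuous_const.mul (Continuous.log (by fun_prop) fun x => (softmax_denom_pos x).ne')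
  have hUi : ∀ g, Integrable (U g) P := fun g => integrable_of_continuous_of_ae_mem hX hPX (hUc g)
  have hsi : ∀ g i, Integrable (softmax y g ε i) P := fun g i =>
    integrable_of_continuous_of_ae_mem hX hPX (continuous_softmax i)
  refine exists_offset_of_subgradient hq0 hq1 (F := fun g => ∫ x, U g x ∂P)
    (p := fun i g => ∫ x, softmax y g ε i x ∂P)
    (fun i g => integral_nonneg fun x => softmax_nonneg i x) (fun g => ?_)
    (fun g g' => ?_) (B := B) (fun g i => ?_) (fun i => ?_)
  · rw [← integral_finsetSum _ fun i _ => hsi g i]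
    simp [sum_softmax]
  · have hi : ∀ i, Integrable (fun x => (g' i - g i) * softmax y g' ε i x) P :=
      fun i => (hsi g' i).const_mul _
    calc (∫ x, U g' x ∂P) + ∑ i, (g' i - g i) * ∫ x, softmax y g' ε i x ∂P
        = ∫ x, (U g' x + ∑ i, (g' i - g i) * softmax y g' ε i x) ∂P := by
          rw [integral_add (hUi g') (integrable_finsetSum _ fun i _ => hi i),
            integral_finsetSum _ fun i _ => hi i]
          simp only [integral_const_mul]
      _ ≤ ∫ x, U g x ∂P := by
          refine integral_mono ((hUi g').add (integrable_finsetSum _ fun i _ => hi i)) (hUi g)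
            fun x => ?_
          -- Jensen's inequality for the exponential and the weights `softmax y g' ε`
          have hJ := convexOn_exp.map_sum_le (t := Finset.univ) (w := fun i => softmax y g' ε i x)
            (p := fun i => (g' i - g i) / ε) (fun i _ => softmax_nonneg i x) (sum_softmax x)
            (fun i _ => Set.mem_univ _)
          have hZ := softmax_denom_pos (y := y) (g := g) (ε := ε) x
          have hZ' := softmax_denom_pos (y := y) (g := g') (ε := ε) x
          have e1 : ∑ i, softmax y g' ε i x • Real.exp ((g' i - g i) / ε)
              = (∑ i, Real.exp (score y g i x / ε)) / ∑ i, Real.exp (score y g' i x / ε) := by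
            rw [Finset.sum_div]
            refine Finset.sum_congr rfl fun i _ => ?_
            rw [softmax, smul_eq_mul, div_mul_eq_mul_div, ← Real.exp_add]
            congr 2
            simp only [score]; field_simp; ring
          rw [e1] at hJ
          have h2 := Real.log_le_log (Real.exp_pos _) hJ
          rw [Real.log_exp, Real.log_div hZ.ne' hZ'.ne'] at h2
          have e2 : ∑ i, softmax y g' ε i x • ((g' i - g i) / ε)
              = (∑ i, (g' i - g i) * softmax y g' ε i x) / ε := by
            rw [Finset.sum_div]
            exact Finset.sum_congr rfl fun i _ => by rw [smul_eq_mul]; ring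
          rw [e2, div_le_iff₀ hε] at h2
          simp only [hU]
          linarith
  · have h1 : ∫ _, (-B - g i) ∂P ≤ ∫ x, U g x ∂P := by
      refine integral_mono_ae (integrable_const _) (hUi g) ?_
      filter_upwards [hPX] with x hx
      have h2 : Real.exp (score y g i x / ε) ≤ ∑ i, Real.exp (score y g i x / ε) :=
        Finset.single_le_sum (f := fun i => Real.exp (score y g i x / ε))
          (fun _ _ => (Real.exp_pos _).le) (Finset.mem_univ i)
      have h3 := Real.log_le_log (Real.exp_pos _) h2
      rw [Real.log_exp, div_le_iff₀ hε] at h3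
      have := hB x hx i
      simp only [score, hU] at h3 ⊢
      linarith
    simpa using h1
  · refine continuous_of_dominated (bound := fun _ => 1)
      (fun g => (continuous_softmax i).aestronglyMeasurable) (fun g => ?_) (integrable_const _)
      (Eventually.of_forall fun x => ?_)
    · refine Eventually.of_forall fun x => ?_
      rw [Real.norm_of_nonneg (softmax_nonneg i x)]
      exact softmax_le_one i x
    · unfold softmax score
      refine Continuous.div (by fun_prop) (by fun_prop) fun g =>
        (softmax_denom_pos (y := y) (g := g) (ε := ε) x).ne'

end Existence

/-! ### Finitely supported targets -/

section Discrete

variable {d : ℕ} {ι : Type*} [Fintype ι] {P Q : Measure (Rd d)} {y : ι → Rd d}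

lemma restrict_eq_self_of_ae_mem_range [DecidableEq (Rd d)] (hQ : ∀ᵐ z ∂Q, ∃ i, z = y i) :
    Q.restrict (Finset.univ.image y : Finset (Rd d)) = Q :=
  Measure.restrict_eq_self_of_ae_mem <| by
    filter_upwards [hQ] with z hz
    obtain ⟨i, rfl⟩ := hz
    simp

lemma integral_eq_sum_of_ae_mem_range [IsFiniteMeasure Q] (hy : Function.Injective y)
    (hQ : ∀ᵐ z ∂Q, ∃ i, z = y i) {E : Type*} [NormedAddCommGroup E] [NormedSpace ℝ E]
    [CompleteSpace E] (f : Rd d → E) : ∫ z, f z ∂Q = ∑ i, Q.real {y i} • f (y i) := by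
  classical
  conv_lhs => rw [← restrict_eq_self_of_ae_mem_range hQ]
  rw [setIntegral_finset _ IntegrableOn.finset, Finset.sum_image fun i _ j _ h => hy h]

lemma integrable_of_ae_mem_range [IsFiniteMeasure Q]
    (hQ : ∀ᵐ z ∂Q, ∃ i, z = y i) {E : Type*} [NormedAddCommGroup E] (f : Rd d → E) :
    Integrable f Q := by
  classical
  rw [← restrict_eq_self_of_ae_mem_range hQ]
  exact IntegrableOn.finset

lemma sum_measureReal_eq_one [IsProbabilityMeasure Q] (hy : Function.Injective y)
    (hQ : ∀ᵐ z ∂Q, ∃ i, z = y i) : ∑ i, Q.real {y i} = 1 := by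
  have := integral_eq_sum_of_ae_mem_range hy hQ fun _ => (1 : ℝ)
  simpa using this.symm

/-- The function on the whole space that takes the value `f i` at `y i` and vanishes elsewhere. -/
noncomputable def extendZero (y : ι → Rd d) (f : ι → ℝ) (z : Rd d) : ℝ :=
  ∑ i, ({y i} : Set (Rd d)).indicator (fun _ => f i) z

lemma extendZero_apply (hy : Function.Injective y) (f : ι → ℝ) (i : ι) :
    extendZero y f (y i) = f i := by
  classical
  rw [extendZero, Finset.sum_eq_single i, Set.indicator_of_mem (Set.mem_singleton _)]
  · intro j _ hji
    exact Set.indicator_of_notMem (fun h : y i ∈ ({y j} : Set (Rd d)) => hji (hy h).symm) _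
  · simp

@[fun_prop]
lemma measurable_extendZero (f : ι → ℝ) : Measurable (extendZero y f) := by
  unfold extendZero
  exact Finset.measurable_fun_sum _ fun i _ =>
    measurable_const.indicator (measurableSet_singleton _)

end Discrete

/-! ### The Brenier map is the Laguerre map -/

section Brenier

variable {d : ℕ} {ι : Type*} [Fintype ι] {X : Set (Rd d)} {P Q : Measure (Rd d)}
  {y : ι → Rd d}

lemma isCoupling_map_prodMk {T : Rd d → Rd d} (hT : AEMeasurable T P) (h : P.map T = Q) :
    IsCoupling P Q (P.map fun x => (x, T x)) := by
  have hm : AEMeasurable (fun x => (x, T x)) P := aemeasurable_id.prodMk hT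
  constructor
  · rw [AEMeasurable.map_map_of_aemeasurable measurable_fst.aemeasurable hm]
    exact Measure.map_id
  · rw [AEMeasurable.map_map_of_aemeasurable measurable_snd.aemeasurable hm]
    exact h

lemma map_eq_of_isCoupling {T : Rd d → Rd d} (hT : AEMeasurable T P)
    (h : IsCoupling P Q (P.map fun x => (x, T x))) : P.map T = Q := by
  have hm : AEMeasurable (fun x => (x, T x)) P := aemeasurable_id.prodMk hT
  have := h.2
  rwa [AEMeasurable.map_map_of_aemeasurable measurable_snd.aemeasurable hm] at this

/-- The map sending each Laguerre cell to its site. -/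
noncomputable def laguerreMap (y : ι → Rd d) (g : ι → ℝ) (x : Rd d) : Rd d :=
  ∑ i, (cell y g i).indicator (1 : Rd d → ℝ) x • y i

lemma measurable_laguerreMap (g : ι → ℝ) : Measurable (laguerreMap y g) := by
  unfold laguerreMap
  exact Finset.measurable_fun_sum _ fun i _ =>
    (measurable_one.indicator (measurableSet_cell i)).smul_const _

lemma laguerreMap_eq {g : ι → ℝ} {x : Rd d}
    (hx : ∑ i, (cell y g i).indicator (1 : Rd d → ℝ) x = 1) {k : ι} (hk : x ∈ cell y g k) :
    laguerreMap y g x = y k := by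
  classical
  rw [laguerreMap, Finset.sum_eq_single k, Set.indicator_of_mem hk, Pi.one_apply, one_smul]
  · intro j _ hjk
    by_cases hj : x ∈ cell y g j
    · have h4 : ∑ i ∈ {k, j}, (cell y g i).indicator (1 : Rd d → ℝ) x ≤ 1 := by
        rw [← hx]
        exact Finset.sum_le_sum_of_subset_of_nonneg (Finset.subset_univ _)
          fun i _ _ => (indicator_one_mem_Icc _ x).1
      rw [Finset.sum_pair hjk.symm, Set.indicator_of_mem hk, Set.indicator_of_mem hj] at h4
      norm_num at h4
    · rw [Set.indicator_of_notMem hj, zero_smul]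
  · simp

lemma map_laguerreMap [Nonempty ι] [IsProbabilityMeasure P] [IsProbabilityMeasure Q]
    (hy : Function.Injective y) (hQ : ∀ᵐ z ∂Q, ∃ i, z = y i) {g : ι → ℝ}
    (hone : ∀ᵐ x ∂P, ∑ i, (cell y g i).indicator (1 : Rd d → ℝ) x = 1)
    (hg : ∀ i, P.real (cell y g i) = Q.real {y i}) : P.map (laguerreMap y g) = Q := by
  have hm := measurable_laguerreMap (y := y) g
  have : IsProbabilityMeasure (P.map (laguerreMap y g)) :=
    Measure.isProbabilityMeasure_map hm.aemeasurable
  ext s hs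
  rw [← ENNReal.toReal_eq_toReal_iff' (measure_ne_top _ _) (measure_ne_top _ _),
    ← measureReal_def, ← measureReal_def, ← integral_indicator_one hs, ← integral_indicator_one hs,
    integral_eq_sum_of_ae_mem_range hy hQ,
    integral_map hm.aemeasurable (measurable_one.indicator hs).aestronglyMeasurable]
  have h1 : ∀ᵐ x ∂P, s.indicator (1 : Rd d → ℝ) (laguerreMap y g x)
      = ∑ i, (cell y g i).indicator (1 : Rd d → ℝ) x * s.indicator (1 : Rd d → ℝ) (y i) := by
    filter_upwards [hone] with x hx
    obtain ⟨k, hk⟩ := exists_mem_cell y g x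
    classical
    rw [laguerreMap_eq hx hk, Finset.sum_eq_single k, Set.indicator_of_mem hk, Pi.one_apply,
      one_mul]
    · intro j _ hjk
      by_cases hj : x ∈ cell y g j
      · exact absurd (hy ((laguerreMap_eq hx hj).symm.trans (laguerreMap_eq hx hk))) hjk
      · rw [Set.indicator_of_notMem hj, zero_mul]
    · simp
  rw [integral_congr_ae h1, integral_finsetSum]
  · refine Finset.sum_congr rfl fun i _ => ?_
    rw [integral_mul_const, integral_indicator_one (measurableSet_cell i), hg, smul_eq_mul]
  · exact fun i _ => ((integrable_const (1 : ℝ)).indicator (measurableSet_cell i)).mul_const _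

/-- A Brenier map maximises the correlation, hence attains the dual bound given by the offsets of
the Laguerre cells, so that it sends almost every point to the site of its cell. -/
lemma ae_eq_laguerreMap_of_isBrenierMap [Nonempty ι] [IsProbabilityMeasure P]
    [IsProbabilityMeasure Q]
    (hX : IsCompact X) (hPX : ∀ᵐ x ∂P, x ∈ X) (hy : Function.Injective y)
    (hQ : ∀ᵐ z ∂Q, ∃ i, z = y i) {g : ι → ℝ}
    (hone : ∀ᵐ x ∂P, ∑ i, (cell y g i).indicator (1 : Rd d → ℝ) x = 1)
    (hg : ∀ i, P.real (cell y g i) = Q.real {y i}) {T₀ : Rd d → Rd d}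
    (hT₀ : IsBrenierMap P Q T₀) : T₀ =ᵐ[P] laguerreMap y g := by
  obtain ⟨hTm, hTc, hTopt⟩ := hT₀
  have hTQ : P.map T₀ = Q := map_eq_of_isCoupling hTm hTc
  have hLm := measurable_laguerreMap (y := y) g
  have hLQ := map_laguerreMap hy hQ hone hg
  have hopt := hTopt _ (isCoupling_map_prodMk hLm.aemeasurable hLQ)
  obtain ⟨R, hR⟩ := hX.isBounded.exists_norm_le
  obtain ⟨K, hK0, hK⟩ := exists_pos_forall_of_mono (p := fun i K => ‖y i‖ ≤ K)
    (fun i C C' h h' => h'.trans h) fun i => ⟨_, le_rfl⟩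
  set G := extendZero y g with hG
  -- facts common to both maps
  have common : ∀ T : Rd d → Rd d, AEMeasurable T P → P.map T = Q →
      (∀ᵐ x ∂P, ∃ i, T x = y i) ∧ Integrable (fun x => ‖x - T x‖ ^ 2) P ∧
      Integrable (fun x => inner ℝ x (T x)) P ∧ Integrable (fun x => G (T x)) P ∧
      ∫ x, G (T x) ∂P = ∫ z, G z ∂Q ∧
      ∫ x, ‖x - T x‖ ^ 2 ∂P
        = (∫ x, ‖x‖ ^ 2 ∂P) - 2 * (∫ x, inner ℝ x (T x) ∂P) + ∫ z, ‖z‖ ^ 2 ∂Q := by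
    intro T hT hTQ
    have hmem : ∀ᵐ x ∂P, ∃ i, T x = y i := ae_of_ae_map hT (hTQ ▸ hQ)
    have hi1 : Integrable (fun x => inner ℝ x (T x)) P := by
      refine Integrable.of_bound (aemeasurable_id.inner hT).aestronglyMeasurable (|R| * K) ?_
      filter_upwards [hPX, hmem] with x hx hTx
      obtain ⟨i, hi⟩ := hTx
      rw [hi]
      exact (abs_real_inner_le_norm _ _).trans
        (mul_le_mul ((hR x hx).trans (le_abs_self R)) (hK i) (norm_nonneg _) (abs_nonneg _))
    have hi2 : Integrable (fun x : Rd d => ‖x‖ ^ 2) P :=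
      integrable_of_continuous_of_ae_mem hX hPX (by fun_prop)
    have hiQ : ∀ f : Rd d → ℝ, Measurable f → Integrable (fun x => f (T x)) P := fun f hf => by
      have h1 : Integrable f (P.map T) := by rw [hTQ]; exact integrable_of_ae_mem_range hQ f
      exact h1.comp_aemeasurable hT
    have hQint : ∀ f : Rd d → ℝ, Measurable f → ∫ x, f (T x) ∂P = ∫ z, f z ∂Q := fun f hf => by
      rw [← hTQ, integral_map hT hf.aestronglyMeasurable]
    have hexp : ∀ x, ‖x - T x‖ ^ 2 = ‖x‖ ^ 2 - 2 * inner ℝ x (T x) + ‖T x‖ ^ 2 := fun x =>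
      norm_sub_sq_real _ _
    have hi3 := hiQ (fun z => ‖z‖ ^ 2) (by fun_prop)
    have hi4 : Integrable (fun x => ‖x‖ ^ 2 - 2 * inner ℝ x (T x)) P := hi2.sub (hi1.const_mul 2)
    refine ⟨hmem, ?_, hi1, hiQ G (measurable_extendZero g), hQint G (measurable_extendZero g), ?_⟩
    · simp only [hexp]
      exact hi4.add hi3
    · simp only [hexp]
      rw [integral_add hi4 hi3, integral_sub hi2 (hi1.const_mul 2), integral_const_mul,
        hQint (fun z => ‖z‖ ^ 2) (by fun_prop)]
  obtain ⟨hTmem, hTi, hTi1, hTi2, hTG, hTexp⟩ := common T₀ hTm hTQ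
  obtain ⟨-, hLi, hLi1, hLi2, hLG, hLexp⟩ := common _ hLm.aemeasurable hLQ
  have hcost : ∀ T : Rd d → Rd d, AEMeasurable T P → Integrable (fun x => ‖x - T x‖ ^ 2) P →
      quadraticCost (P.map fun x => (x, T x)) = ENNReal.ofReal (∫ x, ‖x - T x‖ ^ 2 ∂P) := by
    intro T hT hi
    have hm : AEMeasurable (fun x => (x, T x)) P := aemeasurable_id.prodMk hT
    rw [quadraticCost, lintegral_map' (by fun_prop) hm,
      ofReal_integral_eq_lintegral_ofReal hi (Eventually.of_forall fun x => by positivity)]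
  rw [hcost _ hTm hTi, hcost _ hLm.aemeasurable hLi,
    ENNReal.ofReal_le_ofReal_iff (integral_nonneg fun x => by positivity), hTexp, hLexp] at hopt
  have hcorr : ∫ x, inner ℝ x (laguerreMap y g x) ∂P ≤ ∫ x, inner ℝ x (T₀ x) ∂P := by linarith
  have hle : ∀ᵐ x ∂P, inner ℝ x (T₀ x) - G (T₀ x)
      ≤ inner ℝ x (laguerreMap y g x) - G (laguerreMap y g x) := by
    filter_upwards [hTmem, hone] with x hx hx1
    obtain ⟨i, hi⟩ := hx
    obtain ⟨k, hk⟩ := exists_mem_cell y g x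
    rw [hi, laguerreMap_eq hx1 hk, hG, extendZero_apply hy, extendZero_apply hy]
    exact hk i
  have heq := (integral_eq_iff_of_ae_le (hTi1.sub hTi2) (hLi1.sub hLi2) hle).1 <| by
    refine le_antisymm (integral_mono_ae (hTi1.sub hTi2) (hLi1.sub hLi2) hle) ?_
    simp only [Pi.sub_apply]
    rw [integral_sub hTi1 hTi2, integral_sub hLi1 hLi2, hTG, hLG]
    linarith
  filter_upwards [heq, hTmem, hone] with x hx hTx hx1
  obtain ⟨i, hi⟩ := hTx
  obtain ⟨k, hk⟩ := exists_mem_cell y g x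
  simp only [Pi.sub_apply] at hx
  rw [hi, laguerreMap_eq hx1 hk, hG, extendZero_apply hy, extendZero_apply hy] at hx
  have hxi : x ∈ cell y g i := fun j => (hk j).trans (le_of_eq hx.symm)
  rw [hi, laguerreMap_eq hx1 hxi]

end Brenier

/-! ### The entropic map is the softmax map -/

lemma ae_mem_of_isCoupling {d : ℕ} {ι : Type*} {X : Set (Rd d)} {P Q : Measure (Rd d)}
    {y : ι → Rd d}
    (hPX : ∀ᵐ x ∂P, x ∈ X) (hQ : ∀ᵐ z ∂Q, ∃ i, z = y i)
    {π : Measure (Rd d × Rd d)} (h : IsCoupling P Q π) :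
    ∀ᵐ p ∂π, p.1 ∈ X ∧ ∃ i, p.2 = y i := by
  filter_upwards [ae_of_ae_map measurable_fst.aemeasurable (h.1.symm ▸ hPX),
    ae_of_ae_map measurable_snd.aemeasurable (h.2.symm ▸ hQ)] with p h1 h2 using ⟨h1, h2⟩

lemma isProbabilityMeasure_of_isCoupling {d : ℕ} {P Q : Measure (Rd d)}
    [IsProbabilityMeasure P] {π : Measure (Rd d × Rd d)} (h : IsCoupling P Q π) :
    IsProbabilityMeasure π := by
  constructor
  have h1 : π.map Prod.fst Set.univ = 1 := by rw [h.1]; exact measure_univ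
  rwa [Measure.map_apply measurable_fst MeasurableSet.univ, Set.preimage_univ] at h1

lemma integrable_of_isCoupling {d : ℕ} {ι : Type*} {X : Set (Rd d)} {P Q : Measure (Rd d)}
    [IsProbabilityMeasure P] {y : ι → Rd d} (hPX : ∀ᵐ x ∂P, x ∈ X) (hQ : ∀ᵐ z ∂Q, ∃ i, z = y i)
    {π : Measure (Rd d × Rd d)} (h : IsCoupling P Q π) {E : Type*} [NormedAddCommGroup E]
    {f : Rd d × Rd d → E} (hf : AEStronglyMeasurable f π) {K : ℝ}
    (hK : ∀ x ∈ X, ∀ i, ‖f (x, y i)‖ ≤ K) : Integrable f π := by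
  have := isProbabilityMeasure_of_isCoupling h
  refine Integrable.of_bound hf K ?_
  filter_upwards [ae_mem_of_isCoupling hPX hQ h] with p hp
  obtain ⟨h1, i, h2⟩ := hp
  have : p = (p.1, y i) := by rw [← h2]
  rw [this]
  exact hK _ h1 i

section Entropic

variable {d : ℕ} {ι : Type*} [Fintype ι] {X : Set (Rd d)} {P Q : Measure (Rd d)} {y : ι → Rd d}

/-- The logarithm of the density of the entropic plan with respect to `P.prod Q`: at `(x, y i)` its
exponential is `softmax y g ε i x / Q {y i}`. -/
noncomputable def gibbsExponent (Q : Measure (Rd d)) (y : ι → Rd d) (g : ι → ℝ) (ε : ℝ)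
    (p : Rd d × Rd d) : ℝ :=
  (inner ℝ p.1 p.2 - extendZero y (fun i => g i + ε * Real.log (Q.real {y i})) p.2
    - ε * Real.log (∑ i, Real.exp (score y g i p.1 / ε))) / ε

@[fun_prop]
lemma measurable_gibbsExponent (g : ι → ℝ) (ε : ℝ) : Measurable (gibbsExponent Q y g ε) := by
  unfold gibbsExponent
  have h : Measurable fun x : Rd d => Real.log (∑ i, Real.exp (score y g i x / ε)) :=
    Real.measurable_log.comp (by fun_prop : Continuous fun x : Rd d =>
      ∑ i, Real.exp (score y g i x / ε)).measurable
  have h' : Measurable fun p : Rd d × Rd d =>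
      Real.log (∑ i, Real.exp (score y g i p.1 / ε)) := h.comp measurable_fst
  have h'' : Measurable fun p : Rd d × Rd d =>
      extendZero y (fun i => g i + ε * Real.log (Q.real {y i})) p.2 :=
    (measurable_extendZero _).comp measurable_snd
  exact (((by fun_prop : Continuous fun p : Rd d × Rd d =>
    (inner ℝ p.1 p.2 : ℝ)).measurable.sub h'').sub (h'.const_mul ε)).div_const ε

lemma mul_exp_gibbsExponent (hy : Function.Injective y) (g : ι → ℝ) {ε : ℝ} (hε : 0 < ε)
    (x : Rd d) {i : ι} (hq : 0 < Q.real {y i}) :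
    Q.real {y i} * Real.exp (gibbsExponent Q y g ε (x, y i)) = softmax y g ε i x := by
  have : Nonempty ι := ⟨i⟩
  have hZ := softmax_denom_pos (y := y) (g := g) (ε := ε) x
  have h1 : gibbsExponent Q y g ε (x, y i) = score y g i x / ε - Real.log (Q.real {y i})
      - Real.log (∑ i, Real.exp (score y g i x / ε)) := by
    simp only [gibbsExponent, extendZero_apply hy, score]
    field_simp
    ring
  rw [h1, Real.exp_sub, Real.exp_sub, Real.exp_log hq, Real.exp_log hZ, softmax]
  field_simp

lemma exists_abs_gibbsExponent_le [Nonempty ι] (hX : IsCompact X) (hy : Function.Injective y)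
    (g : ι → ℝ) (ε : ℝ) :
    ∃ K, ∀ x ∈ X, ∀ i, |gibbsExponent Q y g ε (x, y i)| ≤ K := by
  obtain ⟨K, -, hK⟩ := exists_pos_forall_of_mono
    (p := fun i K => ∀ x ∈ X, |gibbsExponent Q y g ε (x, y i)| ≤ K)
    (fun i C C' h h' x hx => (h' x hx).trans h) fun i => by
      have hc : Continuous fun x => gibbsExponent Q y g ε (x, y i) := by
        have h : Continuous fun x : Rd d => Real.log (∑ i, Real.exp (score y g i x / ε)) :=
          Continuous.log (by fun_prop) fun x => (softmax_denom_pos x).ne'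
        simp only [gibbsExponent, extendZero_apply hy]
        fun_prop
      exact hX.exists_bound_of_continuousOn hc.continuousOn
  exact ⟨K, fun x hx i => hK i x hx⟩

variable [IsProbabilityMeasure P] [IsProbabilityMeasure Q]

lemma isCoupling_prod : IsCoupling P Q (P.prod Q) :=
  ⟨by simp [Measure.map_fst_prod], by simp [Measure.map_snd_prod]⟩

/-- The entropic plan: the coupling with conditional weights `softmax y g ε`. -/
noncomputable def gibbsPlan (P Q : Measure (Rd d)) (y : ι → Rd d) (g : ι → ℝ) (ε : ℝ) :
    Measure (Rd d × Rd d) :=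
  (P.prod Q).tilted (gibbsExponent Q y g ε)

variable [Nonempty ι]

lemma integrable_exp_gibbsExponent (hX : IsCompact X) (hPX : ∀ᵐ x ∂P, x ∈ X)
    (hy : Function.Injective y) (hQ : ∀ᵐ z ∂Q, ∃ i, z = y i) (g : ι → ℝ) (ε : ℝ) :
    Integrable (fun p => Real.exp (gibbsExponent Q y g ε p)) (P.prod Q) := by
  obtain ⟨K, hK⟩ := exists_abs_gibbsExponent_le (Q := Q) hX hy g ε
  refine integrable_of_isCoupling hPX hQ isCoupling_prod
    (by fun_prop : Measurable _).aestronglyMeasurable (K := Real.exp K) fun x hx i => ?_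
  rw [Real.norm_of_nonneg (Real.exp_pos _).le]
  gcongr
  exact (le_abs_self _).trans (hK x hx i)

lemma integral_exp_gibbsExponent (hX : IsCompact X) (hPX : ∀ᵐ x ∂P, x ∈ X)
    (hy : Function.Injective y) (hQ : ∀ᵐ z ∂Q, ∃ i, z = y i) (hq : ∀ i, 0 < Q.real {y i})
    (g : ι → ℝ) {ε : ℝ} (hε : 0 < ε) :
    ∫ p, Real.exp (gibbsExponent Q y g ε p) ∂(P.prod Q) = 1 := by
  rw [integral_prod _ (integrable_exp_gibbsExponent hX hPX hy hQ g ε)]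
  simp only [integral_eq_sum_of_ae_mem_range hy hQ, smul_eq_mul,
    mul_exp_gibbsExponent hy g hε _ (hq _), sum_softmax]
  simp

/-- Integration against the entropic plan. -/
lemma integral_gibbsPlan (hX : IsCompact X) (hPX : ∀ᵐ x ∂P, x ∈ X)
    (hy : Function.Injective y) (hQ : ∀ᵐ z ∂Q, ∃ i, z = y i) (hq : ∀ i, 0 < Q.real {y i})
    (g : ι → ℝ) {ε : ℝ} (hε : 0 < ε) {E : Type*} [NormedAddCommGroup E] [NormedSpace ℝ E]
    [CompleteSpace E] {h : Rd d × Rd d → E} (hh : Integrable h (gibbsPlan P Q y g ε)) :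
    ∫ p, h p ∂(gibbsPlan P Q y g ε) = ∫ x, ∑ i, softmax y g ε i x • h (x, y i) ∂P := by
  have hexp := integrable_exp_gibbsExponent hX hPX hy hQ g ε
  have hi := (integrable_tilted_iff hexp h).1 hh
  rw [gibbsPlan, integral_tilted, integral_exp_gibbsExponent hX hPX hy hQ hq g hε]
  simp only [div_one]
  rw [integral_prod _ hi]
  simp only [integral_eq_sum_of_ae_mem_range hy hQ, smul_smul,
    mul_exp_gibbsExponent hy g hε _ (hq _)]

lemma isProbabilityMeasure_gibbsPlan (hX : IsCompact X) (hPX : ∀ᵐ x ∂P, x ∈ X)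
    (hy : Function.Injective y) (hQ : ∀ᵐ z ∂Q, ∃ i, z = y i)
    (g : ι → ℝ) (ε : ℝ) : IsProbabilityMeasure (gibbsPlan P Q y g ε) :=
  isProbabilityMeasure_tilted (integrable_exp_gibbsExponent hX hPX hy hQ g ε)

lemma isCoupling_gibbsPlan (hX : IsCompact X) (hPX : ∀ᵐ x ∂P, x ∈ X)
    (hy : Function.Injective y) (hQ : ∀ᵐ z ∂Q, ∃ i, z = y i) (hq : ∀ i, 0 < Q.real {y i})
    {g : ι → ℝ} {ε : ℝ} (hε : 0 < ε) (hg : ∀ i, ∫ x, softmax y g ε i x ∂P = Q.real {y i}) :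
    IsCoupling P Q (gibbsPlan P Q y g ε) := by
  have := isProbabilityMeasure_gibbsPlan hX hPX hy hQ g ε
  have hmap1 : IsProbabilityMeasure ((gibbsPlan P Q y g ε).map Prod.fst) :=
    Measure.isProbabilityMeasure_map measurable_fst.aemeasurable
  have hmap2 : IsProbabilityMeasure ((gibbsPlan P Q y g ε).map Prod.snd) :=
    Measure.isProbabilityMeasure_map measurable_snd.aemeasurable
  have hind : ∀ s : Set (Rd d), MeasurableSet s → Measurable (s.indicator (1 : Rd d → ℝ)) :=
    fun s hs => measurable_one.indicator hs
  have hii : ∀ (f : Rd d × Rd d → Rd d), Measurable f → ∀ s : Set (Rd d), MeasurableSet s →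
      Integrable (fun p => s.indicator (1 : Rd d → ℝ) (f p)) (gibbsPlan P Q y g ε) := by
    intro f hf s hs
    refine Integrable.of_bound ((hind s hs).comp hf).aestronglyMeasurable 1
      (Eventually.of_forall fun p => ?_)
    rw [Real.norm_of_nonneg (indicator_one_mem_Icc _ _).1]
    exact (indicator_one_mem_Icc _ _).2
  constructor
  · ext s hs
    rw [← ENNReal.toReal_eq_toReal_iff' (measure_ne_top _ _) (measure_ne_top _ _),
      ← measureReal_def, ← measureReal_def, ← integral_indicator_one hs,
      ← integral_indicator_one hs,
      integral_map measurable_fst.aemeasurable (hind s hs).aestronglyMeasurable,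
      integral_gibbsPlan hX hPX hy hQ hq g hε (hii _ measurable_fst s hs)]
    simp only [← Finset.sum_smul, sum_softmax, one_smul]
  · ext s hs
    rw [← ENNReal.toReal_eq_toReal_iff' (measure_ne_top _ _) (measure_ne_top _ _),
      ← measureReal_def, ← measureReal_def, ← integral_indicator_one hs,
      ← integral_indicator_one hs,
      integral_map measurable_snd.aemeasurable (hind s hs).aestronglyMeasurable,
      integral_gibbsPlan hX hPX hy hQ hq g hε (hii _ measurable_snd s hs),
      integral_eq_sum_of_ae_mem_range hy hQ, integral_finsetSum]
    · refine Finset.sum_congr rfl fun i _ => ?_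
      simp only [smul_eq_mul]
      rw [integral_mul_const, hg]
    · intro i _
      simp only [smul_eq_mul]
      exact (integrable_of_continuous_of_ae_mem hX hPX (continuous_softmax i)).mul_const _

/-- The Gibbs variational principle: the entropic objective of a coupling is a constant minus `ε`
times its relative entropy with respect to the Gibbs plan. So an optimal coupling is the Gibbs
plan. -/
lemma eq_gibbsPlan_of_isEntropicPlan (hX : IsCompact X) (hPX : ∀ᵐ x ∂P, x ∈ X)
    (hy : Function.Injective y) (hQ : ∀ᵐ z ∂Q, ∃ i, z = y i) (hq : ∀ i, 0 < Q.real {y i})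
    {g : ι → ℝ} {ε : ℝ} (hε : 0 < ε) (hg : ∀ i, ∫ x, softmax y g ε i x ∂P = Q.real {y i})
    {π : Measure (Rd d × Rd d)} (hπ : IsEntropicPlan P Q ε π) : π = gibbsPlan P Q y g ε := by
  obtain ⟨hπc, hπopt⟩ := hπ
  have hγc := isCoupling_gibbsPlan hX hPX hy hQ hq hε hg
  have hγprob := isProbabilityMeasure_gibbsPlan hX hPX hy hQ g ε
  set γ := gibbsPlan P Q y g ε with hγ
  set F := gibbsExponent Q y g ε with hF
  have hexp := integrable_exp_gibbsExponent hX hPX hy hQ g ε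
  have hexp1 := integral_exp_gibbsExponent hX hPX hy hQ hq g hε
  obtain ⟨K, hK⟩ := exists_abs_gibbsExponent_le (Q := Q) hX hy g ε
  obtain ⟨R, hR⟩ := hX.isBounded.exists_norm_le
  obtain ⟨K', hK0', hK'⟩ := exists_pos_forall_of_mono (p := fun i K => ‖y i‖ ≤ K)
    (fun i C C' h h' => h'.trans h) fun i => ⟨_, le_rfl⟩
  set V : Rd d → ℝ := extendZero y (fun i => g i + ε * Real.log (Q.real {y i})) with hV
  set U : Rd d → ℝ := fun x => ε * Real.log (∑ i, Real.exp (score y g i x / ε)) with hU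
  have hUc : Continuous U :=
    continuous_const.mul (Continuous.log (by fun_prop) fun x => (softmax_denom_pos x).ne')
  have hVm : Measurable V := measurable_extendZero _
  set κ : ℝ := (∫ z, V z ∂Q) + ∫ x, U x ∂P with hκ
  have hFm : Measurable F := measurable_gibbsExponent g ε
  have hFi : ∀ π, IsCoupling P Q π → Integrable F π := fun π hπ =>
    integrable_of_isCoupling hPX hQ hπ hFm.aestronglyMeasurable hK
  have hFint : ∀ π, IsCoupling P Q π →
      ε * ∫ p, F p ∂π = (∫ p, inner ℝ p.1 p.2 ∂π) - κ := by
    intro π hπ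
    have h1 : Integrable (fun p : Rd d × Rd d => (inner ℝ p.1 p.2 : ℝ)) π := by
      refine integrable_of_isCoupling hPX hQ hπ
        (by fun_prop : Continuous fun p : Rd d × Rd d =>
          (inner ℝ p.1 p.2 : ℝ)).aestronglyMeasurable (K := |R| * K') fun x hx i => ?_
      exact (abs_real_inner_le_norm _ _).trans
        (mul_le_mul ((hR x hx).trans (le_abs_self R)) (hK' i) (norm_nonneg _) (abs_nonneg _))
    have hV1 : Integrable V (π.map Prod.snd) := by
      rw [hπ.2]; exact integrable_of_ae_mem_range hQ V
    have hU1 : Integrable U (π.map Prod.fst) := by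
      rw [hπ.1]; exact integrable_of_continuous_of_ae_mem hX hPX hUc
    have hV2 : ∫ p, V p.2 ∂π = ∫ z, V z ∂Q := by
      rw [← hπ.2, integral_map measurable_snd.aemeasurable hVm.aestronglyMeasurable]
    have hU2 : ∫ p, U p.1 ∂π = ∫ x, U x ∂P := by
      rw [← hπ.1, integral_map measurable_fst.aemeasurable hUc.aestronglyMeasurable]
    have hVi : Integrable (fun p => V p.2) π := hV1.comp_measurable measurable_snd
    have hUi : Integrable (fun p => U p.1) π := hU1.comp_measurable measurable_fst
    have h2 : ∀ p, F p = (inner ℝ p.1 p.2 - V p.2 - U p.1) / ε := fun p => rfl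
    have h3 : Integrable (fun p : Rd d × Rd d => (inner ℝ p.1 p.2 : ℝ) - V p.2) π := h1.sub hVi
    simp only [h2]
    rw [integral_div, integral_sub h3 hUi, integral_sub h1 hVi, hV2, hU2, hκ]
    field_simp
    ring
  have hobj : ∀ π, IsCoupling P Q π → π ≪ P.prod Q → Integrable (llr π (P.prod Q)) π →
      entropicObjective P Q ε π
        = ((κ - ε * ∫ p, llr π γ p ∂π : ℝ) : EReal) := by
    intro π hπ hac hint
    have := isProbabilityMeasure_of_isCoupling hπ
    have h1 := integral_llr_tilted_right hac (hFi π hπ) hexp hint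
    rw [hexp1, Real.log_one, add_zero] at h1
    have h2 := hFint π hπ
    have h3 := InformationTheory.toReal_klDiv_of_measure_eq hac (by simp)
    rw [entropicObjective, ← ENNReal.ofReal_toReal (InformationTheory.klDiv_ne_top hac hint), h3,
      EReal.coe_ennreal_ofReal, max_eq_left (h3 ▸ ENNReal.toReal_nonneg), ← EReal.coe_mul,
      ← EReal.coe_sub, hγ, gibbsPlan, ← hF, h1]
    congr 1
    linarith
  have hγobj : entropicObjective P Q ε γ = (κ : EReal) := by
    have h1 : llr γ (P.prod Q) =ᵐ[γ] F := by
      have h := log_rnDeriv_tilted_left_self hexp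
      rw [hexp1, Real.log_one] at h
      filter_upwards [(tilted_absolutelyContinuous _ _).ae_le h] with p hp
      rw [llr, hγ, gibbsPlan, hp, sub_zero]
    rw [hobj γ hγc (tilted_absolutelyContinuous _ _) ((hFi γ hγc).congr h1.symm),
      integral_congr_ae (llr_self γ)]
    simp
  have hπprob := isProbabilityMeasure_of_isCoupling hπc
  have hle := hπopt γ hγc
  rw [hγobj] at hle
  have hfin : InformationTheory.klDiv π (P.prod Q) ≠ ⊤ := by
    intro htop
    rw [entropicObjective, htop, EReal.coe_ennreal_top, EReal.coe_mul_top_of_pos hε,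
      EReal.sub_top] at hle
    simp at hle
  obtain ⟨hac, hint⟩ := InformationTheory.klDiv_ne_top_iff.1 hfin
  rw [hobj π hπc hac hint, EReal.coe_le_coe_iff] at hle
  have hacγ : π ≪ γ := hac.trans (absolutelyContinuous_tilted hexp)
  have hintγ : Integrable (llr π γ) π := integrable_llr_tilted_right hac (hFi π hπc) hint hexp
  have hkl := InformationTheory.toReal_klDiv_of_measure_eq hacγ (by simp)
  have h0 : (InformationTheory.klDiv π γ).toReal = 0 := by
    refine le_antisymm ?_ ENNReal.toReal_nonneg
    rw [hkl]
    exact le_of_mul_le_mul_left (by linarith) hε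
  rcases (ENNReal.toReal_eq_zero_iff _).1 h0 with h | h
  · exact InformationTheory.klDiv_eq_zero_iff.1 h
  · exact absurd h (InformationTheory.klDiv_ne_top hacγ hintγ)

end Entropic

section EntropicMap

variable {d : ℕ} {ι : Type*} [Fintype ι] {X : Set (Rd d)} {P Q : Measure (Rd d)} {y : ι → Rd d}

lemma norm_sum_softmax_smul_le [Nonempty ι] {K : ℝ} (hK : ∀ i, ‖y i‖ ≤ K) (g : ι → ℝ) (ε : ℝ)
    (x : Rd d) : ‖∑ i, softmax y g ε i x • y i‖ ≤ K := by
  refine (norm_sum_le _ _).trans ?_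
  calc ∑ i, ‖softmax y g ε i x • y i‖ ≤ ∑ i, softmax y g ε i x * K := by
        refine Finset.sum_le_sum fun i _ => ?_
        rw [norm_smul, Real.norm_of_nonneg (softmax_nonneg i x)]
        exact mul_le_mul_of_nonneg_left (hK i) (softmax_nonneg i x)
    _ = K := by rw [← Finset.sum_mul, sum_softmax, one_mul]

/-- The entropic map averages the sites with the softmax weights, since these are the conditional
weights of the entropic plan. -/
lemma ae_eq_softmax_of_isEntropicMap [IsProbabilityMeasure P] [IsProbabilityMeasure Q]
    [Nonempty ι] (hX : IsCompact X) (hPX : ∀ᵐ x ∂P, x ∈ X)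
    (hy : Function.Injective y) (hQ : ∀ᵐ z ∂Q, ∃ i, z = y i) (hq : ∀ i, 0 < Q.real {y i})
    {g : ι → ℝ} {ε : ℝ} (hε : 0 < ε) (hg : ∀ i, ∫ x, softmax y g ε i x ∂P = Q.real {y i})
    {T : Rd d → Rd d} (hT : IsEntropicMap P Q ε T) :
    T =ᵐ[P] fun x => ∑ i, softmax y g ε i x • y i := by
  obtain ⟨hTm, π, hπ, hTcond⟩ := hT
  have hγ := eq_gibbsPlan_of_isEntropicPlan hX hPX hy hQ hq hε hg hπ
  have hπc := hπ.1
  have hπprob := isProbabilityMeasure_of_isCoupling hπc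
  set S : Rd d → Rd d := fun x => ∑ i, softmax y g ε i x • y i with hS
  have hSc : Continuous S :=
    continuous_finsetSum _ fun i _ => (continuous_softmax i).smul continuous_const
  obtain ⟨K, hK0, hK⟩ := exists_pos_forall_of_mono (p := fun i K => ‖y i‖ ≤ K)
    (fun i C C' h h' => h'.trans h) fun i => ⟨_, le_rfl⟩
  have hm : MeasurableSpace.comap (Prod.fst : Rd d × Rd d → Rd d) inferInstance
      ≤ (inferInstance : MeasurableSpace (Rd d × Rd d)) := measurable_fst.comap_le
  have hSi : Integrable (fun p : Rd d × Rd d => S p.1) π :=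
    integrable_of_isCoupling hPX hQ hπc
      (hSc.comp continuous_fst).aestronglyMeasurable (K := K)
      fun x _ i => norm_sum_softmax_smul_le hK g ε x
  have hyi : Integrable (fun p : Rd d × Rd d => p.2) π :=
    integrable_of_isCoupling hPX hQ hπc continuous_snd.aestronglyMeasurable (K := K)
      fun x _ i => hK i
  have hScond : (fun p : Rd d × Rd d => S p.1) =ᵐ[π]
      π[fun p : Rd d × Rd d => p.2 |
        MeasurableSpace.comap (Prod.fst : Rd d × Rd d → Rd d) inferInstance] := by
    refine ae_eq_condExp_of_forall_setIntegral_eq hm hyi (fun _ _ _ => hSi.integrableOn) ?_ ?_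
    · rintro _ ⟨t, ht, rfl⟩ -
      have hst : MeasurableSet (Prod.fst ⁻¹' t : Set (Rd d × Rd d)) := measurable_fst ht
      rw [← integral_indicator hst, ← integral_indicator hst]
      have h1 := hSi.indicator hst
      have h2 := hyi.indicator hst
      rw [hγ] at h1 h2 ⊢
      rw [integral_gibbsPlan hX hPX hy hQ hq g hε h1, integral_gibbsPlan hX hPX hy hQ hq g hε h2]
      congr 1
      ext1 x
      by_cases hx : x ∈ t
      · have : ∀ i, (x, y i) ∈ (Prod.fst ⁻¹' t : Set (Rd d × Rd d)) := fun i => hx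
        simp only [Set.indicator_of_mem (this _)]
        rw [← Finset.sum_smul, sum_softmax, one_smul]
      · have : ∀ i, (x, y i) ∉ (Prod.fst ⁻¹' t : Set (Rd d × Rd d)) := fun i => hx
        simp only [Set.indicator_of_notMem (this _)]
    · exact ((hSc.stronglyMeasurable).comp_measurable
        (comap_measurable (Prod.fst : Rd d × Rd d → Rd d))).aestronglyMeasurable
  have h1 : (fun p : Rd d × Rd d => T p.1) =ᵐ[π] fun p => S p.1 := hTcond.trans hScond.symm
  have h2 : (fun p : Rd d × Rd d => hTm.mk T p.1) =ᵐ[π] fun p => S p.1 := by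
    have h3 : ∀ᵐ x ∂(π.map Prod.fst), T x = hTm.mk T x := by rw [hπc.1]; exact hTm.ae_eq_mk
    filter_upwards [h1, ae_of_ae_map measurable_fst.aemeasurable h3] with p hp hp'
    rw [← hp', hp]
  have h4 : ∀ᵐ x ∂(π.map Prod.fst), hTm.mk T x = S x :=
    (ae_map_iff measurable_fst.aemeasurable
      (measurableSet_eq_fun hTm.measurable_mk hSc.measurable)).2 h2
  exact hTm.ae_eq_mk.trans (hπc.1 ▸ h4 : ∀ᵐ x ∂P, _)

end EntropicMap

/-! ### Hölder norms -/

section Holder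

variable {d : ℕ} {X : Set (Rd d)} {α : ℝ} {φ : Rd d → Rd d}

lemma IsHolderOn.continuousOn (hα : 0 < α) (h : IsHolderOn α X φ) : ContinuousOn φ X := by
  obtain ⟨K, hK⟩ := h
  intro x hx
  rw [ContinuousWithinAt, tendsto_iff_norm_sub_tendsto_zero]
  have h1 : Tendsto (fun x' => K * ‖x' - x‖ ^ α) (𝓝[X] x) (𝓝 0) := by
    have : ContinuousAt (fun x' : Rd d => K * ‖x' - x‖ ^ α) x :=
      continuousAt_const.mul ((by fun_prop : ContinuousAt (fun x' : Rd d => ‖x' - x‖) x).rpow_const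
        (Or.inr hα.le))
    have h2 := this.tendsto
    simp only [sub_self, norm_zero, Real.zero_rpow hα.ne', mul_zero] at h2
    exact h2.mono_left nhdsWithin_le_nhds
  exact squeeze_zero' (Eventually.of_forall fun _ => norm_nonneg _)
    (eventually_mem_nhdsWithin.mono fun x' hx' => hK x' hx' x hx) h1

lemma supNorm_nonneg : 0 ≤ supNorm X φ :=
  Real.sSup_nonneg <| by rintro _ ⟨x, -, rfl⟩; exact norm_nonneg _

lemma norm_le_supNorm (hX : IsCompact X) (hφ : ContinuousOn φ X) {x : Rd d} (hx : x ∈ X) :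
    ‖φ x‖ ≤ supNorm X φ :=
  le_csSup (hX.bddAbove_image hφ.norm) (Set.mem_image_of_mem _ hx)

lemma supNorm_le_holderNorm : supNorm X φ ≤ holderNorm α X φ := by
  refine le_add_of_nonneg_right (Real.sSup_nonneg ?_)
  rintro _ ⟨x, -, x', -, -, rfl⟩
  positivity

lemma IsHolderOn.norm_sub_le (h : IsHolderOn α X φ) {x x' : Rd d} (hx : x ∈ X) (hx' : x' ∈ X) :
    ‖φ x - φ x'‖ ≤ (holderNorm α X φ - supNorm X φ) * ‖x - x'‖ ^ α := by
  obtain ⟨K, hK⟩ := h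
  rcases eq_or_ne x x' with rfl | hne
  · rw [sub_self, norm_zero]
    exact mul_nonneg (sub_nonneg.2 supNorm_le_holderNorm) (Real.rpow_nonneg (norm_nonneg _) _)
  have hpos : 0 < ‖x - x'‖ ^ α := Real.rpow_pos_of_pos (norm_pos_iff.2 (sub_ne_zero.2 hne)) _
  rw [holderNorm, add_sub_cancel_left, ← div_le_iff₀ hpos]
  refine le_csSup ⟨K, ?_⟩ ⟨x, hx, x', hx', hne, rfl⟩
  rintro _ ⟨z, hz, z', hz', hzz, rfl⟩
  exact (div_le_iff₀ (Real.rpow_pos_of_pos (norm_pos_iff.2 (sub_ne_zero.2 hzz)) _)).2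
    (hK z hz z' hz')

end Holder

/-! ### Measures with a density bounded above and below -/

section Density

variable {d : ℕ} {X : Set (Rd d)} {ρ : Rd d → ℝ} {m M : ℝ}

lemma le_measureReal_densityMeasure (hX : IsCompact X)
    [IsFiniteMeasure (densityMeasure X ρ)] (hm : 0 ≤ m) (hmρ : ∀ x ∈ X, m ≤ ρ x)
    (s : Set (Rd d)) : m * (volume.restrict X).real s ≤ (densityMeasure X ρ).real s := by
  have hfin : IsFiniteMeasure (volume.restrict X) :=
    ⟨by simpa using hX.isBounded.measure_lt_top⟩
  have h : ENNReal.ofReal m * volume.restrict X s ≤ densityMeasure X ρ s := by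
    rw [densityMeasure, withDensity_apply', ← setLIntegral_const]
    refine lintegral_mono_ae (ae_restrict_of_ae ?_)
    filter_upwards [ae_restrict_mem hX.measurableSet] with x hx
    exact ENNReal.ofReal_le_ofReal (hmρ x hx)
  have := ENNReal.toReal_mono (measure_ne_top _ _) h
  rwa [ENNReal.toReal_mul, ENNReal.toReal_ofReal hm] at this

lemma measureReal_densityMeasure_le (hX : IsCompact X)
    (hM : 0 ≤ M) (hρM : ∀ x ∈ X, ρ x ≤ M) (s : Set (Rd d)) :
    (densityMeasure X ρ).real s ≤ M * (volume.restrict X).real s := by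
  have hfin : IsFiniteMeasure (volume.restrict X) :=
    ⟨by simpa using hX.isBounded.measure_lt_top⟩
  have h : densityMeasure X ρ s ≤ ENNReal.ofReal M * volume.restrict X s := by
    rw [densityMeasure, withDensity_apply', ← setLIntegral_const]
    refine lintegral_mono_ae (ae_restrict_of_ae ?_)
    filter_upwards [ae_restrict_mem hX.measurableSet] with x hx
    exact ENNReal.ofReal_le_ofReal (hρM x hx)
  have := ENNReal.toReal_mono (ENNReal.mul_ne_top ENNReal.ofReal_ne_top (measure_ne_top _ _)) h
  rwa [ENNReal.toReal_mul, ENNReal.toReal_ofReal hM] at this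

lemma integral_densityMeasure (hX : IsCompact X) (hρ : ContinuousOn ρ X)
    (hρ0 : ∀ x ∈ X, 0 ≤ ρ x) (f : Rd d → ℝ) :
    ∫ x, f x ∂(densityMeasure X ρ) = ∫ x in X, ρ x * f x := by
  rw [densityMeasure, integral_withDensity_eq_integral_toReal_smul₀
    (hρ.aemeasurable hX.measurableSet).ennreal_ofReal
    (Eventually.of_forall fun _ => ENNReal.ofReal_lt_top)]
  refine setIntegral_congr_fun hX.measurableSet fun x hx => ?_
  simp only [smul_eq_mul]
  rw [ENNReal.toReal_ofReal (hρ0 x hx)]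

lemma ae_mem_densityMeasure (hX : IsCompact X) : ∀ᵐ x ∂(densityMeasure X ρ), x ∈ X :=
  (withDensity_absolutelyContinuous _ _).ae_le (ae_restrict_mem hX.measurableSet)

lemma integrable_mul_densityMeasure [IsFiniteMeasure (densityMeasure X ρ)] (hX : IsCompact X)
    {ψ h : Rd d → ℝ} (hψ : ContinuousOn ψ X) (hh : Measurable h) {b : ℝ} (hb : ∀ x, |h x| ≤ b) :
    Integrable (fun x => ψ x * h x) (densityMeasure X ρ) := by
  obtain ⟨B, hB⟩ := hX.exists_bound_of_continuousOn hψ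
  have h1 : AEStronglyMeasurable ψ (densityMeasure X ρ) :=
    (hψ.aestronglyMeasurable hX.measurableSet).mono_ac (withDensity_absolutelyContinuous _ _)
  refine Integrable.of_bound (h1.mul hh.aestronglyMeasurable) (B * b) ?_
  filter_upwards [ae_mem_densityMeasure hX] with x hx
  rw [norm_mul]
  exact mul_le_mul (hB x hx) (hb x) (norm_nonneg _) ((norm_nonneg _).trans (hB x hx))

end Density

/-! ### Comparison of the entropic map with the Brenier map -/

section Comparison

variable {d : ℕ} {ι : Type*} [Fintype ι] {X : Set (Rd d)} {ρ : Rd d → ℝ} {m M : ℝ}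
  {L : ℝ≥0} {y : ι → Rd d}

lemma abs_softmax_sub_indicator_le (g g' : ι → ℝ) (ε : ℝ) (i : ι) (x : Rd d) :
    |softmax y g ε i x - (cell y g' i).indicator 1 x| ≤ 1 := by
  have h1 := softmax_nonneg (y := y) (g := g) (ε := ε) i x
  have h2 := softmax_le_one (y := y) (g := g) (ε := ε) i x
  have h3 := indicator_one_mem_Icc (cell y g' i) x
  exact abs_sub_le_of_nonneg_of_le h1 h2 h3.1 h3.2

lemma abs_integral_mul_indicator_sub_le {P : Measure (Rd d)} [IsFiniteMeasure P]
    (hPX : ∀ᵐ x ∂P, x ∈ X) {A A' : Set (Rd d)} (hA : MeasurableSet A) (hA' : MeasurableSet A')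
    {ψ : Rd d → ℝ} {B : ℝ} (hB : ∀ x ∈ X, |ψ x| ≤ B) :
    |∫ x, ψ x * (A.indicator 1 x - A'.indicator 1 x) ∂P|
      ≤ B * (P.real (A \ A') + P.real (A' \ A)) := by
  have hi : ∀ s : Set (Rd d), MeasurableSet s →
      Integrable (s.indicator (1 : Rd d → ℝ)) P := fun s hs =>
    (integrable_const (1 : ℝ)).indicator hs
  have h1 := hi _ (hA.diff hA')
  have h2 := hi _ (hA'.diff hA)
  rw [← integral_indicator_one (hA.diff hA'), ← integral_indicator_one (hA'.diff hA),
    ← integral_add h1 h2, ← integral_const_mul, ← Real.norm_eq_abs]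
  refine norm_integral_le_of_norm_le ((h1.add h2).const_mul B) ?_
  filter_upwards [hPX] with x hx
  rw [norm_mul]
  refine mul_le_mul (hB x hx) ?_ (norm_nonneg _) ((abs_nonneg _).trans (hB x hx))
  by_cases h : x ∈ A <;> by_cases h' : x ∈ A' <;> simp [h, h']

/-- A softmax weight has at most the mass of its Laguerre cell, up to `O(ε)`. So Laguerre cells have
masses bounded below if the softmax weights do. -/
lemma exists_integral_softmax_le [IsProbabilityMeasure (densityMeasure X ρ)] (hX : IsCompact X)
    (hρ : ContinuousOn ρ X) (hρ0 : ∀ x ∈ X, 0 ≤ ρ x) (hρM : ∀ x ∈ X, ρ x ≤ M)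
    (hy : Function.Injective y) :
    ∃ C : ℝ, 0 < C ∧ ∀ i (g : ι → ℝ) (ε : ℝ), 0 < ε →
      ∫ x, softmax y g ε i x ∂(densityMeasure X ρ)
        ≤ (densityMeasure X ρ).real (cell y g i) + C * ε := by
  classical
  have hfin : IsFiniteMeasure (volume.restrict X) :=
    ⟨by simpa using hX.isBounded.measure_lt_top⟩
  set P := densityMeasure X ρ with hP
  have hPX : ∀ᵐ x ∂P, x ∈ X := ae_mem_densityMeasure hX
  have hexp : ∀ i : ι, ∀ j : {j // j ≠ i}, ∃ C : ℝ, ∀ (g : ι → ℝ) (ε : ℝ), 0 < ε →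
      ∫ x, Real.exp (-|score y g i x - score y g j x| / ε) ∂P ≤ C * ε := by
    rintro i ⟨j, hj⟩
    have hv : y i - y j ≠ 0 := sub_ne_zero.2 (hy.ne hj.symm)
    obtain ⟨C, hC0, hC⟩ := exists_integral_exp_strip_le hX hv
    refine ⟨M * C, fun g ε hε => ?_⟩
    have h1 : Continuous fun x => Real.exp (-|score y g i x - score y g j x| / ε) := by fun_prop
    rw [hP, integral_densityMeasure hX hρ hρ0, mul_assoc]
    have hM : X.Nonempty → 0 ≤ M := fun ⟨x, hx⟩ => (hρ0 x hx).trans (hρM x hx)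
    rcases X.eq_empty_or_nonempty with hXe | hXn
    · have : (P : Measure (Rd d)) Set.univ = 0 := by rw [hP, densityMeasure, hXe]; simp
      simp [measure_univ] at this
    calc ∫ x in X, ρ x * Real.exp (-|score y g i x - score y g j x| / ε)
        ≤ ∫ x in X, M * Real.exp (-|score y g i x - score y g j x| / ε) := by
          refine setIntegral_mono_on ?_ ?_ hX.measurableSet fun x hx => ?_
          · exact (hρ.mul h1.continuousOn).integrableOn_compact hX
          · exact (continuous_const.mul h1).continuousOn.integrableOn_compact hX
          · exact mul_le_mul_of_nonneg_right (hρM x hx) (Real.exp_pos _).le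
      _ ≤ M * (C * ε) := by
          rw [integral_const_mul]
          refine mul_le_mul_of_nonneg_left ?_ (hM hXn)
          simpa only [score_sub_score] using hC (g i - g j) ε hε
  refine exists_pos_forall_of_mono (fun i C C' hCC h g ε hε => (h g ε hε).trans ?_) fun i => ?_
  · gcongr
  obtain ⟨C, hC0, hC⟩ := exists_pos_forall_of_mono
    (p := fun (j : {j // j ≠ i}) C => ∀ (g : ι → ℝ) (ε : ℝ), 0 < ε →
      ∫ x, Real.exp (-|score y g i x - score y g j x| / ε) ∂P ≤ C * ε)
    (fun j C C' hCC h g ε hε => (h g ε hε).trans (by gcongr)) (hexp i)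
  refine ⟨Fintype.card {j // j ≠ i} * C, fun g ε hε => ?_⟩
  have hei : ∀ j : {j // j ≠ i},
      Integrable (fun x => Real.exp (-|score y g i x - score y g j x| / ε)) P := fun j =>
    integrable_of_continuous_of_ae_mem hX hPX (by fun_prop)
  have hci : Integrable ((cell y g i).indicator (1 : Rd d → ℝ)) P :=
    (integrable_const (1 : ℝ)).indicator (measurableSet_cell i)
  calc ∫ x, softmax y g ε i x ∂P
      ≤ ∫ x, ((cell y g i).indicator 1 x +
          ∑ j : {j // j ≠ i}, Real.exp (-|score y g i x - score y g j x| / ε)) ∂P :=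
        integral_mono (integrable_of_continuous_of_ae_mem hX hPX (continuous_softmax i))
          (hci.add (integrable_finsetSum _ fun j _ => hei j)) fun x => softmax_le_indicator_add i x
    _ = P.real (cell y g i) +
          ∑ j : {j // j ≠ i}, ∫ x, Real.exp (-|score y g i x - score y g j x| / ε) ∂P := by
        rw [integral_add hci (integrable_finsetSum _ fun j _ => hei j),
          integral_indicator_one (measurableSet_cell i), integral_finsetSum _ fun j _ => hei j]
    _ ≤ P.real (cell y g i) + ∑ _j : {j // j ≠ i}, C * ε := by
        gcongr with j _
        exact hC j g ε hε
    _ = P.real (cell y g i) + Fintype.card {j // j ≠ i} * C * ε := by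
        simp [mul_assoc]

/-- The smoothing error of the softmax weights against a test function, under a Lipschitz density.
The density is absorbed into the test function, which stays Hölder. -/
lemma exists_abs_integral_mul_softmax_sub_indicator_le [IsProbabilityMeasure (densityMeasure X ρ)]
    (hX : IsCompact X) (hXc : Convex ℝ X) (hXi : (interior X).Nonempty)
    (hρ : LipschitzOnWith L ρ X) (hρ0 : ∀ x ∈ X, 0 ≤ ρ x) (hM : 0 < M) (hρM : ∀ x ∈ X, ρ x ≤ M)
    (hy : Function.Injective y) {c : ℝ} (hc : 0 < c) :
    ∃ C : ℝ, 0 < C ∧ ∀ g : ι → ℝ, (∀ l, c ≤ (densityMeasure X ρ).real (cell y g l)) →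
      ∀ ε : ℝ, 0 < ε → ε ≤ Real.exp (-1) → ∀ α : ℝ, 0 < α → α ≤ 1 →
      ∀ ψ : Rd d → ℝ, ContinuousOn ψ X → ∀ B K : ℝ, 0 ≤ B → 0 ≤ K → (∀ x ∈ X, |ψ x| ≤ B) →
        (∀ x ∈ X, ∀ x' ∈ X, |ψ x - ψ x'| ≤ K * ‖x - x'‖ ^ α) → ∀ i,
      |∫ x, ψ x * (softmax y g ε i x - (cell y g i).indicator 1 x) ∂(densityMeasure X ρ)|
        ≤ C * (B * (ε ^ 2 * Real.log (1 / ε) ^ 2) + (B + K) * ε ^ (1 + α)) := by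
  obtain ⟨C, hC0, hC⟩ := exists_abs_integral_softmax_sub_indicator_le hX hXc hXi hy
    (div_pos hc hM)
  obtain ⟨D, hD⟩ := hX.isBounded.exists_norm_le
  set Δ : ℝ := max 1 (2 * D) with hΔ
  have hΔ1 : 1 ≤ Δ := le_max_left _ _
  have hdist : ∀ α : ℝ, 0 < α → α ≤ 1 → ∀ x ∈ X, ∀ x' ∈ X, ‖x - x'‖ ≤ Δ * ‖x - x'‖ ^ α := by
    intro α hα0 hα1 x hx x' hx'
    have h1 : ‖x - x'‖ ≤ Δ := by
      refine le_trans ?_ (le_max_right _ _)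
      linarith [norm_sub_le x x', hD x hx, hD x' hx']
    rcases (norm_nonneg (x - x')).eq_or_lt with h0 | h0
    · rw [← h0]
      positivity
    calc ‖x - x'‖ = ‖x - x'‖ ^ (1 - α) * ‖x - x'‖ ^ α := by
          rw [← Real.rpow_add h0, sub_add_cancel, Real.rpow_one]
      _ ≤ Δ * ‖x - x'‖ ^ α := by
          refine mul_le_mul_of_nonneg_right ?_ (by positivity)
          calc ‖x - x'‖ ^ (1 - α) ≤ Δ ^ (1 - α) :=
                Real.rpow_le_rpow h0.le h1 (by linarith)
            _ ≤ Δ ^ (1 : ℝ) := Real.rpow_le_rpow_of_exponent_le hΔ1 (by linarith)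
            _ = Δ := Real.rpow_one _
  refine ⟨C * (M + L * Δ), by positivity,
    fun g hg ε hε hε1 α hα0 hα1 ψ hψ B K hB0 hK0 hB hK i => ?_⟩
  have hcell : ∀ l, c / M ≤ (volume.restrict X).real (cell y g l) := fun l => by
    rw [div_le_iff₀' hM]
    exact (hg l).trans (measureReal_densityMeasure_le hX hM.le hρM _)
  set F : Rd d → ℝ := X.indicator fun x => ρ x * ψ x with hF
  have hFX : ∀ x ∈ X, F x = ρ x * ψ x := fun x hx => Set.indicator_of_mem hx _
  have hFm : Measurable F := by
    classical
    rw [hF, ← Set.piecewise_eq_indicator]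
    exact ContinuousOn.measurable_piecewise (hρ.continuousOn.mul hψ) continuousOn_const
      hX.measurableSet
  have hFB : ∀ x ∈ X, |F x| ≤ M * B := fun x hx => by
    rw [hFX x hx, abs_mul, abs_of_nonneg (hρ0 x hx)]
    exact mul_le_mul (hρM x hx) (hB x hx) (abs_nonneg _) hM.le
  have hFK : ∀ x ∈ X, ∀ x' ∈ X, |F x - F x'| ≤ (L * Δ * B + M * K) * ‖x - x'‖ ^ α := by
    intro x hx x' hx'
    have h1 : |ρ x - ρ x'| ≤ L * (Δ * ‖x - x'‖ ^ α) :=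
      (hρ.norm_sub_le hx hx').trans
        (mul_le_mul_of_nonneg_left (hdist α hα0 hα1 x hx x' hx') L.coe_nonneg)
    rw [hFX x hx, hFX x' hx',
      show ρ x * ψ x - ρ x' * ψ x' = (ρ x - ρ x') * ψ x + ρ x' * (ψ x - ψ x') by ring]
    refine (abs_add_le _ _).trans ?_
    rw [abs_mul, abs_mul, abs_of_nonneg (hρ0 x' hx')]
    have h2 := mul_le_mul h1 (hB x hx) (abs_nonneg _) (by positivity)
    have h3 := mul_le_mul (hρM x' hx') (hK x hx x' hx') (abs_nonneg _) hM.le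
    linarith
  have key := hC g hcell ε hε hε1 α hα0 hα1 F hFm (M * B) (L * Δ * B + M * K) (by positivity)
    (by positivity) hFB hFK i
  rw [integral_densityMeasure hX hρ.continuousOn hρ0]
  have hcongr : ∫ x in X, ρ x * (ψ x * (softmax y g ε i x - (cell y g i).indicator 1 x))
      = ∫ x in X, F x * (softmax y g ε i x - (cell y g i).indicator 1 x) :=
    setIntegral_congr_fun hX.measurableSet fun x hx => by
      simp only [hFX x hx]; ring
  rw [hcongr, mul_assoc]
  refine key.trans (mul_le_mul_of_nonneg_left ?_ hC0.le)
  have e1 : 0 ≤ ε ^ 2 * Real.log (1 / ε) ^ 2 := by positivity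
  have e2 : 0 ≤ ε ^ (1 + α) := by positivity
  have e3 : 0 ≤ L * Δ * (B * (ε ^ 2 * Real.log (1 / ε) ^ 2)) := by positivity
  have e4 : 0 ≤ L * Δ * (K * ε ^ (1 + α)) := by positivity
  have e5 : 0 ≤ M * (B * ε ^ (1 + α)) := by positivity
  nlinarith

/-- Softmax weights and Laguerre cells with the same masses agree, against Hölder test functions,
up to the smoothing error. The two sets of offsets differ: the cells with the offsets of the softmax
weights have almost the right masses (the smoothing error against the constant `1`), so by stability
they almost coincide with the cells that have exactly the right masses. -/
lemma exists_abs_integral_mul_softmax_sub_cell_le [IsProbabilityMeasure (densityMeasure X ρ)]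
    (hX : IsCompact X) (hXc : Convex ℝ X) (hXi : (interior X).Nonempty)
    (hρ : LipschitzOnWith L ρ X) (hm : 0 < m) (hmρ : ∀ x ∈ X, m ≤ ρ x) (hM : 0 < M)
    (hρM : ∀ x ∈ X, ρ x ≤ M) (hy : Function.Injective y) {c : ℝ} (hc : 0 < c) :
    ∃ C ε₀ : ℝ, 0 < C ∧ 0 < ε₀ ∧ ∀ q : ι → ℝ, (∀ l, c ≤ q l) →
      ∀ ε : ℝ, 0 < ε → ε ≤ ε₀ → ∀ g g₀ : ι → ℝ,
      (∀ l, ∫ x, softmax y g ε l x ∂(densityMeasure X ρ) = q l) →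
      (∀ l, (densityMeasure X ρ).real (cell y g₀ l) = q l) → ∀ α : ℝ, 0 < α → α ≤ 1 →
      ∀ ψ : Rd d → ℝ, ContinuousOn ψ X → ∀ B K : ℝ, 0 ≤ B → 0 ≤ K → (∀ x ∈ X, |ψ x| ≤ B) →
        (∀ x ∈ X, ∀ x' ∈ X, |ψ x - ψ x'| ≤ K * ‖x - x'‖ ^ α) → ∀ i,
      |∫ x, ψ x * (softmax y g ε i x - (cell y g₀ i).indicator 1 x) ∂(densityMeasure X ρ)|
        ≤ C * (B * (ε ^ 2 * Real.log (1 / ε) ^ 3) + (B + K) * ε ^ (1 + α)) := by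
  have hρ0 : ∀ x ∈ X, 0 ≤ ρ x := fun x hx => hm.le.trans (hmρ x hx)
  have hPX : ∀ᵐ x ∂(densityMeasure X ρ), x ∈ X := ae_mem_densityMeasure hX
  obtain ⟨C₁, hC₁, hmass⟩ := exists_integral_softmax_le hX hρ.continuousOn hρ0 hρM hy
  obtain ⟨C₂, hC₂, hsmooth⟩ := exists_abs_integral_mul_softmax_sub_indicator_le hX hXc hXi hρ hρ0
    hM hρM hy (half_pos hc)
  obtain ⟨C₃, hC₃, hstab⟩ := exists_measureReal_cell_sdiff_le hm hM hX hXc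
    (le_measureReal_densityMeasure hX hm.le hmρ) (measureReal_densityMeasure_le hX hM.le hρM) hy
    (half_pos hc)
  set P := densityMeasure X ρ with hP
  set N : ℝ := (Fintype.card ι : ℝ) with hN
  refine ⟨C₂ + 2 * C₃ * (N * (C₂ * 2)), min (Real.exp (-1)) (c / (2 * C₁)), by positivity,
    lt_min (Real.exp_pos _) (by positivity), ?_⟩
  intro q hq ε hε hε₀ g g₀ hg hg₀ α hα0 hα1 ψ hψ B K hB0 hK0 hB hK i
  have hε1 : ε ≤ Real.exp (-1) := hε₀.trans (min_le_left _ _)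
  have hlog : 1 ≤ Real.log (1 / ε) := by
    rw [one_div, Real.log_inv]
    have := Real.log_le_log hε hε1
    rw [Real.log_exp] at this
    linarith
  set ℓ := Real.log (1 / ε) with hℓ
  have hℓ1 : (1 : ℝ) ≤ ℓ ^ 2 := one_le_pow₀ hlog
  have hℓ2 : ℓ ^ 2 ≤ ℓ ^ 3 := pow_le_pow_right₀ hlog (by norm_num)
  have hcell₀ : ∀ l, c / 2 ≤ P.real (cell y g₀ l) := fun l => by
    rw [hg₀]; linarith [hq l]
  have hcell : ∀ l, c / 2 ≤ P.real (cell y g l) := fun l => by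
    have h1 := hmass l g ε hε
    rw [hg] at h1
    have h2 : C₁ * ε ≤ c / 2 := by
      calc C₁ * ε ≤ C₁ * (c / (2 * C₁)) := by gcongr; exact hε₀.trans (min_le_right _ _)
        _ = c / 2 := by field_simp
    linarith [hq l]
  -- The smoothing error against the constant `1` is the error in the masses.
  have hdiff : ∀ l, |P.real (cell y g l) - P.real (cell y g₀ l)| ≤ C₂ * 2 * (ε ^ 2 * ℓ ^ 2) := by
    intro l
    have h1 := hsmooth g hcell ε hε hε1 1 one_pos le_rfl (fun _ => 1) continuousOn_const 1 0
      zero_le_one le_rfl (fun _ _ => by simp) (fun _ _ _ _ => by simp) l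
    simp only [one_mul, add_zero] at h1
    rw [integral_sub (integrable_of_continuous_of_ae_mem hX hPX (continuous_softmax l))
      (show Integrable ((cell y g l).indicator (1 : Rd d → ℝ)) P from
        (integrable_const (1 : ℝ)).indicator (measurableSet_cell l)),
      integral_indicator_one (measurableSet_cell l), hg, ← hg₀, abs_sub_comm] at h1
    refine h1.trans ?_
    rw [mul_assoc]
    refine mul_le_mul_of_nonneg_left ?_ hC₂.le
    have h2 : ε ^ ((1 : ℝ) + 1) = ε ^ 2 := by
      rw [show (1 : ℝ) + 1 = (2 : ℕ) by norm_num, Real.rpow_natCast]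
    rw [h2]
    nlinarith [sq_nonneg ε]
  have hsum : ∑ l, |P.real (cell y g l) - P.real (cell y g₀ l)|
      ≤ N * (C₂ * 2) * (ε ^ 2 * ℓ ^ 2) := by
    calc _ ≤ ∑ _l : ι, C₂ * 2 * (ε ^ 2 * ℓ ^ 2) := Finset.sum_le_sum fun l _ => hdiff l
      _ = N * (C₂ * 2) * (ε ^ 2 * ℓ ^ 2) := by simp [hN, mul_assoc]
  have hs1 := (hstab g g₀ hcell i).trans (mul_le_mul_of_nonneg_left hsum hC₃.le)
  have hs2 := hstab g₀ g hcell₀ i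
  simp only [abs_sub_comm (P.real (cell y g₀ _))] at hs2
  replace hs2 := hs2.trans (mul_le_mul_of_nonneg_left hsum hC₃.le)
  have hA := hsmooth g hcell ε hε hε1 α hα0 hα1 ψ hψ B K hB0 hK0 hB hK i
  have hB' := abs_integral_mul_indicator_sub_le hPX (measurableSet_cell (y := y) (g := g) i)
    (measurableSet_cell (y := y) (g := g₀) i) hB
  have hm1 : Measurable fun x => softmax y g ε i x - (cell y g i).indicator (1 : Rd d → ℝ) x :=
    (continuous_softmax i).measurable.sub (measurable_one.indicator (measurableSet_cell i))
  have hm2 : Measurable fun x => (cell y g i).indicator (1 : Rd d → ℝ) x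
      - (cell y g₀ i).indicator (1 : Rd d → ℝ) x :=
    (measurable_one.indicator (measurableSet_cell i)).sub
      (measurable_one.indicator (measurableSet_cell i))
  have hi1 : Integrable (fun x => ψ x *
      (softmax y g ε i x - (cell y g i).indicator (1 : Rd d → ℝ) x)) P :=
    integrable_mul_densityMeasure hX hψ hm1 (b := 1) (abs_softmax_sub_indicator_le g g ε i)
  have hi2 : Integrable (fun x => ψ x * ((cell y g i).indicator (1 : Rd d → ℝ) x
      - (cell y g₀ i).indicator (1 : Rd d → ℝ) x)) P :=
    integrable_mul_densityMeasure hX hψ hm2 (b := 1) fun x =>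
      abs_sub_le_of_nonneg_of_le (indicator_one_mem_Icc _ x).1 (indicator_one_mem_Icc _ x).2
        (indicator_one_mem_Icc _ x).1 (indicator_one_mem_Icc _ x).2
  have hsplit : ∫ x, ψ x * (softmax y g ε i x - (cell y g₀ i).indicator 1 x) ∂P
      = (∫ x, ψ x * (softmax y g ε i x - (cell y g i).indicator 1 x) ∂P)
        + ∫ x, ψ x * ((cell y g i).indicator 1 x - (cell y g₀ i).indicator 1 x) ∂P := by
    rw [← integral_add hi1 hi2]
    congr 1
    ext x
    ring
  rw [hsplit]
  have hB'' : B * (P.real (cell y g i \ cell y g₀ i) + P.real (cell y g₀ i \ cell y g i))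
      ≤ B * (2 * C₃ * (N * (C₂ * 2)) * (ε ^ 2 * ℓ ^ 2)) :=
    mul_le_mul_of_nonneg_left (by linarith) hB0
  have e0 : 0 ≤ 2 * C₃ * (N * (C₂ * 2)) := by positivity
  set W := 2 * C₃ * (N * (C₂ * 2)) with hW
  have e1 : B * (ε ^ 2 * ℓ ^ 2) ≤ B * (ε ^ 2 * ℓ ^ 3) := by gcongr
  have e2 : 0 ≤ (B + K) * ε ^ (1 + α) := by positivity
  calc _ ≤ C₂ * (B * (ε ^ 2 * ℓ ^ 2) + (B + K) * ε ^ (1 + α))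
        + B * (W * (ε ^ 2 * ℓ ^ 2)) :=
        (abs_add_le _ _).trans (add_le_add hA (hB'.trans hB''))
    _ ≤ C₂ * (B * (ε ^ 2 * ℓ ^ 3) + (B + K) * ε ^ (1 + α))
        + W * (B * (ε ^ 2 * ℓ ^ 3) + (B + K) * ε ^ (1 + α)) := by
        refine add_le_add (mul_le_mul_of_nonneg_left (by linarith) hC₂.le) ?_
        rw [mul_left_comm]
        exact mul_le_mul_of_nonneg_left (by linarith) e0
    _ = _ := by ring

end Comparison

end EntropicOT

open EntropicOT

theorem theorem1 {d : ℕ} (α : ℝ) (hα0 : 0 < α) (hα1 : α ≤ 1)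
    (X : Set (EntropicOT.Rd d)) (hXcompact : IsCompact X) (hXconvex : Convex ℝ X)
    (hXint : (interior X).Nonempty)
    (ρ : EntropicOT.Rd d → ℝ) (hρLip : ∃ L : ℝ≥0, LipschitzOnWith L ρ X)
    (hρpos : ∀ x ∈ X, 0 < ρ x)
    (hρprob : IsProbabilityMeasure (EntropicOT.densityMeasure X ρ))
    (Y : Finset (EntropicOT.Rd d)) (c₀ : ℝ) (hc0 : 0 < c₀) (hc1 : c₀ < 1) :
    ∃ C : ℝ, 0 < C ∧
      ∀ Q : Measure (EntropicOT.Rd d), IsProbabilityMeasure Q →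
        Q (↑Y : Set (EntropicOT.Rd d))ᶜ = 0 → (∀ y ∈ Y, c₀ ≤ Q.real {y}) →
      ∀ T₀ : EntropicOT.Rd d → EntropicOT.Rd d,
        EntropicOT.IsBrenierMap (EntropicOT.densityMeasure X ρ) Q T₀ →
      ∀ φ : EntropicOT.Rd d → EntropicOT.Rd d, EntropicOT.IsHolderOn α X φ →
      ∀ ε : ℝ, 0 < ε → ε < 1 →
      ∀ T : EntropicOT.Rd d → EntropicOT.Rd d,
        EntropicOT.IsEntropicMap (EntropicOT.densityMeasure X ρ) Q ε T →
        |∫ x, inner ℝ (φ x) (T x - T₀ x) ∂(EntropicOT.densityMeasure X ρ)| ≤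
          C * (EntropicOT.supNorm X φ * ε ^ 2 * (Real.log (1 / ε)) ^ 3
            + EntropicOT.holderNorm α X φ * ε ^ (1 + α)) := by
  have hXne : X.Nonempty := hXint.mono interior_subset
  obtain ⟨L, hL⟩ := hρLip
  obtain ⟨xm, hxm, hmin⟩ := hXcompact.exists_isMinOn hXne hL.continuousOn
  obtain ⟨xM, hxM, hmax⟩ := hXcompact.exists_isMaxOn hXne hL.continuousOn
  have hmρ : ∀ x ∈ X, ρ xm ≤ ρ x := fun x hx => hmin hx
  have hρM : ∀ x ∈ X, ρ x ≤ ρ xM := fun x hx => hmax hx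
  have hup := measureReal_densityMeasure_le hXcompact (hρpos _ hxM).le hρM
  set y : Y → Rd d := Subtype.val with hydef
  have hy : Function.Injective y := Subtype.val_injective
  obtain ⟨C, ε₀, hC, hε₀, hmain⟩ := exists_abs_integral_mul_softmax_sub_cell_le hXcompact hXconvex
    hXint hL (hρpos _ hxm) hmρ (hρpos _ hxM) hρM hy hc0
  obtain ⟨R, hR0, hR⟩ := exists_pos_forall_of_mono (p := fun i R => ‖y i‖ ≤ R)
    (fun i C C' h h' => h'.trans h) fun i => ⟨_, le_rfl⟩
  set P := densityMeasure X ρ with hP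
  have hPX : ∀ᵐ x ∂P, x ∈ X := ae_mem_densityMeasure hXcompact
  refine ⟨Fintype.card Y * (C * R) + 2 * R / ε₀ ^ 2, by positivity, ?_⟩
  intro Q hQprob hQY hQc T₀ hT₀ φ hφ ε hε hε1 T hT
  have hQ : ∀ᵐ z ∂Q, ∃ i, z = y i := by
    filter_upwards [(mem_ae_iff.2 hQY : (Y : Set (Rd d)) ∈ ae Q)] with z hz using ⟨⟨z, hz⟩, rfl⟩
  have hne : Nonempty Y := by
    obtain ⟨z, i, -⟩ := hQ.exists
    exact ⟨i⟩
  have hqc : ∀ i : Y, c₀ ≤ Q.real {y i} := fun i => hQc _ i.2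
  have hq : ∀ i : Y, 0 < Q.real {y i} := fun i => hc0.trans_le (hqc i)
  have hq1 := sum_measureReal_eq_one hy hQ
  obtain ⟨g, hg⟩ := exists_integral_softmax_eq hXcompact hPX y hq hq1 hε
  obtain ⟨g₀, hg₀⟩ := exists_measureReal_cell_eq (hρpos _ hxM) hXcompact hup hy hq hq1
  have hone := ae_of_measureReal_le hXcompact hup (ae_sum_indicator_cell hXcompact hy g₀)
  have hTae := ae_eq_softmax_of_isEntropicMap hXcompact hPX hy hQ hq hε hg hT
  have hT₀ae := ae_eq_laguerreMap_of_isBrenierMap hXcompact hPX hy hQ hone hg₀ hT₀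
  have hφc := hφ.continuousOn hα0
  have hφ0 : 0 ≤ supNorm X φ := supNorm_nonneg
  have hφH : supNorm X φ ≤ holderNorm α X φ := supNorm_le_holderNorm
  have hlog : 0 ≤ Real.log (1 / ε) := Real.log_nonneg (one_le_one_div hε hε1.le)
  have hrhs1 : 0 ≤ supNorm X φ * ε ^ 2 * Real.log (1 / ε) ^ 3 := by positivity
  have hrhs2 : 0 ≤ holderNorm α X φ * ε ^ (1 + α) :=
    mul_nonneg (hφ0.trans hφH) (Real.rpow_nonneg hε.le _)
  rcases le_or_gt ε ε₀ with hεs | hεl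
  · have hint : ∫ x, inner ℝ (φ x) (T x - T₀ x) ∂P = ∑ i, ∫ x, inner ℝ (φ x) (y i) *
        (softmax y g ε i x - (cell y g₀ i).indicator 1 x) ∂P := by
      rw [← integral_finsetSum]
      · refine integral_congr_ae ?_
        filter_upwards [hTae, hT₀ae] with x h1 h2
        rw [h1, h2, laguerreMap, ← Finset.sum_sub_distrib, inner_sum]
        refine Finset.sum_congr rfl fun i _ => ?_
        rw [← sub_smul, inner_smul_right, mul_comm]
      · intro i _
        exact integrable_mul_densityMeasure hXcompact (hφc.inner continuousOn_const)
          ((continuous_softmax i).measurable.sub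
            (measurable_one.indicator (measurableSet_cell i)))
          (abs_softmax_sub_indicator_le g g₀ ε i)
    have hterm : ∀ i, |∫ x, inner ℝ (φ x) (y i) *
        (softmax y g ε i x - (cell y g₀ i).indicator 1 x) ∂P|
        ≤ C * R * (supNorm X φ * ε ^ 2 * Real.log (1 / ε) ^ 3
            + holderNorm α X φ * ε ^ (1 + α)) := by
      intro i
      refine (hmain _ hqc ε hε hεs g g₀ hg hg₀ α hα0 hα1 (fun x => inner ℝ (φ x) (y i))
        (hφc.inner continuousOn_const) (supNorm X φ * R) ((holderNorm α X φ - supNorm X φ) * R)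
        (by positivity) (mul_nonneg (sub_nonneg.2 hφH) hR0.le) (fun x hx => ?_)
        (fun x hx x' hx' => ?_) i).trans (le_of_eq ?_)
      · exact (abs_real_inner_le_norm _ _).trans
          (mul_le_mul (norm_le_supNorm hXcompact hφc hx) (hR i) (norm_nonneg _) hφ0)
      · rw [← inner_sub_left, mul_right_comm]
        exact (abs_real_inner_le_norm _ _).trans
          (mul_le_mul (hφ.norm_sub_le hx hx') (hR i) (norm_nonneg _)
            ((norm_nonneg _).trans (hφ.norm_sub_le hx hx')))
      · ring
    rw [hint]
    calc _ ≤ ∑ i : Y, C * R * (supNorm X φ * ε ^ 2 * Real.log (1 / ε) ^ 3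
            + holderNorm α X φ * ε ^ (1 + α)) :=
          (Finset.abs_sum_le_sum_abs _ _).trans (Finset.sum_le_sum fun i _ => hterm i)
      _ = Fintype.card Y * (C * R) * (supNorm X φ * ε ^ 2 * Real.log (1 / ε) ^ 3
            + holderNorm α X φ * ε ^ (1 + α)) := by
          rw [Finset.sum_const, Finset.card_univ, nsmul_eq_mul]
          ring
      _ ≤ _ := by
          refine mul_le_mul_of_nonneg_right ?_ (add_nonneg hrhs1 hrhs2)
          exact le_add_of_nonneg_right (by positivity)
  · -- For `ε` bounded below the right-hand side is at least a multiple of `‖φ‖_∞`.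
    have hbound : |∫ x, inner ℝ (φ x) (T x - T₀ x) ∂P| ≤ supNorm X φ * (R + R) := by
      have h := norm_integral_le_of_norm_le_const (μ := P)
        (f := fun x => (inner ℝ (φ x) (T x - T₀ x) : ℝ)) (C := supNorm X φ * (R + R)) ?_
      · simpa using h
      filter_upwards [hTae, hT₀ae, hPX, hone] with x h1 h2 hx hx1
      obtain ⟨k, hk⟩ := exists_mem_cell y g₀ x
      rw [h1, h2, laguerreMap_eq hx1 hk]
      refine (abs_real_inner_le_norm _ _).trans
        (mul_le_mul (norm_le_supNorm hXcompact hφc hx) ?_ (norm_nonneg _) hφ0)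
      exact (norm_sub_le _ _).trans (add_le_add (norm_sum_softmax_smul_le hR g ε x) (hR k))
    have hpow : ε₀ ^ 2 ≤ ε ^ (1 + α) := by
      calc ε₀ ^ 2 ≤ ε ^ 2 := by gcongr
        _ = ε ^ (2 : ℝ) := by rw [← Real.rpow_natCast]; norm_num
        _ ≤ ε ^ (1 + α) := Real.rpow_le_rpow_of_exponent_ge hε hε1.le (by linarith)
    calc _ ≤ supNorm X φ * (R + R) := hbound
      _ = 2 * R / ε₀ ^ 2 * (supNorm X φ * ε₀ ^ 2) := by field_simp; ring
      _ ≤ 2 * R / ε₀ ^ 2 * (holderNorm α X φ * ε ^ (1 + α)) := by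
          refine mul_le_mul_of_nonneg_left ?_ (by positivity)
          exact mul_le_mul hφH hpow (by positivity) (hφ0.trans hφH)
      _ ≤ _ := by
          refine mul_le_mul (le_add_of_nonneg_left (by positivity)) (by linarith) hrhs2
            (by positivity)
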